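/- Let $S$ be a locally Noetherian scheme and $n\ge 0$. A branchvariety of a scheme $Y$ over a field $k$ is a $k$-scheme $X$ of finite type such that $X\otimes_k\bar k$ is reduced, together with a finite morphism $X\to Y$ over $k$. A family of branchvarieties of $\mathbb P^n$ over $S$ is a morphism $f:X\to\mathbb P^n_S$ such that $X$ is proper and flat over $S$ and, for every $s\in S$ with residue field $\kappa(s)$, the induced morphism $f_s:X_s\to\mathbb P^n_{\kappa(s)}$ on fibers is a branchvariety of $\mathbb P^n_{\kappa(s)}$. If $f:X\to\mathbb P^n_S$ is a family of branchvarieties, then for every $s\in S$ the geometric fiber $X_s\otimes_{\kappa(s)}\overline{\kappa(s)}$ has finitely many connected components, and their number is a locally constant function of $s\in S$. This is unlike families of subschemes: there exist an $n$, a connected locally Noetherian scheme $S$ and a closed subscheme $Z\subset\mathbb P^n_S$, flat over $S$, such that the number of connected components of the geometric fiber $Z_s\otimes_{\kappa(s)}\overline{\kappa(s)}$ is not a locally constant function of $s\in S$. -/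

import Mathlib

open CategoryTheory CategoryTheory.Limits AlgebraicGeometry

universe u

namespace Branch

/-- Projective `n`-space over `ℤ`: `Proj ℤ[x₀, …, xₙ]` with the grading by degree. -/
noncomputable def projectiveSpaceInt (n : ℕ) : Scheme.{u} :=
  letI := MvPolynomial.gradedAlgebra (σ := Fin (n + 1)) (R := ULift.{u} ℤ)
  Proj (MvPolynomial.homogeneousSubmodule (Fin (n + 1)) (ULift.{u} ℤ))

/-- Projective `n`-space over a scheme `S`, i.e. `S × Proj ℤ[x₀, …, xₙ]`. -/
noncomputable def projectiveSpace (n : ℕ) (S : Scheme.{u}) : Scheme.{u} :=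
  pullback (terminal.from S) (terminal.from (projectiveSpaceInt.{u} n))

/-- The structure morphism of projective `n`-space over `S`. -/
noncomputable def projectiveSpaceToBase (n : ℕ) (S : Scheme.{u}) : projectiveSpace n S ⟶ S :=
  pullback.fst _ _

/-- For a scheme `X` over a field `k`, the base change of `X` to the algebraic closure of `k`. -/
noncomputable def overAlgClosure {k : Type u} [Field k] {X : Scheme.{u}} (q : X ⟶ Spec (.of k)) : Scheme.{u} :=
  pullback q (Spec.map (CommRingCat.ofHom (algebraMap k (AlgebraicClosure k))))

/-- For a scheme `Y` over a field `k` (with structure morphism `q`), a morphism `f : X ⟶ Y` is a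
branchvariety of `Y` if `f` is finite, and `X` is of finite type over `k` and becomes reduced
after base change to the algebraic closure of `k`. -/
structure IsBranchvariety {k : Type u} [Field k] {X Y : Scheme.{u}} (f : X ⟶ Y)
    (q : Y ⟶ Spec (.of k)) : Prop where
  isFinite : IsFinite f
  locallyOfFiniteType : LocallyOfFiniteType (f ≫ q)
  quasiCompact : QuasiCompact (f ≫ q)
  isReduced : IsReduced (overAlgClosure (f ≫ q))

/-- The morphism `f_s : X_s ⟶ Y_s` induced on the fibers over `s : S` by a morphism `f : X ⟶ Y`
of schemes over `S`, where `p : Y ⟶ S` is the structure morphism of `Y`. -/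
noncomputable def fiberMap {S X Y : Scheme.{u}} (f : X ⟶ Y) (p : Y ⟶ S) (s : S) :
    (f ≫ p).fiber s ⟶ p.fiber s :=
  pullback.map (f ≫ p) (S.fromSpecResidueField s) p (S.fromSpecResidueField s) f (𝟙 _) (𝟙 _)
    (by simp) (by simp)

/-- A (flat, proper) family of branchvarieties `f : X ⟶ Y` over `S`, where `p : Y ⟶ S` is the
structure morphism of `Y`: `X` is proper and flat over `S`, and for every `s : S` the morphism
`f_s : X_s ⟶ Y_s` is a branchvariety of `Y_s`. -/
structure IsBranchFamily {S X Y : Scheme.{u}} (f : X ⟶ Y) (p : Y ⟶ S) : Prop where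
  isProper : IsProper (f ≫ p)
  flat : Flat (f ≫ p)
  fiber : ∀ s : S, IsBranchvariety (k := S.residueField s) (fiberMap f p s)
    (p.fiberToSpecResidueField s)

/-- A family of closed subschemes of `Y` over `S` (`p : Y ⟶ S` the structure morphism of `Y`):
a closed immersion `i : X ⟶ Y` with `X` proper and flat over `S`. -/
structure IsSubschemeFamily {S X Y : Scheme.{u}} (i : X ⟶ Y) (p : Y ⟶ S) : Prop where
  isClosedImmersion : IsClosedImmersion i
  isProper : IsProper (i ≫ p)
  flat : Flat (i ≫ p)

/-- The geometric fiber of `π : X ⟶ S` over `s`: the fiber `X_s`, base changed from the residue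
field of `s` to its algebraic closure. -/
noncomputable def geometricFiber {S X : Scheme.{u}} (π : X ⟶ S) (s : S) : Scheme.{u} :=
  overAlgClosure (k := S.residueField s) (π.fiberToSpecResidueField s)

/-- The number (possibly `⊤`) of connected components of the geometric fiber of `π` over `s`. -/
noncomputable def numGeometricComponents {S X : Scheme.{u}} (π : X ⟶ S) (s : S) : ℕ∞ :=
  ENat.card (_root_.ConnectedComponents (geometricFiber π s))

end Branch

/-!
The number of geometric connected components of a family of branchvarieties is shown to be
invariant under specialization `t ⤳ s`; on a locally Noetherian base this implies that it is locally
constant (`isLocallyConstant_of_specializes`).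

The base may be replaced by the Noetherian local ring `R` at `s`. A proper morphism with finite
fibers is finite, so the total space `T` is finite over projective space over `R`, and it is covered
by the preimages `U i` of the standard charts, on which there are functions `z i j = x j / x i`. For
a reduced scheme over an algebraically closed field whose ring of functions is finite-dimensional,
the number of connected components is the dimension of that ring
(`card_connectedComponents_eq_finrank`). So one has to see that the dimension of the space of
functions on the geometric fiber does not change from `s` to `t`.

The functions on a base change of `T` to a field `K` are the compatible families in
`∏ i, K ⊗ Γ(U i)`. They are the kernel of a linear map between finite free `R`-modules, base changed
to `K`, by an elementary form of Serre's theorem on twisted sections: there is a graded module `M`,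
generated in bounded degree, from which all charts are obtained by inverting a variable
(`IsChartSystem`). For large `d` the module `M d` is free (`IsChartSystem.eventually_free`), and it
consists of the compatible families of sections of `𝒪(d)` on the charts
(`IsChartSystem.eventually_saturated`).
Hence the compatible families of functions are the kernel of
`crossDiff x d : (ι → M d) → (ι × ι → M (2 d))`, which sends `b` to the family of all
`x j ^ d * b i - x i ^ d * b j`, and this remains true after base change to a Noetherian ring.

Let `k` be the residue field of `R`. The kernel has the same dimension over all fields over `R` as
soon as every element of the kernel over `k` lifts to the kernel over `R`, for then the image of
`crossDiff` is a direct summand (`finrank_ker_baseChange_add`). By the Artin–Rees lemma it suffices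
to lift modulo every power of the maximal ideal (`exists_sub_mem_and_map_eq_zero`). Here reducedness
enters: a function `u` on the special fiber has a separable minimal polynomial over `k`
(`separable_minpoly_of_isReduced`), so it is a simple root of a polynomial with coefficients in `R`.
By Hensel's lemma it lifts uniquely to a root on each chart modulo a power of the maximal ideal, and
by uniqueness these lifts agree on the overlaps (`exists_sub_mem_and_map_sub_map_mem`).

Closed subschemes behave differently: in the projective line over `ℤ`, the union of the sections
`x = 0` and `x = 2` is flat over `ℤ`, but these sections meet precisely over the prime `2`, where the
fiber is a double point (`numGeometricComponents_quadratic_le_one_iff`).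
-/

namespace Branch

/-! ### Graded modules as systems of submodules -/

section Graded

variable {R T ι : Type*} [CommRing R] [AddCommGroup T] [Module R T]

theorem pow_apply_eq_zero_of_le {f : Module.End R T} {t : T} {N N' : ℕ} (h : N ≤ N')
    (ht : (f ^ N) t = 0) : (f ^ N') t = 0 := by
  rw [← Nat.sub_add_cancel h, pow_add, Module.End.mul_apply, ht, map_zero]

/-- `A d` are the graded pieces of a graded module, inside an ambient module `T`, over the polynomial
ring in the variables `ι`, which act through the commuting operators `X i`. The pieces are finitely
generated, and the module is generated in bounded degree. -/
structure IsGradedSystem (X : ι → Module.End R T) (A : ℕ → Submodule R T) : Prop where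
  comm : ∀ i j, Commute (X i) (X j)
  map_le : ∀ i d, (A d).map (X i) ≤ A (d + 1)
  indep : iSupIndep A
  fg : ∀ d, (A d).FG
  gen : ∃ d₁, ∀ d ≥ d₁, A (d + 1) ≤ ⨆ i, (A d).map (X i)

/-- `P d` are the graded pieces of a graded submodule of the graded module with pieces `A d`. -/
structure IsStable (X : ι → Module.End R T) (A P : ℕ → Submodule R T) : Prop where
  le : ∀ d, P d ≤ A d
  map_le : ∀ i d, (P d).map (X i) ≤ P (d + 1)

variable {X : ι → Module.End R T} {A P Q : ℕ → Submodule R T}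

theorem IsStable.mem (hP : IsStable X A P) (i : ι) {d : ℕ} {t : T} (ht : t ∈ P d) :
    X i t ∈ P (d + 1) := hP.map_le i d ⟨t, ht, rfl⟩

theorem IsStable.pow_mem (hP : IsStable X A P) (i : ι) {d : ℕ} {t : T} (ht : t ∈ P d) (N : ℕ) :
    (X i ^ N) t ∈ P (d + N) := by
  induction N with
  | zero => simpa
  | succ N ih => rw [pow_succ', Module.End.mul_apply]; exact hP.mem i ih

theorem IsGradedSystem.isStable (hA : IsGradedSystem X A) : IsStable X A A :=
  ⟨fun _ => le_rfl, hA.map_le⟩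

theorem IsGradedSystem.pow_comm_apply (hA : IsGradedSystem X A) (i j : ι) (a b : ℕ) (t : T) :
    (X i ^ a) ((X j ^ b) t) = (X j ^ b) ((X i ^ a) t) := by
  rw [← Module.End.mul_apply, ← Module.End.mul_apply, ((hA.comm i j).pow_pow a b).eq]

theorem iSup_inf_le_of_iSupIndep (hA : iSupIndep A) (h : ∀ d, P d ≤ A d) (d : ℕ) :
    (⨆ e, P e) ⊓ A d ≤ P d := by
  rintro x ⟨hx, hxd⟩
  rw [SetLike.mem_coe, iSup_split_single P d] at hx
  obtain ⟨p, hp, q, hq, rfl⟩ := Submodule.mem_sup.1 hx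
  have hq' : q ∈ ⨆ (e) (_ : e ≠ d), A e := (iSup₂_mono fun e _ => h e) hq
  have hqd : q ∈ A d := by
    have := (A d).sub_mem hxd (h d hp)
    rwa [add_sub_cancel_left] at this
  have : q = 0 := by
    have := (hA d).le_bot ⟨hqd, hq'⟩
    simpa using this
  rw [this, add_zero]; exact hp

/-- The graded submodule of `Q` generated by its pieces of degree at most `e`. -/
def truncGen (X : ι → Module.End R T) (Q : ℕ → Submodule R T) (e : ℕ) : ℕ → Submodule R T
  | 0 => Q 0
  | d + 1 => if d + 1 ≤ e then Q (d + 1) else ⨆ i, (truncGen X Q e d).map (X i)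

theorem truncGen_of_le {d e : ℕ} (h : d ≤ e) : truncGen X Q e d = Q d := by
  cases d with
  | zero => rfl
  | succ d => rw [truncGen, if_pos h]

theorem truncGen_succ {d e : ℕ} (h : e ≤ d) :
    truncGen X Q e (d + 1) = ⨆ i, (truncGen X Q e d).map (X i) := by
  rw [truncGen, if_neg (by omega)]

theorem truncGen_le (hQ : IsStable X A Q) (e d : ℕ) : truncGen X Q e d ≤ Q d := by
  induction d with
  | zero => exact le_rfl
  | succ d ih =>
    rcases le_or_gt (d + 1) e with h | h
    · rw [truncGen_of_le h]
    · rw [truncGen_succ (by omega)]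
      exact iSup_le fun i => (Submodule.map_mono ih).trans (hQ.map_le i d)

theorem truncGen_isStable (hQ : IsStable X A Q) (e : ℕ) : IsStable X A (truncGen X Q e) := by
  refine ⟨fun d => (truncGen_le hQ e d).trans (hQ.le d), fun i d => ?_⟩
  rcases le_or_gt (d + 1) e with h | h
  · rw [truncGen_of_le h, truncGen_of_le (by omega)]; exact hQ.map_le i d
  · rw [truncGen_succ (by omega)]; exact le_iSup (fun i => (truncGen X Q e d).map (X i)) i

theorem truncGen_mono (hQ : IsStable X A Q) {e e' : ℕ} (h : e ≤ e') (d : ℕ) :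
    truncGen X Q e d ≤ truncGen X Q e' d := by
  induction d with
  | zero => exact le_rfl
  | succ d ih =>
    rcases le_or_gt (d + 1) e' with h' | h'
    · rw [truncGen_of_le h']; exact truncGen_le hQ _ _
    · rw [truncGen_succ (by omega), truncGen_succ (by omega)]
      exact iSup_mono fun i => Submodule.map_mono ih

open scoped IsMulCommutative in
/-- Noetherianity of graded systems: a subfamily stable under the operators is generated in
bounded degree. The sum of the system is a finite module over the commutative algebra generated
by the operators, which is Noetherian by Hilbert's basis theorem. -/
theorem IsStable.gen [IsNoetherianRing R] [Finite ι] (hA : IsGradedSystem X A)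
    (hQ : IsStable X A Q) : ∃ e, ∀ d ≥ e, Q (d + 1) ≤ ⨆ i, (Q d).map (X i) := by
  classical
  let S := Algebra.adjoin R (Set.range X)
  have hcomm : IsMulCommutative S := Algebra.isMulCommutative_adjoin R (by
    rintro _ ⟨i, rfl⟩ _ ⟨j, rfl⟩; exact (hA.comm i j).eq)
  have : Algebra.FiniteType R S :=
    (Subalgebra.fg_iff_finiteType S).1 ⟨(Set.finite_range X).toFinset, by simp [S]⟩
  have : IsNoetherianRing S := Algebra.FiniteType.isNoetherianRing R S
  -- the sum of the pieces of a graded submodule is a module over `S`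
  let lift : ∀ P : ℕ → Submodule R T, IsStable X A P → Submodule S T := fun P hP =>
    { (⨆ d, P d : Submodule R T) with
      smul_mem' := by
        rintro ⟨s, hs⟩ t ht
        change s t ∈ (⨆ d, P d : Submodule R T)
        change t ∈ (⨆ d, P d : Submodule R T) at ht
        induction hs using Algebra.adjoin_induction generalizing t with
        | mem s hs =>
          obtain ⟨i, rfl⟩ := hs
          have : (⨆ d, P d : Submodule R T).map (X i) ≤ ⨆ d, P d := by
            rw [Submodule.map_iSup]
            exact iSup_le fun d => (hP.map_le i d).trans (le_iSup P (d + 1))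
          exact this ⟨t, ht, rfl⟩
        | algebraMap r => exact Submodule.smul_mem _ r ht
        | add a b _ _ ha hb => exact Submodule.add_mem _ (ha ht) (hb ht)
        | mul a b _ _ ha hb => exact ha (hb ht) }
  have mem_lift : ∀ P hP t, t ∈ lift P hP ↔ t ∈ (⨆ d, P d : Submodule R T) := fun _ _ _ => Iff.rfl
  obtain ⟨d₁, hd₁⟩ := hA.gen
  have hfg : (lift A hA.isStable).FG := by
    choose s hs using hA.fg
    refine ⟨(Finset.range (d₁ + 1)).biUnion s, le_antisymm ?_ ?_⟩
    · refine Submodule.span_le.2 fun t ht => ?_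
      simp only [Finset.coe_biUnion, Set.mem_iUnion] at ht
      obtain ⟨d, -, hd⟩ := ht
      refine (mem_lift A hA.isStable t).2 (le_iSup A d ?_)
      rw [← hs d]; exact Submodule.subset_span hd
    · set W := Submodule.span S (((Finset.range (d₁ + 1)).biUnion s : Finset T) : Set T)
      have key : ∀ d, A d ≤ W.restrictScalars R := by
        intro d
        induction d with
        | zero =>
          rw [← hs 0, Submodule.span_le]
          intro t ht
          refine Submodule.subset_span ?_
          simp only [Finset.coe_biUnion, Set.mem_iUnion]
          exact ⟨0, by simp, ht⟩
        | succ d ih =>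
          rcases le_or_gt (d + 1) d₁ with h | h
          · rw [← hs (d + 1), Submodule.span_le]
            intro t ht
            refine Submodule.subset_span ?_
            simp only [Finset.coe_biUnion, Set.mem_iUnion]
            exact ⟨d + 1, by simpa using by omega, ht⟩
          · refine (hd₁ d (by omega)).trans (iSup_le fun i => ?_)
            rintro _ ⟨t, ht, rfl⟩
            exact W.smul_mem (⟨X i, Algebra.subset_adjoin ⟨i, rfl⟩⟩ : S) (ih ht)
      intro t ht
      exact (iSup_le key) ((mem_lift A hA.isStable t).1 ht)
  have hN : IsNoetherian S (lift A hA.isStable) := isNoetherian_of_fg_of_noetherian _ hfg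
  let c : ℕ →o Submodule S (lift A hA.isStable) :=
    { toFun := fun e => (lift _ (truncGen_isStable hQ e)).comap (lift A hA.isStable).subtype
      monotone' := by
        intro e e' h t ht
        change (t : T) ∈ (⨆ d, truncGen X Q e d : Submodule R T) at ht
        change (t : T) ∈ (⨆ d, truncGen X Q e' d : Submodule R T)
        exact (iSup_mono (truncGen_mono hQ h)) ht }
  obtain ⟨n, hn⟩ := monotone_stabilizes_iff_noetherian.2 hN c
  have key : ∀ d, Q d ≤ truncGen X Q n d := by
    intro d t ht
    refine iSup_inf_le_of_iSupIndep hA.indep (truncGen_isStable hQ n).le d ⟨?_, hQ.le d ht⟩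
    have htA : t ∈ lift A hA.isStable := (mem_lift A hA.isStable t).2 (le_iSup A d (hQ.le d ht))
    have h1 : (⟨t, htA⟩ : lift A hA.isStable) ∈ c (max n d) := by
      refine (mem_lift _ (truncGen_isStable hQ (max n d)) t).2
        (le_iSup (truncGen X Q (max n d)) d ?_)
      rwa [truncGen_of_le (le_max_right _ _)]
    rw [← hn _ (le_max_left _ _)] at h1
    exact h1
  refine ⟨n, fun d hd => (key (d + 1)).trans ?_⟩
  rw [truncGen_succ hd]
  exact iSup_mono fun i => Submodule.map_mono (truncGen_le hQ n d)

theorem IsStable.fg [IsNoetherianRing R] (hA : IsGradedSystem X A) (hQ : IsStable X A Q) (d : ℕ) :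
    (Q d).FG := by
  have := isNoetherian_of_fg_of_noetherian _ (hA.fg d)
  exact Submodule.FG.of_le (hA.fg d) (hQ.le d)

/-- The elements which all words of length `k` in the operators send from degree `d` into `P`, i.e.
into `P (d + k)`. -/
def killedBy (X : ι → Module.End R T) (P : ℕ → Submodule R T) : ℕ → ℕ → Submodule R T
  | 0, d => P d
  | k + 1, d => ⨅ i, (killedBy X P k (d + 1)).comap (X i)

theorem killedBy_le_succ (hP : IsStable X A P) (k d : ℕ) :
    killedBy X P k d ≤ killedBy X P (k + 1) d := by
  induction k generalizing d with
  | zero => exact le_iInf fun i => Submodule.map_le_iff_le_comap.1 (hP.map_le i d)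
  | succ k ih => exact iInf_mono fun i => Submodule.comap_mono (ih (d + 1))

theorem killedBy_mono (hP : IsStable X A P) {k k' : ℕ} (h : k ≤ k') (d : ℕ) :
    killedBy X P k d ≤ killedBy X P k' d :=
  monotone_nat_of_le_succ (f := fun k => killedBy X P k d) (fun k => killedBy_le_succ hP k d) h

/-- If the power `X i ^ c i` sends `q` into `P` for each `i`, then so does every word in the operators
which is longer than the sum of the `c i`. -/
theorem mem_killedBy_of_pow_mem [Fintype ι] (hA : IsGradedSystem X A) (hP : IsStable X A P)
    (k : ℕ) (c : ι → ℕ) (hc : ∑ i, c i < k) (d : ℕ) (q : T)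
    (h : ∀ i, (X i ^ c i) q ∈ P (d + c i)) : q ∈ killedBy X P k d := by
  classical
  induction k generalizing c d q with
  | zero => omega
  | succ k ih =>
    refine (Submodule.mem_iInf _).2 fun i => ?_
    change X i q ∈ killedBy X P k (d + 1)
    -- apply the induction hypothesis to `X i q`, for which the exponent `c i` drops by one
    rcases Nat.eq_zero_or_pos (c i) with h0 | h0
    · have hq := h i
      rw [h0, pow_zero] at hq
      exact killedBy_mono hP (Nat.zero_le k) _ (hP.mem i hq)
    · refine ih (Function.update c i (c i - 1)) ?_ _ _ fun j => ?_
      · have := Finset.sum_update_of_mem (Finset.mem_univ i) c (c i - 1)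
        have h2 := Finset.add_sum_erase _ c (Finset.mem_univ i)
        rw [← Finset.sdiff_singleton_eq_erase] at h2
        omega
      · by_cases hj : j = i
        · subst hj
          have := h j
          obtain ⟨n, hn⟩ : ∃ n, c j = n + 1 := ⟨c j - 1, by omega⟩
          rw [hn, pow_succ, Module.End.mul_apply] at this
          rw [Function.update_self, hn, Nat.add_sub_cancel]
          rwa [add_right_comm, add_assoc]
        · rw [Function.update_of_ne hj]
          have := hP.mem i (h j)
          rw [add_right_comm]
          have e := hA.pow_comm_apply j i (c j) 1 q
          rw [pow_one] at e
          rwa [e]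

/-- In a graded system over a Noetherian ring, a stable subfamily all of whose elements are
torsion modulo a smaller one agrees with it in large degree. -/
theorem IsStable.eventually_le [IsNoetherianRing R] [Finite ι] (hA : IsGradedSystem X A)
    (hP : IsStable X A P) (hQ : IsStable X A Q)
    (h : ∀ d, ∀ q ∈ Q d, ∀ i, ∃ N, (X i ^ N) q ∈ P (d + N)) :
    ∃ d₀, ∀ d ≥ d₀, Q d ≤ P d := by
  cases nonempty_fintype ι
  obtain ⟨e, he⟩ := hQ.gen hA
  obtain ⟨s, hs⟩ := hQ.fg hA e
  have hk : ∃ k, ∀ q ∈ s, q ∈ killedBy X P k e := by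
    have : ∀ q ∈ s, ∃ k, q ∈ killedBy X P k e := by
      intro q hq
      choose c hc using h e q (by rw [← hs]; exact Submodule.subset_span hq)
      exact ⟨_, mem_killedBy_of_pow_mem hA hP _ c (Nat.lt_succ_self _) e q hc⟩
    choose! k hk using this
    exact ⟨s.sup k, fun q hq => killedBy_mono hP (Finset.le_sup hq) _ (hk q hq)⟩
  obtain ⟨k, hk⟩ := hk
  have key : ∀ j, Q (e + j) ≤ killedBy X P (k - j) (e + j) := by
    intro j
    induction j with
    | zero =>
      rw [Nat.add_zero, Nat.sub_zero, ← hs]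
      exact Submodule.span_le.2 hk
    | succ j ih =>
      refine (he (e + j) (by omega)).trans (iSup_le fun i => ?_)
      rintro _ ⟨q, hq, rfl⟩
      have hq' := ih hq
      rcases Nat.eq_zero_or_pos (k - j) with h0 | h0
      · rw [h0] at hq'
        exact killedBy_mono hP (Nat.zero_le _) _ (hP.mem i hq')
      · obtain ⟨n, hn⟩ : ∃ n, k - j = n + 1 := ⟨k - j - 1, by omega⟩
        rw [hn] at hq'
        rw [show k - (j + 1) = n by omega]
        exact (Submodule.mem_iInf _).1 hq' i
  refine ⟨e + k, fun d hd => ?_⟩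
  have := key (d - e)
  rwa [show e + (d - e) = d by omega, show k - (d - e) = 0 by omega] at this

/-- Elements of `P` killed by a power of the `i`-th operator. -/
def torsionPart (X : ι → Module.End R T) (P : ℕ → Submodule R T) (i : ι) (d : ℕ) :
    Submodule R T where
  carrier := {t | t ∈ P d ∧ ∃ N, (X i ^ N) t = 0}
  zero_mem' := ⟨(P d).zero_mem, 0, by simp⟩
  add_mem' := by
    rintro a b ⟨ha, N, hN⟩ ⟨hb, N', hN'⟩
    exact ⟨(P d).add_mem ha hb, N + N', by
      rw [map_add, pow_apply_eq_zero_of_le (Nat.le_add_right N N') hN,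
        pow_apply_eq_zero_of_le (Nat.le_add_left N' N) hN', add_zero]⟩
  smul_mem' := by
    rintro r a ⟨ha, N, hN⟩
    exact ⟨(P d).smul_mem r ha, N, by rw [map_smul, hN, smul_zero]⟩

theorem torsionPart_isStable (hA : IsGradedSystem X A) (hP : IsStable X A P) (i : ι) :
    IsStable X A (torsionPart X P i) where
  le d _ ht := hP.le d ht.1
  map_le := by
    rintro j d _ ⟨t, ⟨ht, N, hN⟩, rfl⟩
    refine ⟨hP.mem j ht, N, ?_⟩
    have e := hA.pow_comm_apply i j N 1 t
    rw [pow_one] at e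
    rw [e, hN, map_zero]

/-- Elements of `Q` that are torsion modulo `P` for each operator. -/
def saturation (X : ι → Module.End R T) (Q P : ℕ → Submodule R T) (hP : IsStable X A P) (d : ℕ) :
    Submodule R T where
  carrier := {t | t ∈ Q d ∧ ∀ i, ∃ N, (X i ^ N) t ∈ P (d + N)}
  zero_mem' := ⟨(Q d).zero_mem, fun i => ⟨0, by simp⟩⟩
  add_mem' := by
    rintro a b ⟨ha, ha'⟩ ⟨hb, hb'⟩
    refine ⟨(Q d).add_mem ha hb, fun i => ?_⟩
    obtain ⟨N, hN⟩ := ha' i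
    obtain ⟨N', hN'⟩ := hb' i
    refine ⟨N + N', ?_⟩
    rw [map_add]
    refine (P _).add_mem ?_ ?_
    · have := hP.pow_mem i hN N'
      rwa [← Module.End.mul_apply, ← pow_add, add_comm N' N, add_assoc] at this
    · have := hP.pow_mem i hN' N
      rwa [← Module.End.mul_apply, ← pow_add, add_assoc, add_comm N' N] at this
  smul_mem' := by
    rintro r a ⟨ha, ha'⟩
    refine ⟨(Q d).smul_mem r ha, fun i => ?_⟩
    obtain ⟨N, hN⟩ := ha' i
    exact ⟨N, by rw [map_smul]; exact (P _).smul_mem r hN⟩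

theorem saturation_isStable (hA : IsGradedSystem X A) (hP : IsStable X A P)
    (hQ : IsStable X A Q) : IsStable X A (saturation X Q P hP) where
  le d _ ht := hQ.le d ht.1
  map_le := by
    rintro j d _ ⟨t, ⟨ht, h⟩, rfl⟩
    refine ⟨hQ.mem j ht, fun i => ?_⟩
    obtain ⟨N, hN⟩ := h i
    refine ⟨N, ?_⟩
    have e := hA.pow_comm_apply i j N 1 t
    rw [pow_one] at e
    rw [e, add_right_comm]
    exact hP.mem j hN

theorem bot_isStable : IsStable X A (fun _ => ⊥) :=
  ⟨fun _ => bot_le, fun i d => by simp⟩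

/-- In large degree, a graded module over a Noetherian ring has no element which is killed by a power
of each variable. -/
theorem IsGradedSystem.eventually_torsionFree [IsNoetherianRing R] [Finite ι]
    (hA : IsGradedSystem X A) :
    ∃ d₀, ∀ d ≥ d₀, ∀ m ∈ A d, (∀ i, ∃ N, (X i ^ N) m = 0) → m = 0 := by
  obtain ⟨d₀, h⟩ := IsStable.eventually_le hA bot_isStable
    (saturation_isStable hA (bot_isStable (A := A)) hA.isStable) (fun d q hq i => hq.2 i)
  exact ⟨d₀, fun d hd m hm hm' => by simpa using h d hd ⟨hm, by simpa using hm'⟩⟩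

/-- The graded submodule `X a • P + torsionPart X P a`. -/
def mulAddTorsion (X : ι → Module.End R T) (P : ℕ → Submodule R T) (a : ι) : ℕ → Submodule R T
  | 0 => torsionPart X P a 0
  | d + 1 => (P d).map (X a) ⊔ torsionPart X P a (d + 1)

theorem mulAddTorsion_isStable (hA : IsGradedSystem X A) (hP : IsStable X A P) (a : ι) :
    IsStable X A (mulAddTorsion X P a) where
  le d := by
    cases d with
    | zero => exact (torsionPart_isStable hA hP a).le 0
    | succ d =>
      exact sup_le ((hP.map_le a d).trans (hP.le _)) ((torsionPart_isStable hA hP a).le _)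
  map_le i d := by
    cases d with
    | zero => exact ((torsionPart_isStable hA hP a).map_le i 0).trans le_sup_right
    | succ d =>
      change (_ ⊔ _ : Submodule R T).map _ ≤ _
      rw [Submodule.map_sup]
      refine sup_le ?_ (((torsionPart_isStable hA hP a).map_le i _).trans le_sup_right)
      rintro _ ⟨_, ⟨t, ht, rfl⟩, rfl⟩
      refine Submodule.mem_sup_left ⟨X i t, hP.mem i ht, ?_⟩
      have e := hA.pow_comm_apply i a 1 1 t
      rw [pow_one, pow_one] at e
      exact e.symm

/-- In large degree `d`, an element `t` of degree `d + N` is divisible by `X a ^ N` up to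
`X a`-torsion, provided that it becomes so after multiplication with a power of each variable. -/
theorem exists_division [IsNoetherianRing R] [Finite ι] (hA : IsGradedSystem X A)
    (hP : IsStable X A P) (a : ι) :
    ∃ d₀, ∀ d ≥ d₀, ∀ N, ∀ t ∈ P (d + N),
      (∀ j, ∃ L, ∃ s ∈ P (d + L), (X a ^ N) s - (X j ^ L) t ∈ torsionPart X P a (d + N + L)) →
      ∃ s ∈ P d, (X a ^ N) s - t ∈ torsionPart X P a (d + N) := by
  have hT := torsionPart_isStable hA hP a
  have hM := mulAddTorsion_isStable hA hP a
  obtain ⟨d₀, h₀⟩ := IsStable.eventually_le hA hM (saturation_isStable hA hM hP)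
    (fun d q hq i => hq.2 i)
  refine ⟨d₀, fun d hd N => ?_⟩
  induction N with
  | zero =>
    intro t ht _
    exact ⟨t, ht, by simp⟩
  | succ N ih =>
    intro t ht h
    have h1 : t ∈ saturation X P (mulAddTorsion X P a) hM (d + N + 1) := by
      refine ⟨ht, fun j => ?_⟩
      obtain ⟨L, s, hs, hL⟩ := h j
      refine ⟨L, ?_⟩
      have e : (X j ^ L) t = X a ((X a ^ N) s) - ((X a ^ (N + 1)) s - (X j ^ L) t) := by
        rw [pow_succ', Module.End.mul_apply, sub_sub_cancel]
      have e2 : d + N + 1 + L = (d + L + N) + 1 := by omega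
      rw [e, e2]
      refine Submodule.sub_mem _ (Submodule.mem_sup_left ⟨_, hP.pow_mem a hs N, rfl⟩)
        (Submodule.mem_sup_right ?_)
      rwa [← e2]
    obtain ⟨_, ⟨t₁, ht₁, rfl⟩, t', ht', rfl⟩ := Submodule.mem_sup.1 (h₀ _ (by omega) h1)
    obtain ⟨s, hs, hs'⟩ := ih t₁ ht₁ (fun j => by
      obtain ⟨L, s, hs, hL⟩ := h j
      refine ⟨L, s, hs, ?_⟩
      have hmem : (X a ^ N) s - (X j ^ L) t₁ ∈ P (d + N + L) := by
        refine Submodule.sub_mem _ ?_ (hP.pow_mem j ht₁ L)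
        rw [add_right_comm]; exact hP.pow_mem a hs N
      have e := hA.pow_comm_apply j a L 1 t₁
      rw [pow_one] at e
      have h3 : X a ((X a ^ N) s - (X j ^ L) t₁) ∈ torsionPart X P a (d + (N + 1) + L) := by
        have : X a ((X a ^ N) s - (X j ^ L) t₁)
            = ((X a ^ (N + 1)) s - (X j ^ L) (X a t₁ + t')) + (X j ^ L) t' := by
          rw [map_add, e, map_sub, pow_succ', Module.End.mul_apply]; abel
        rw [this]
        exact Submodule.add_mem _ hL (hT.pow_mem j ht' L)
      obtain ⟨-, K, hK⟩ := h3
      exact ⟨hmem, K + 1, by rw [pow_succ, Module.End.mul_apply, hK]⟩)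
    refine ⟨s, hs, ?_⟩
    have : (X a ^ (N + 1)) s - (X a t₁ + t') = X a ((X a ^ N) s - t₁) - t' := by
      rw [map_sub, pow_succ', Module.End.mul_apply]; abel
    rw [this]
    exact Submodule.sub_mem _ (hT.mem a hs') ht'

/-- The existence of sections for graded submodules that are torsion for the variables outside `J`,
by induction on `J`: a section is divided by a power of one variable `a ∈ J`, and the error is a
section of the `X a`-torsion. -/
theorem IsStable.exists_section_aux [IsNoetherianRing R] [Finite ι] (hA : IsGradedSystem X A)
    (J : Finset ι) : ∀ P : ℕ → Submodule R T, IsStable X A P →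
      (∀ j ∉ J, ∀ d, ∀ t ∈ P d, ∃ K, (X j ^ K) t = 0) →
      ∃ d₀, ∀ d ≥ d₀, ∀ N, ∀ m : ι → T, (∀ i, m i ∈ P (d + N)) →
        (∀ i j, (X j ^ N) (m i) = (X i ^ N) (m j)) →
        ∃ s ∈ P d, ∀ i, ∃ K, (X i ^ K) ((X i ^ N) s - m i) = 0 := by
  classical
  induction J using Finset.induction_on with
  | empty =>
    intro P hP hJ
    refine ⟨0, fun d _ N m hm _ => ⟨0, (P d).zero_mem, fun i => ?_⟩⟩
    obtain ⟨K, hK⟩ := hJ i (by simp) _ _ (hm i)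
    exact ⟨K, by rw [map_zero, zero_sub, map_neg, hK, neg_zero]⟩
  | insert a J _ ih =>
    intro P hP hJ
    have hT := torsionPart_isStable hA hP a
    obtain ⟨d₀, h₀⟩ := exists_division hA hP a
    obtain ⟨d₁, h₁⟩ := ih _ hT (fun j hj d t ht => by
      by_cases hja : j = a
      · subst hja; exact ht.2
      · exact hJ j (by simp [hja, hj]) d t ht.1)
    refine ⟨max d₀ d₁, fun d hd N m hm hmm => ?_⟩
    obtain ⟨s, hs, hs'⟩ := h₀ d (le_trans (le_max_left _ _) hd) N (m a) (hm a)
      (fun j => ⟨N, m j, hm j, by rw [hmm, sub_self]; exact Submodule.zero_mem _⟩)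
    have h2 : ∀ j, m j - (X j ^ N) s ∈ torsionPart X P a (d + N) := by
      intro j
      obtain ⟨-, K, hK⟩ := hs'
      refine ⟨Submodule.sub_mem _ (hm j) (hP.pow_mem j hs N), K + N, ?_⟩
      have : (X a ^ N) (m j - (X j ^ N) s) = - (X j ^ N) ((X a ^ N) s - m a) := by
        rw [map_sub, map_sub, hA.pow_comm_apply a j, hmm j a]; abel
      rw [pow_add, Module.End.mul_apply, this, map_neg, hA.pow_comm_apply a j, hK, map_zero,
        neg_zero]
    obtain ⟨s', hs₁, hK⟩ := h₁ d (le_trans (le_max_right _ _) hd) N _ h2 (fun i j => by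
      rw [map_sub, map_sub, hmm, hA.pow_comm_apply j i])
    refine ⟨s + s', (P d).add_mem hs hs₁.1, fun i => ?_⟩
    obtain ⟨K, hK⟩ := hK i
    refine ⟨K, ?_⟩
    rw [← hK, map_add]; congr 1; abel

/-- In large degree, every section of a graded system over a Noetherian ring (given by compatible
fractions `m i / X i ^ N`) comes from an element of the system. -/
theorem IsGradedSystem.exists_section [IsNoetherianRing R] [Finite ι] (hA : IsGradedSystem X A) :
    ∃ d₀, ∀ d ≥ d₀, ∀ N, ∀ m : ι → T, (∀ i, m i ∈ A (d + N)) →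
      (∀ i j, (X j ^ N) (m i) = (X i ^ N) (m j)) →
      ∃ s ∈ A d, ∀ i, ∃ K, (X i ^ K) ((X i ^ N) s - m i) = 0 := by
  cases nonempty_fintype ι
  exact IsStable.exists_section_aux hA Finset.univ A hA.isStable (fun j hj => by simp at hj)

end Graded
end Branch

namespace Branch

/-! ### Sequential colimits and tensor products -/

section SeqColim

open TensorProduct

variable {R : Type*} [CommRing R] {N : ℕ → Type*} [∀ d, AddCommGroup (N d)] [∀ d, Module R (N d)]
  {C : Type*} [AddCommGroup C] [Module R C]

/-- The composite `N d → N (d + 1) → ⋯ → N (d + n)` of transition maps. -/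
def iterTrans (t : ∀ d, N d →ₗ[R] N (d + 1)) (d : ℕ) : ∀ n, N d →ₗ[R] N (d + n)
  | 0 => LinearMap.id
  | n + 1 => t (d + n) ∘ₗ iterTrans t d n

/-- `C` is the colimit of the sequence of modules `N 0 → N 1 → ⋯`, in elementary terms. -/
structure IsSeqColim (t : ∀ d, N d →ₗ[R] N (d + 1)) (f : ∀ d, N d →ₗ[R] C) : Prop where
  comp_trans : ∀ d, f (d + 1) ∘ₗ t d = f d
  surj : ∀ c, ∃ d m, f d m = c
  ker : ∀ d m, f d m = 0 → ∃ n, iterTrans t d n m = 0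

variable {t : ∀ d, N d →ₗ[R] N (d + 1)} {f : ∀ d, N d →ₗ[R] C}

theorem IsSeqColim.iterTrans (h : IsSeqColim t f) (d n : ℕ) (m : N d) :
    f (d + n) (iterTrans t d n m) = f d m := by
  induction n with
  | zero => rfl
  | succ n ih => rw [← ih]; exact LinearMap.congr_fun (h.comp_trans (d + n)) _

theorem IsSeqColim.surj_of_le (h : IsSeqColim t f) (c : C) :
    ∃ d₀, ∀ d ≥ d₀, ∃ m, f d m = c := by
  obtain ⟨d, m, hm⟩ := h.surj c
  refine ⟨d, fun d' hd' => ?_⟩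
  obtain ⟨n, rfl⟩ := Nat.exists_eq_add_of_le hd'
  exact ⟨_, (h.iterTrans d n m).trans hm⟩

/-- Transition maps of a sequence as a directed system. -/
noncomputable def transLE (t : ∀ d, N d →ₗ[R] N (d + 1)) (i j : ℕ) (h : i ≤ j) : N i →ₗ[R] N j :=
  Nat.leRecOn (C := fun j => N i →ₗ[R] N j) h (fun {k} φ => t k ∘ₗ φ) LinearMap.id

theorem transLE_self (t : ∀ d, N d →ₗ[R] N (d + 1)) (i : ℕ) :
    transLE t i i le_rfl = LinearMap.id := Nat.leRecOn_self _

theorem transLE_succ (t : ∀ d, N d →ₗ[R] N (d + 1)) {i j : ℕ} (h : i ≤ j) :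
    transLE t i (j + 1) (h.trans (Nat.le_succ j)) = t j ∘ₗ transLE t i j h :=
  Nat.leRecOn_succ (C := fun j => N i →ₗ[R] N j) h _

theorem transLE_add (t : ∀ d, N d →ₗ[R] N (d + 1)) (d n : ℕ) :
    transLE t d (d + n) (Nat.le_add_right d n) = iterTrans t d n := by
  induction n with
  | zero => exact transLE_self t d
  | succ n ih =>
    have := transLE_succ t (Nat.le_add_right d n)
    rw [ih] at this; exact this

theorem transLE_directedSystem (t : ∀ d, N d →ₗ[R] N (d + 1)) :
    DirectedSystem N (fun i j h => transLE t i j h) where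
  map_self i x := by rw [transLE_self]; rfl
  map_map k j i hij hjk x := by
    induction hjk with
    | refl => rw [transLE_self]; rfl
    | step h ih =>
      rw [transLE_succ t h, transLE_succ t (hij.trans h), LinearMap.comp_apply, ih]; rfl

section Tensor

variable (A : Type*) [CommRing A] [Algebra R A] (Q : Type*) [AddCommGroup Q] [Module R Q]
  [Module A Q] [IsScalarTower R A Q]

theorem lTensor_iterTrans (t : ∀ d, N d →ₗ[R] N (d + 1)) (d n : ℕ) :
    iterTrans (fun d => AlgebraTensorModule.lTensor A Q (t d)) d n =
      AlgebraTensorModule.lTensor A Q (iterTrans t d n) := by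
  induction n with
  | zero => exact (AlgebraTensorModule.lTensor_id).symm
  | succ n ih => rw [iterTrans, ih, iterTrans, AlgebraTensorModule.lTensor_comp]

/-- Sequential colimits commute with tensor products. -/
theorem IsSeqColim.lTensor (h : IsSeqColim t f) :
    IsSeqColim (fun d => AlgebraTensorModule.lTensor A Q (t d))
      (fun d => AlgebraTensorModule.lTensor A Q (f d)) where
  comp_trans d := by rw [← AlgebraTensorModule.lTensor_comp, h.comp_trans]
  surj c := by
    suffices H : ∃ d₀, ∀ d ≥ d₀, ∃ m, AlgebraTensorModule.lTensor A Q (f d) m = c by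
      obtain ⟨d, hd⟩ := H
      exact ⟨d, hd d le_rfl⟩
    induction c using TensorProduct.induction_on with
    | zero => exact ⟨0, fun d _ => ⟨0, map_zero _⟩⟩
    | tmul q c =>
      obtain ⟨d₀, hd₀⟩ := h.surj_of_le c
      refine ⟨d₀, fun d hd => ?_⟩
      obtain ⟨m, rfl⟩ := hd₀ d hd
      exact ⟨q ⊗ₜ m, rfl⟩
    | add a b ha hb =>
      obtain ⟨d₀, ha⟩ := ha
      obtain ⟨d₁, hb⟩ := hb
      refine ⟨max d₀ d₁, fun d hd => ?_⟩
      obtain ⟨m, hm⟩ := ha d (le_trans (le_max_left _ _) hd)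
      obtain ⟨m', hm'⟩ := hb d (le_trans (le_max_right _ _) hd)
      exact ⟨m + m', by rw [map_add, hm, hm']⟩
  ker d m hm := by
    -- identify `C` with the direct limit, which commutes with tensor products
    have hD := transLE_directedSystem t
    have Hg : ∀ i j hij (m : N i), f j (transLE t i j hij m) = f i m := by
      intro i j hij m
      obtain ⟨n, rfl⟩ := Nat.exists_eq_add_of_le hij
      rw [transLE_add, h.iterTrans]
    let L : Module.DirectLimit N (transLE t) →ₗ[R] C :=
      Module.DirectLimit.lift R ℕ N (transLE t) f Hg
    have L_of : ∀ d (m : N d), L (Module.DirectLimit.of R ℕ N (transLE t) d m) = f d m :=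
      fun d m => Module.DirectLimit.lift_of f Hg m
    have hL : Function.Bijective L := by
      constructor
      · rw [injective_iff_map_eq_zero]
        intro y hy
        obtain ⟨i, y, rfl⟩ := Module.DirectLimit.exists_of y
        rw [L_of] at hy
        obtain ⟨n, hn⟩ := h.ker i y hy
        rw [← Module.DirectLimit.of_f (hij := Nat.le_add_right i n), transLE_add, hn, map_zero]
      · intro c
        obtain ⟨d, m, rfl⟩ := h.surj c
        exact ⟨Module.DirectLimit.of R ℕ N (transLE t) d m, L_of d m⟩
    let E := LinearEquiv.ofBijective L hL
    have hE : ∀ d, L ∘ₗ Module.DirectLimit.of R ℕ N (transLE t) d = f d := fun d =>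
      LinearMap.ext (L_of d)
    have h0 : LinearMap.lTensor Q (Module.DirectLimit.of R ℕ N (transLE t) d) m = 0 := by
      apply (E.lTensor Q).injective
      rw [map_zero, ← hm]
      change LinearMap.lTensor Q L _ = LinearMap.lTensor Q (f d) m
      rw [← hE d, LinearMap.lTensor_comp]; rfl
    have h1 : ∀ y : Q ⊗[R] N d, TensorProduct.directLimitRight (transLE t) Q
        (LinearMap.lTensor Q (Module.DirectLimit.of R ℕ N (transLE t) d) y) =
        Module.DirectLimit.of R ℕ (fun i => Q ⊗[R] N i)
          (fun i j hij => (transLE t i j hij).lTensor Q) d y := by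
      intro y
      induction y using TensorProduct.induction_on with
      | zero => simp
      | tmul q n => simp
      | add a b ha hb => rw [map_add, map_add, ha, hb, map_add]
    have h2 := h1 m
    rw [h0, map_zero] at h2
    obtain ⟨j, hij, hj⟩ := Module.DirectLimit.of.zero_exact h2.symm
    obtain ⟨n, rfl⟩ := Nat.exists_eq_add_of_le hij
    refine ⟨n, ?_⟩
    rw [transLE_add] at hj
    rw [lTensor_iterTrans]
    exact hj

end Tensor
end SeqColim
end Branch

namespace Branch

/-! ### Systems of charts and twisted sections -/

section ChartSystem

open TensorProduct

variable {R ι : Type*} [CommRing R]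
  {C : ι → Type*} [∀ i, AddCommGroup (C i)] [∀ i, Module R (C i)]
  {C₂ : ι → ι → Type*} [∀ i j, AddCommGroup (C₂ i j)] [∀ i j, Module R (C₂ i j)]
  {M : ℕ → Type*} [∀ d, AddCommGroup (M d)] [∀ d, Module R (M d)]

/-- The linear data underlying a graded module `M` and the sheaf it defines on the standard charts of
projective space. Here `C i` and `C₂ i j` stand for the sections on the chart `x i ≠ 0` and on the
overlap of two charts, `z i j` and `w i j k` for multiplication by `x j / x i` and `x k / x i`, and
`v i j` is the inverse of `w i j j`. The maps `l` and `r` restrict sections from the first and the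
second chart to an overlap, `x i d` is multiplication by `x i` on `M d`, and `e i d` is the map
`m ↦ m / x i ^ d`. By the last two fields, `C i` arises from `M` by inverting `x i`, and `C₂ i j`
arises from `C i` by inverting `z i j`.

Only modules occur, so that the notion is stable under tensor products with arbitrary modules. -/
structure IsChartSystem (z : ∀ i, ι → Module.End R (C i)) (w : ∀ i j, ι → Module.End R (C₂ i j))
    (v : ∀ i j, Module.End R (C₂ i j)) (l : ∀ i j, C i →ₗ[R] C₂ i j) (r : ∀ i j, C j →ₗ[R] C₂ i j)
    (x : ι → ∀ d, M d →ₗ[R] M (d + 1)) (e : ∀ i d, M d →ₗ[R] C i) : Prop where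
  x_comm : ∀ i j d, x i (d + 1) ∘ₗ x j d = x j (d + 1) ∘ₗ x i d
  z_self : ∀ i, z i i = 1
  z_comm : ∀ i j k, z i j * z i k = z i k * z i j
  w_comm : ∀ i j k k', w i j k * w i j k' = w i j k' * w i j k
  v_w : ∀ i j, v i j * w i j j = 1
  l_z : ∀ i j k, l i j ∘ₗ z i k = w i j k ∘ₗ l i j
  r_z : ∀ i j k, w i j j ∘ₗ r i j ∘ₗ z j k = w i j k ∘ₗ r i j
  e_x : ∀ i j d, e i (d + 1) ∘ₗ x j d = z i j ∘ₗ e i d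
  l_e : ∀ i j d, l i j ∘ₗ e i d = (w i j j ^ d) ∘ₗ r i j ∘ₗ e j d
  colim_e : ∀ i, IsSeqColim (x i) (e i)
  colim_l : ∀ i j, IsSeqColim (fun _ => z i j) (fun d => (v i j ^ d) ∘ₗ l i j)

/-- The elements of degree `d` are exactly the compatible families of sections of the twist by
`d` on the charts. -/
structure Saturated (w : ∀ i j, ι → Module.End R (C₂ i j))
    (l : ∀ i j, C i →ₗ[R] C₂ i j) (r : ∀ i j, C j →ₗ[R] C₂ i j)
    (e : ∀ i d, M d →ₗ[R] C i) (d : ℕ) : Prop where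
  inj : ∀ m : M d, (∀ i, e i d m = 0) → m = 0
  surj : ∀ a : ∀ i, C i, (∀ i j, l i j (a i) = (w i j j ^ d) (r i j (a j))) →
    ∃ m, ∀ i, e i d m = a i

variable {z : ∀ i, ι → Module.End R (C i)} {w : ∀ i j, ι → Module.End R (C₂ i j)}
    {v : ∀ i j, Module.End R (C₂ i j)} {l : ∀ i j, C i →ₗ[R] C₂ i j} {r : ∀ i j, C j →ₗ[R] C₂ i j}
    {x : ι → ∀ d, M d →ₗ[R] M (d + 1)} {e : ∀ i d, M d →ₗ[R] C i}

section Tensor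

variable (A : Type*) [CommRing A] [Algebra R A] (Q : Type*) [AddCommGroup Q] [Module R Q]
  [Module A Q] [IsScalarTower R A Q]

theorem lTensor_pow' {V : Type*} [AddCommGroup V] [Module R V] (f : Module.End R V) (n : ℕ) :
    AlgebraTensorModule.lTensor A Q (f ^ n) =
      (AlgebraTensorModule.lTensor A Q f : Module.End A (Q ⊗[R] V)) ^ n := by
  induction n with
  | zero => exact AlgebraTensorModule.lTensor_id
  | succ n ih => rw [pow_succ, pow_succ, AlgebraTensorModule.lTensor_mul, ih]

/-- Chart systems are stable under tensor products with a module, possibly with an additional action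
of an algebra `A`. -/
theorem IsChartSystem.lTensor (h : IsChartSystem z w v l r x e) :
    IsChartSystem (R := A) (fun i j => AlgebraTensorModule.lTensor A Q (z i j))
      (fun i j k => AlgebraTensorModule.lTensor A Q (w i j k))
      (fun i j => AlgebraTensorModule.lTensor A Q (v i j))
      (fun i j => AlgebraTensorModule.lTensor A Q (l i j))
      (fun i j => AlgebraTensorModule.lTensor A Q (r i j))
      (fun i d => AlgebraTensorModule.lTensor A Q (x i d))
      (fun i d => AlgebraTensorModule.lTensor A Q (e i d)) where
  x_comm i j d := by
    simp only [← AlgebraTensorModule.lTensor_comp, h.x_comm i j d]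
  z_self i := by rw [h.z_self, AlgebraTensorModule.lTensor_one]
  z_comm i j k := by
    rw [← AlgebraTensorModule.lTensor_mul, h.z_comm, AlgebraTensorModule.lTensor_mul]
  w_comm i j k k' := by
    rw [← AlgebraTensorModule.lTensor_mul, h.w_comm, AlgebraTensorModule.lTensor_mul]
  v_w i j := by rw [← AlgebraTensorModule.lTensor_mul, h.v_w, AlgebraTensorModule.lTensor_one]
  l_z i j k := by simp only [← AlgebraTensorModule.lTensor_comp, h.l_z]
  r_z i j k := by simp only [← AlgebraTensorModule.lTensor_comp, h.r_z]
  e_x i j d := by simp only [← AlgebraTensorModule.lTensor_comp, h.e_x]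
  l_e i j d := by simp only [← AlgebraTensorModule.lTensor_comp, ← lTensor_pow', h.l_e]
  colim_e i := (h.colim_e i).lTensor A Q
  colim_l i j := by
    have := (h.colim_l i j).lTensor A Q
    simpa only [AlgebraTensorModule.lTensor_comp, lTensor_pow'] using this

end Tensor

section Total

open DirectSum

/-- The operator of degree one on the total module `⨁ d, M d`. -/
noncomputable def totalEnd (x : ι → ∀ d, M d →ₗ[R] M (d + 1)) (i : ι) :
    Module.End R (⨁ d, M d) :=
  DirectSum.toModule R ℕ _ (fun d => DirectSum.lof R ℕ M (d + 1) ∘ₗ x i d)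

theorem totalEnd_lof (x : ι → ∀ d, M d →ₗ[R] M (d + 1)) (i : ι) (d : ℕ) (m : M d) :
    totalEnd x i (lof R ℕ M d m) = lof R ℕ M (d + 1) (x i d m) := by
  rw [totalEnd, toModule_lof]; rfl

theorem totalEnd_pow_lof (x : ι → ∀ d, M d →ₗ[R] M (d + 1)) (i : ι) (d n : ℕ) (m : M d) :
    (totalEnd x i ^ n) (lof R ℕ M d m) = lof R ℕ M (d + n) (iterTrans (x i) d n m) := by
  induction n with
  | zero => rfl
  | succ n ih =>
    rw [pow_succ', Module.End.mul_apply, ih, totalEnd_lof]; rfl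

theorem isGradedSystem_total (hx : ∀ i j d, x i (d + 1) ∘ₗ x j d = x j (d + 1) ∘ₗ x i d)
    [∀ d, Module.Finite R (M d)]
    (hgen : ∃ d₁, ∀ d ≥ d₁, (⨆ i, LinearMap.range (x i d)) = ⊤) :
    IsGradedSystem (totalEnd x) (fun d => LinearMap.range (lof R ℕ M d)) where
  comm i j := by
    refine DirectSum.linearMap_ext _ fun d => LinearMap.ext fun m => ?_
    change totalEnd x i (totalEnd x j (lof R ℕ M d m)) = totalEnd x j (totalEnd x i (lof R ℕ M d m))
    rw [totalEnd_lof, totalEnd_lof, totalEnd_lof, totalEnd_lof]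
    exact congrArg _ (LinearMap.congr_fun (hx i j d) m)
  map_le i d := by
    rintro _ ⟨_, ⟨m, rfl⟩, rfl⟩
    exact ⟨x i d m, (totalEnd_lof x i d m).symm⟩
  indep d := by
    rw [Submodule.disjoint_def]
    rintro _ ⟨m, rfl⟩ h
    have : (⨆ (e) (_ : e ≠ d), LinearMap.range (lof R ℕ M e)) ≤
        LinearMap.ker (DirectSum.component R ℕ M d) := by
      refine iSup₂_le fun e he => ?_
      rintro _ ⟨m, rfl⟩
      exact DirectSum.of_eq_of_ne e d m he.symm
    have h2 : DirectSum.component R ℕ M d (lof R ℕ M d m) = 0 := this h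
    rw [DirectSum.component.lof_self] at h2
    rw [h2, map_zero]
  fg d := by
    rw [LinearMap.range_eq_map]; exact (Module.Finite.fg_top).map _
  gen := by
    obtain ⟨d₁, h⟩ := hgen
    refine ⟨d₁, fun d hd => ?_⟩
    rw [LinearMap.range_eq_map, ← h d hd, Submodule.map_iSup]
    refine iSup_mono fun i => ?_
    rintro _ ⟨_, ⟨m, rfl⟩, rfl⟩
    exact ⟨lof R ℕ M d m, ⟨m, rfl⟩, totalEnd_lof x i d m⟩

/-- The map from the total module to the chart with index `i`. -/
noncomputable def totalToChart (e : ∀ i d, M d →ₗ[R] C i) (i : ι) : (⨁ d, M d) →ₗ[R] C i :=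
  DirectSum.toModule R ℕ _ (e i)

theorem totalToChart_lof (e : ∀ i d, M d →ₗ[R] C i) (i : ι) (d : ℕ) (m : M d) :
    totalToChart e i (lof R ℕ M d m) = e i d m := toModule_lof R d m

theorem IsChartSystem.totalToChart_totalEnd_pow (h : IsChartSystem z w v l r x e) (i j : ι)
    (n : ℕ) (t : ⨁ d, M d) :
    totalToChart e i ((totalEnd x j ^ n) t) = (z i j ^ n) (totalToChart e i t) := by
  have h1 : totalToChart e i ∘ₗ totalEnd x j = z i j ∘ₗ totalToChart e i := by
    refine DirectSum.linearMap_ext _ fun d => LinearMap.ext fun m => ?_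
    change totalToChart e i (totalEnd x j (lof R ℕ M d m))
      = z i j (totalToChart e i (lof R ℕ M d m))
    rw [totalEnd_lof, totalToChart_lof, totalToChart_lof]
    exact LinearMap.congr_fun (h.e_x i j d) m
  induction n with
  | zero => rfl
  | succ n ih =>
    rw [pow_succ', Module.End.mul_apply, pow_succ', Module.End.mul_apply, ← ih]
    exact LinearMap.congr_fun h1 _

theorem IsChartSystem.totalToChart_totalEnd_pow_self (h : IsChartSystem z w v l r x e) (i : ι)
    (n : ℕ) (t : ⨁ d, M d) :
    totalToChart e i ((totalEnd x i ^ n) t) = totalToChart e i t := by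
  rw [h.totalToChart_totalEnd_pow, h.z_self, one_pow]; rfl

theorem IsChartSystem.exists_totalEnd_pow_eq_zero (h : IsChartSystem z w v l r x e) (i : ι)
    {t : ⨁ d, M d} {d : ℕ} (ht : t ∈ LinearMap.range (lof R ℕ M d))
    (h0 : totalToChart e i t = 0) : ∃ n, (totalEnd x i ^ n) t = 0 := by
  obtain ⟨m, rfl⟩ := ht
  rw [totalToChart_lof] at h0
  obtain ⟨n, hn⟩ := (h.colim_e i).ker d m h0
  exact ⟨n, by rw [totalEnd_pow_lof, hn, map_zero]⟩

theorem iterTrans_const {V : Type*} [AddCommGroup V] [Module R V] (f : Module.End R V) (d n : ℕ) :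
    iterTrans (N := fun _ => V) (fun _ => f) d n = f ^ n := by
  induction n with
  | zero => rfl
  | succ n ih => rw [iterTrans, ih, pow_succ']; rfl

theorem IsChartSystem.l_z_pow (h : IsChartSystem z w v l r x e) (i j k : ι) (n : ℕ) (a : C i) :
    l i j ((z i k ^ n) a) = (w i j k ^ n) (l i j a) := by
  induction n with
  | zero => rfl
  | succ n ih =>
    rw [pow_succ', Module.End.mul_apply, pow_succ', Module.End.mul_apply, ← ih]
    exact LinearMap.congr_fun (h.l_z i j k) _

/-- Over a Noetherian ring, a chart system with a finitely generated module is saturated in large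
degree: Serre's comparison between a graded module and the twisted sections of its sheaf. -/
theorem IsChartSystem.eventually_saturated [IsNoetherianRing R] [Finite ι]
    (h : IsChartSystem z w v l r x e) [∀ d, Module.Finite R (M d)]
    (hgen : ∃ d₁, ∀ d ≥ d₁, (⨆ i, LinearMap.range (x i d)) = ⊤) :
    ∃ d₀, ∀ d ≥ d₀, Saturated w l r e d := by
  cases nonempty_fintype ι
  have hA := isGradedSystem_total h.x_comm hgen
  obtain ⟨d₀, h₀⟩ := hA.eventually_torsionFree
  obtain ⟨d₁, h₁⟩ := hA.exists_section
  refine ⟨max d₀ d₁, fun d hd => ⟨fun m hm => ?_, fun a ha => ?_⟩⟩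
  · refine DirectSum.of_injective d ((h₀ d (le_trans (le_max_left _ _) hd) (lof R ℕ M d m)
      ⟨m, rfl⟩ fun i => ?_).trans (map_zero _).symm)
    exact h.exists_totalEnd_pow_eq_zero i ⟨m, rfl⟩ (by rw [totalToChart_lof, hm])
  · -- write all `a i` as fractions `m i / x i ^ (d + N)` with the same exponent
    choose D hD using fun i => (h.colim_e i).surj_of_le (a i)
    set N := Finset.univ.sup D
    have hDN : ∀ i, D i ≤ d + N := fun i =>
      (Finset.le_sup (f := D) (Finset.mem_univ i)).trans (Nat.le_add_left _ _)
    choose m hm using fun i => hD i (d + N) (hDN i)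
    set t : ι → ⨁ d, M d := fun i => lof R ℕ M (d + N) (m i) with ht
    have htE : ∀ i, totalToChart e i (t i) = a i := fun i => by rw [totalToChart_lof, hm]
    have htA : ∀ i, t i ∈ LinearMap.range (lof R ℕ M (d + N)) := fun i => ⟨m i, rfl⟩
    -- the two fractions representing the section on charts `i` and `j` agree up to torsion
    have key : ∀ i j, ∃ n n', (totalEnd x i ^ n') ((totalEnd x j ^ n)
        ((totalEnd x j ^ N) (t i) - (totalEnd x i ^ N) (t j))) = 0 := by
      intro i j
      set y := (totalEnd x j ^ N) (t i) - (totalEnd x i ^ N) (t j) with hy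
      have hyA : y ∈ LinearMap.range (lof R ℕ M (d + N + N)) :=
        Submodule.sub_mem _ (hA.isStable.pow_mem j (htA i) N) (hA.isStable.pow_mem i (htA j) N)
      have hly : l i j (totalToChart e i y) = 0 := by
        have e1 : l i j (e i (d + N) (m j)) = (w i j j ^ (d + N)) (r i j (e j (d + N) (m j))) :=
          LinearMap.congr_fun (h.l_e i j (d + N)) (m j)
        rw [hy, map_sub, h.totalToChart_totalEnd_pow, h.totalToChart_totalEnd_pow_self, htE,
          totalToChart_lof, map_sub, h.l_z_pow, ha, e1, hm, ← Module.End.mul_apply, ← pow_add,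
          add_comm N d, sub_self]
      obtain ⟨n, hn⟩ := (h.colim_l i j).ker 0 (totalToChart e i y) (by
        rw [LinearMap.comp_apply, hly, map_zero])
      rw [iterTrans_const, ← h.totalToChart_totalEnd_pow] at hn
      obtain ⟨n', hn'⟩ := h.exists_totalEnd_pow_eq_zero i (hA.isStable.pow_mem j hyA n) hn
      exact ⟨n, n', hn'⟩
    choose n n' hn using key
    set L := Finset.univ.sup (fun p : ι × ι => max (n p.1 p.2) (n' p.1 p.2))
    have hL : ∀ i j, (totalEnd x i ^ L) ((totalEnd x j ^ L)
        ((totalEnd x j ^ N) (t i) - (totalEnd x i ^ N) (t j))) = 0 := by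
      intro i j
      have hle : max (n i j) (n' i j) ≤ L :=
        Finset.le_sup (f := fun p : ι × ι => max (n p.1 p.2) (n' p.1 p.2))
          (Finset.mem_univ (i, j))
      refine pow_apply_eq_zero_of_le ((le_max_right _ _).trans hle) ?_
      rw [hA.pow_comm_apply]
      refine pow_apply_eq_zero_of_le ((le_max_left _ _).trans hle) ?_
      rw [hA.pow_comm_apply]
      exact hn i j
    obtain ⟨_, ⟨s, rfl⟩, hs⟩ := h₁ d (le_trans (le_max_right _ _) hd) (N + L)
      (fun i => (totalEnd x i ^ L) (t i))
      (fun i => by rw [← add_assoc]; exact hA.isStable.pow_mem i (htA i) L) (fun i j => by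
        have := hL i j
        rw [map_sub, map_sub, sub_eq_zero] at this
        have e1 : (totalEnd x j ^ (N + L)) ((totalEnd x i ^ L) (t i)) =
            (totalEnd x i ^ L) ((totalEnd x j ^ L) ((totalEnd x j ^ N) (t i))) := by
          rw [add_comm N L, pow_add, Module.End.mul_apply, hA.pow_comm_apply j i,
            hA.pow_comm_apply j i]
        have e2 : (totalEnd x i ^ (N + L)) ((totalEnd x j ^ L) (t j)) =
            (totalEnd x i ^ L) ((totalEnd x j ^ L) ((totalEnd x i ^ N) (t j))) := by
          rw [add_comm N L, pow_add, Module.End.mul_apply, hA.pow_comm_apply i j N]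
        rw [e1, e2, this])
    refine ⟨s, fun i => ?_⟩
    obtain ⟨K, hK⟩ := hs i
    have := congrArg (totalToChart e i) hK
    rw [h.totalToChart_totalEnd_pow_self, map_sub, h.totalToChart_totalEnd_pow_self,
      h.totalToChart_totalEnd_pow_self, htE, totalToChart_lof, map_zero, sub_eq_zero] at this
    exact this

end Total

end ChartSystem
end Branch

namespace Branch

/-! ### Global functions as a kernel, freeness and saturation -/

section ChartSystem

open TensorProduct

variable {R ι : Type*} [CommRing R]
  {C : ι → Type*} [∀ i, AddCommGroup (C i)] [∀ i, Module R (C i)]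
  {C₂ : ι → ι → Type*} [∀ i j, AddCommGroup (C₂ i j)] [∀ i j, Module R (C₂ i j)]
  {M : ℕ → Type*} [∀ d, AddCommGroup (M d)] [∀ d, Module R (M d)]
  {z : ∀ i, ι → Module.End R (C i)} {w : ∀ i j, ι → Module.End R (C₂ i j)}
  {v : ∀ i j, Module.End R (C₂ i j)} {l : ∀ i j, C i →ₗ[R] C₂ i j} {r : ∀ i j, C j →ₗ[R] C₂ i j}
  {x : ι → ∀ d, M d →ₗ[R] M (d + 1)} {e : ∀ i d, M d →ₗ[R] C i}

section Kernel

/-- The map whose kernel consists of the families `b` with `x j ^ d * b i = x i ^ d * b j`. -/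
noncomputable def crossDiff (x : ι → ∀ d, M d →ₗ[R] M (d + 1)) (d : ℕ) :
    (ι → M d) →ₗ[R] (ι × ι → M (d + d)) :=
  LinearMap.pi fun p => iterTrans (x p.2) d d ∘ₗ LinearMap.proj p.1 -
    iterTrans (x p.1) d d ∘ₗ LinearMap.proj p.2

theorem crossDiff_apply (x : ι → ∀ d, M d →ₗ[R] M (d + 1)) (d : ℕ) (b : ι → M d) (i j : ι) :
    crossDiff x d b (i, j) = iterTrans (x j) d d (b i) - iterTrans (x i) d d (b j) := rfl

theorem IsChartSystem.e_iterTrans (h : IsChartSystem z w v l r x e) (i j : ι) (d n : ℕ) (m : M d) :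
    e i (d + n) (iterTrans (x j) d n m) = (z i j ^ n) (e i d m) := by
  induction n with
  | zero => rfl
  | succ n ih =>
    rw [pow_succ', Module.End.mul_apply, ← ih]
    exact LinearMap.congr_fun (h.e_x i j (d + n)) _

theorem IsChartSystem.w_pow_injective (h : IsChartSystem z w v l r x e) (i j : ι) (n : ℕ) :
    Function.Injective (w i j j ^ n) := by
  have h1 : Function.Injective (w i j j) := by
    refine Function.LeftInverse.injective (g := v i j) fun a => ?_
    exact LinearMap.congr_fun (h.v_w i j) a
  rw [Module.End.coe_pow]
  exact h1.iterate n

theorem IsChartSystem.eq_of_crossDiff_eq_zero (h : IsChartSystem z w v l r x e) {d : ℕ}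
    {b : ι → M d} (hb : crossDiff x d b = 0) (i k : ι) :
    e k d (b i) = (z k i ^ d) (e k d (b k)) := by
  have h1 : iterTrans (x k) d d (b i) - iterTrans (x i) d d (b k) = 0 := congrFun hb (i, k)
  have h2 := congrArg (e k (d + d)) (sub_eq_zero.1 h1)
  rw [h.e_iterTrans, h.e_iterTrans, h.z_self, one_pow] at h2
  exact h2

/-- A family `b` in the kernel of `crossDiff` gives a global function, equal to `b i / x i ^ d` on the
chart `i`. -/
theorem IsChartSystem.compat_of_crossDiff_eq_zero (h : IsChartSystem z w v l r x e) {d : ℕ}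
    {b : ι → M d} (hb : crossDiff x d b = 0) (i j : ι) :
    l i j (e i d (b i)) = r i j (e j d (b j)) := by
  apply h.w_pow_injective i j d
  rw [← h.l_z_pow, ← h.eq_of_crossDiff_eq_zero hb]
  exact LinearMap.congr_fun (h.l_e i j d) (b j)

theorem IsChartSystem.eq_zero_of_crossDiff_eq_zero (h : IsChartSystem z w v l r x e) {d : ℕ}
    (hd : Saturated w l r e d) {b : ι → M d} (hb : crossDiff x d b = 0)
    (hb0 : ∀ i, e i d (b i) = 0) : b = 0 := by
  funext i
  refine hd.inj (b i) fun k => ?_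
  rw [h.eq_of_crossDiff_eq_zero hb, hb0, map_zero]

theorem IsChartSystem.r_z_pow (h : IsChartSystem z w v l r x e) (i j k : ι) (n : ℕ) (a : C j) :
    (w i j j ^ n) (r i j ((z j k ^ n) a)) = (w i j k ^ n) (r i j a) := by
  induction n generalizing a with
  | zero => rfl
  | succ n ih =>
    have hc : Commute (w i j j) (w i j k ^ n) := Commute.pow_right (h.w_comm i j j k) n
    have h1 : w i j j (r i j (z j k a)) = w i j k (r i j a) := LinearMap.congr_fun (h.r_z i j k) a
    rw [pow_succ', Module.End.mul_apply, pow_succ, Module.End.mul_apply, ih,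
      ← Module.End.mul_apply, hc.eq, Module.End.mul_apply, h1, pow_succ, Module.End.mul_apply]

/-- Every global function `a` comes from a family in the kernel of `crossDiff`, formed by the
elements `x i ^ d * a` of `M d`. -/
theorem IsChartSystem.exists_crossDiff_eq_zero (h : IsChartSystem z w v l r x e) {d : ℕ}
    (hd : Saturated w l r e d) (hd2 : Saturated w l r e (d + d)) {a : ∀ i, C i}
    (ha : ∀ i j, l i j (a i) = r i j (a j)) :
    ∃ b : ι → M d, crossDiff x d b = 0 ∧ ∀ i, e i d (b i) = a i := by
  have H : ∀ i, ∃ m, ∀ k, e k d m = (z k i ^ d) (a k) := fun i => hd.surj _ fun k j => by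
    rw [h.l_z_pow, h.r_z_pow, ha]
  choose b hb using H
  refine ⟨b, funext fun ⟨i, j⟩ => ?_, fun i => by rw [hb, h.z_self, one_pow]; rfl⟩
  rw [crossDiff_apply]
  refine hd2.inj _ fun k => ?_
  rw [map_sub, h.e_iterTrans, h.e_iterTrans, hb, hb, ← Module.End.mul_apply,
    ← Module.End.mul_apply, sub_eq_zero]
  have hc : Commute (z k j ^ d) (z k i ^ d) := Commute.pow_pow (h.z_comm k j i) d d
  rw [hc.eq]

end Kernel

/-- Saturation of the tensor product of a chart system with `Q`. -/
abbrev SaturatedTensor (A : Type*) [CommRing A] [Algebra R A] (Q : Type*) [AddCommGroup Q]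
    [Module R Q] [Module A Q] [IsScalarTower R A Q] (w : ∀ i j, ι → Module.End R (C₂ i j))
    (l : ∀ i j, C i →ₗ[R] C₂ i j) (r : ∀ i j, C j →ₗ[R] C₂ i j)
    (e : ∀ i d, M d →ₗ[R] C i) (d : ℕ) : Prop :=
  Saturated (R := A) (fun i j k => AlgebraTensorModule.lTensor A Q (w i j k))
    (fun i j => AlgebraTensorModule.lTensor A Q (l i j))
    (fun i j => AlgebraTensorModule.lTensor A Q (r i j))
    (fun i d => AlgebraTensorModule.lTensor A Q (e i d)) d

theorem iSup_range_lTensor (A : Type*) [CommRing A] [Algebra R A] (Q : Type*) [AddCommGroup Q]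
    [Module R Q] [Module A Q] [IsScalarTower R A Q] {d : ℕ}
    (h : (⨆ i, LinearMap.range (x i d)) = ⊤) :
    (⨆ i, LinearMap.range (AlgebraTensorModule.lTensor A Q (x i d))) = ⊤ := by
  rw [eq_top_iff]
  rintro y -
  induction y using TensorProduct.induction_on with
  | zero => exact Submodule.zero_mem _
  | add a b ha hb => exact Submodule.add_mem _ ha hb
  | tmul q m =>
    have hm : m ∈ (⨆ i, LinearMap.range (x i d)) := h ▸ Submodule.mem_top
    induction hm using Submodule.iSup_induction' with
    | mem i m hm =>
      obtain ⟨m, rfl⟩ := hm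
      exact Submodule.mem_iSup_of_mem i ⟨q ⊗ₜ m, rfl⟩
    | zero => rw [tmul_zero]; exact Submodule.zero_mem _
    | add a b _ _ ha hb => rw [tmul_add]; exact Submodule.add_mem _ ha hb

theorem IsChartSystem.eventually_saturatedTensor [Finite ι]
    (h : IsChartSystem z w v l r x e) [∀ d, Module.Finite R (M d)]
    (hgen : ∃ d₁, ∀ d ≥ d₁, (⨆ i, LinearMap.range (x i d)) = ⊤)
    (A : Type*) [CommRing A] [Algebra R A] [IsNoetherianRing A] :
    ∃ d₀, ∀ d ≥ d₀, SaturatedTensor A A w l r e d := by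
  obtain ⟨d₁, hd₁⟩ := hgen
  exact (h.lTensor A A).eventually_saturated ⟨d₁, fun d hd => iSup_range_lTensor A A (hd₁ d hd)⟩

/-- If the charts are flat, then a finitely generated graded module is free in large degree: the
kernels of the maps `𝔪 ⊗ M d → M d` vanish on the charts. -/
theorem IsChartSystem.eventually_free [IsNoetherianRing R] [IsLocalRing R] [Finite ι]
    (h : IsChartSystem z w v l r x e) [∀ d, Module.Finite R (M d)] [∀ i, Module.Flat R (C i)]
    (hgen : ∃ d₁, ∀ d ≥ d₁, (⨆ i, LinearMap.range (x i d)) = ⊤) :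
    ∃ d₀, ∀ d ≥ d₀, Module.Free R (M d) := by
  let 𝔪 := IsLocalRing.maximalIdeal R
  obtain ⟨d₁, hd₁⟩ := hgen
  have h' := h.lTensor R 𝔪
  have hA := isGradedSystem_total h'.x_comm
    ⟨d₁, fun d hd => iSup_range_lTensor R 𝔪 (hd₁ d hd)⟩
  obtain ⟨d₀, h₀⟩ := hA.eventually_torsionFree
  refine ⟨d₀, fun d hd => ?_⟩
  have : Module.FinitePresentation R (M d) := Module.finitePresentation_of_finite R (M d)
  refine Module.free_of_maximalIdeal_rTensor_injective ?_
  rw [injective_iff_map_eq_zero]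
  intro q hq
  have : DirectSum.lof R ℕ (fun d => 𝔪 ⊗[R] M d) d q = 0 := by
    refine h₀ d hd _ ⟨q, rfl⟩ fun i => h'.exists_totalEnd_pow_eq_zero i ⟨q, rfl⟩ ?_
    rw [totalToChart_lof]
    have hinj : Function.Injective ((𝔪).subtype.rTensor (C i)) :=
      Module.Flat.rTensor_preserves_injective_linearMap _ Subtype.val_injective
    apply hinj
    rw [map_zero]
    change (LinearMap.rTensor (C i) (𝔪).subtype) (LinearMap.lTensor 𝔪 (e i d) q) = 0
    rw [← LinearMap.comp_apply, LinearMap.rTensor_comp_lTensor, ← LinearMap.lTensor_comp_rTensor,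
      LinearMap.comp_apply, hq, map_zero]
  exact DirectSum.of_injective d (this.trans (map_zero _).symm)

section Devissage

theorem lTensor_rTensor_apply {V W Q Q' : Type*} [AddCommGroup V] [Module R V] [AddCommGroup W]
    [Module R W] [AddCommGroup Q] [Module R Q] [AddCommGroup Q'] [Module R Q']
    (f : V →ₗ[R] W) (g : Q →ₗ[R] Q') (y : Q ⊗[R] V) :
    AlgebraTensorModule.lTensor R Q' f (g.rTensor V y) =
      g.rTensor W (AlgebraTensorModule.lTensor R Q f y) := by
  change LinearMap.lTensor Q' f _ = g.rTensor W (LinearMap.lTensor Q f y)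
  rw [← LinearMap.comp_apply, LinearMap.lTensor_comp_rTensor, ← LinearMap.rTensor_comp_lTensor]
  rfl

/-- Saturation of tensor products is stable under extensions of the coefficient module. -/
theorem SaturatedTensor.of_exact (h : IsChartSystem z w v l r x e) [∀ i, Module.Flat R (C i)]
    [∀ i j, Module.Flat R (C₂ i j)] {Q' Q Q'' : Type*} [AddCommGroup Q] [Module R Q]
    [AddCommGroup Q'] [Module R Q'] [AddCommGroup Q''] [Module R Q''] (f : Q' →ₗ[R] Q)
    (p : Q →ₗ[R] Q'') (hf : Function.Injective f) (hfp : Function.Exact f p)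
    (hp : Function.Surjective p) {d : ℕ} (h' : SaturatedTensor R Q' w l r e d)
    (h'' : SaturatedTensor R Q'' w l r e d) : SaturatedTensor R Q w l r e d where
  inj m hm := by
    have h1 : p.rTensor (M d) m = 0 := h''.inj _ fun i => by
      rw [lTensor_rTensor_apply, hm, map_zero]
    obtain ⟨m', rfl⟩ := (rTensor_exact (M d) hfp hp m).1 h1
    rw [h'.inj m' fun i => ?_, map_zero]
    apply Module.Flat.rTensor_preserves_injective_linearMap (M := C i) f hf
    rw [← lTensor_rTensor_apply, hm, map_zero]
  surj a ha := by
    simp only [← lTensor_pow'] at ha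
    obtain ⟨m'', hm''⟩ := h''.surj (fun i => p.rTensor (C i) (a i)) fun i j => by
      rw [← lTensor_pow', lTensor_rTensor_apply, ha, lTensor_rTensor_apply, lTensor_rTensor_apply]
    obtain ⟨m, rfl⟩ := LinearMap.rTensor_surjective (M d) hp m''
    have h1 : ∀ i, ∃ c, f.rTensor (C i) c = a i - AlgebraTensorModule.lTensor R Q (e i d) m := by
      intro i
      refine (rTensor_exact (C i) hfp hp _).1 ?_
      rw [map_sub, ← lTensor_rTensor_apply, hm'', sub_self]
    choose c hc using h1
    obtain ⟨m', hm'⟩ := h'.surj c fun i j => by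
      rw [← lTensor_pow']
      apply Module.Flat.rTensor_preserves_injective_linearMap (M := C₂ i j) f hf
      have h2 := LinearMap.congr_fun ((h.lTensor R Q).l_e i j d) m
      rw [← lTensor_pow'] at h2
      rw [← lTensor_rTensor_apply, ← lTensor_rTensor_apply, ← lTensor_rTensor_apply, hc, hc,
        map_sub, map_sub, map_sub, ha]
      exact congrArg _ h2
    refine ⟨m + f.rTensor (M d) m', fun i => ?_⟩
    rw [map_add, lTensor_rTensor_apply, hm', hc]; abel

theorem SaturatedTensor.of_subsingleton {Q : Type*} [AddCommGroup Q] [Module R Q] [Subsingleton Q]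
    {d : ℕ} : SaturatedTensor R Q w l r e d where
  inj _ _ := Subsingleton.elim _ _
  surj _ _ := ⟨0, fun _ => Subsingleton.elim _ _⟩

/-- If the reduction of a flat chart system modulo the maximal ideal is saturated, then so is its
tensor product with any module of finite length. -/
theorem SaturatedTensor.of_isFiniteLength [IsLocalRing R] (h : IsChartSystem z w v l r x e)
    [∀ i, Module.Flat R (C i)] [∀ i j, Module.Flat R (C₂ i j)] {d : ℕ}
    (h₀ : SaturatedTensor R (R ⧸ IsLocalRing.maximalIdeal R) w l r e d)
    {Q : Type*} [AddCommGroup Q] [Module R Q] (hQ : IsFiniteLength R Q) :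
    SaturatedTensor R Q w l r e d := by
  induction hQ with
  | of_subsingleton => exact SaturatedTensor.of_subsingleton
  | @of_simple_quotient Q _ _ N hs _ ih =>
    refine SaturatedTensor.of_exact h N.subtype N.mkQ N.injective_subtype
      (LinearMap.exact_subtype_mkQ N) N.mkQ_surjective ih ?_
    obtain ⟨I, hI, ⟨E⟩⟩ := isSimpleModule_iff_quot_maximal.1 hs
    obtain rfl := IsLocalRing.eq_maximalIdeal hI
    refine SaturatedTensor.of_exact h (0 : (⊥ : Submodule R R) →ₗ[R] (Q ⧸ N)) E.toLinearMap
      (Function.injective_of_subsingleton _) ?_ E.surjective SaturatedTensor.of_subsingleton h₀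
    intro y
    constructor
    · intro hy
      exact ⟨0, by simpa using (E.map_eq_zero_iff.1 hy).symm⟩
    · rintro ⟨_, rfl⟩; simp

end Devissage

end ChartSystem
end Branch

namespace Branch

/-! ### Lifting simple roots -/

section EtaleLift

open Polynomial

variable {R : Type*} [CommRing R]

theorem isNilpotent_mk_of_mem_map {B : Type*} [CommRing B] [Algebra R B] (I : Ideal R) (n : ℕ)
    {x : B} (hx : x ∈ I.map (algebraMap R B)) :
    IsNilpotent (Ideal.Quotient.mkₐ R ((I ^ (n + 1)).map (algebraMap R B)) x) := by
  refine ⟨n + 1, ?_⟩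
  rw [← map_pow]
  refine Ideal.Quotient.eq_zero_iff_mem.2 ?_
  rw [Ideal.map_pow]
  exact Ideal.pow_mem_pow hx _

theorem eq_of_isNilpotent_sub_of_aeval_eq_zero {S : Type*} [CommRing S] [Algebra R S] {P : R[X]}
    {x r s : S} (hP : IsNilpotent (aeval x P)) (hP' : IsUnit (aeval x (derivative P)))
    (hr : IsNilpotent (x - r)) (hs : IsNilpotent (x - s)) (hr0 : aeval r P = 0)
    (hs0 : aeval s P = 0) : r = s :=
  (existsUnique_nilpotent_sub_and_aeval_eq_zero hP hP').unique ⟨hr, hr0⟩ ⟨hs, hs0⟩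

theorem isUnit_aeval_of_isNilpotent {B S : Type*} [CommRing B] [Algebra R B] [CommRing S]
    [Algebra R S] {J : Ideal B} {Q : R[X]} {u c : B} (hc : aeval u Q * c - 1 ∈ J)
    (h : B →ₐ[R] S) (hh : ∀ x ∈ J, IsNilpotent (h x)) : IsUnit (aeval (h u) Q) := by
  rw [aeval_algHom_apply]
  have h1 : IsUnit (h (aeval u Q * c)) := by
    have := (hh _ hc).isUnit_one_add
    rwa [← map_one h, ← map_add, add_sub_cancel] at this
  rw [map_mul] at h1
  exact isUnit_of_mul_isUnit_left h1

/-- An element `u` which is modulo `I` a simple root of a polynomial and has equal images under `f`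
and `g` modulo `I` can be modified so that its images agree modulo a power of `I`: it is replaced by
a root `u'` modulo that power, whose two images agree by the uniqueness in Hensel's lemma. -/
theorem exists_sub_mem_and_map_sub_map_mem {B D : Type*} [CommRing B] [CommRing D] [Algebra R B]
    [Algebra R D] (I : Ideal R) (f g : B →ₐ[R] D) (P : R[X]) (u c : B)
    (hP : aeval u P ∈ I.map (algebraMap R B))
    (hc : aeval u (derivative P) * c - 1 ∈ I.map (algebraMap R B))
    (hu : f u - g u ∈ I.map (algebraMap R D)) (n : ℕ) :
    ∃ u', u' - u ∈ I.map (algebraMap R B) ∧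
      f u' - g u' ∈ (I ^ (n + 1)).map (algebraMap R D) := by
  let q : B →ₐ[R] _ := Ideal.Quotient.mkₐ R ((I ^ (n + 1)).map (algebraMap R B))
  have hq : ∀ x ∈ I.map (algebraMap R B), IsNilpotent (q x) := fun x hx =>
    isNilpotent_mk_of_mem_map I n hx
  obtain ⟨r, ⟨hr, hr0⟩, -⟩ := existsUnique_nilpotent_sub_and_aeval_eq_zero
    (P := P) (x := q u) (by rw [aeval_algHom_apply]; exact hq _ hP) (isUnit_aeval_of_isNilpotent hc q hq)
  obtain ⟨u', rfl⟩ := Ideal.Quotient.mkₐ_surjective R _ r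
  have hPu' : aeval u' P ∈ (I ^ (n + 1)).map (algebraMap R B) := by
    change aeval (q u') P = 0 at hr0
    rw [aeval_algHom_apply] at hr0
    exact Ideal.Quotient.eq_zero_iff_mem.1 hr0
  have hle : (I ^ (n + 1)).map (algebraMap R B) ≤ I.map (algebraMap R B) :=
    Ideal.map_mono (Ideal.pow_le_self n.succ_ne_zero)
  obtain ⟨N, hN⟩ := hr
  have hN' : (u - u') ^ N ∈ I.map (algebraMap R B) := by
    change (q u - q u') ^ N = 0 at hN
    rw [← map_sub, ← map_pow] at hN
    exact hle (Ideal.Quotient.eq_zero_iff_mem.1 hN)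
  refine ⟨u', ?_, ?_⟩
  · let q₁ : B →ₐ[R] _ := Ideal.Quotient.mkₐ R (I.map (algebraMap R B))
    have h0 : ∀ x ∈ I.map (algebraMap R B), q₁ x = 0 := fun x hx =>
      Ideal.Quotient.eq_zero_iff_mem.2 hx
    have h1 : q₁ u' = q₁ u := by
      refine eq_of_isNilpotent_sub_of_aeval_eq_zero (P := P) (x := q₁ u) ?_ ?_ ⟨N, ?_⟩
        (sub_self (q₁ u) ▸ IsNilpotent.zero) ?_ ?_
      · rw [aeval_algHom_apply, h0 _ hP]; exact IsNilpotent.zero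
      · exact isUnit_aeval_of_isNilpotent hc q₁ fun x hx => by rw [h0 x hx]; exact IsNilpotent.zero
      · rw [← map_sub, ← map_pow]; exact h0 _ hN'
      · rw [aeval_algHom_apply, h0 _ (hle hPu')]
      · rw [aeval_algHom_apply, h0 _ hP]
    rw [← sub_eq_zero, ← map_sub] at h1
    exact Ideal.Quotient.eq_zero_iff_mem.1 h1
  · let p : D →ₐ[R] _ := Ideal.Quotient.mkₐ R ((I ^ (n + 1)).map (algebraMap R D))
    have hp : ∀ x ∈ I.map (algebraMap R D), IsNilpotent (p x) := fun x hx =>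
      isNilpotent_mk_of_mem_map I n hx
    have hmap : ∀ (J : Ideal R) (h : B →ₐ[R] D), ∀ x ∈ J.map (algebraMap R B),
        h x ∈ J.map (algebraMap R D) := by
      intro J h x hx
      have := Ideal.mem_map_of_mem (h : B →+* D) hx
      rwa [Ideal.map_map, AlgHom.comp_algebraMap] at this
    have hz : ∀ (h : B →ₐ[R] D), aeval (p (h u')) P = 0 := fun h => by
      rw [aeval_algHom_apply, aeval_algHom_apply]
      exact Ideal.Quotient.eq_zero_iff_mem.2 (hmap _ h _ hPu')
    have hn : ∀ h : B →ₐ[R] D, IsNilpotent (p (h u) - p (h u')) := fun h => by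
      rw [← map_sub, ← map_sub]
      refine IsNilpotent.of_pow (m := N) ?_
      rw [← map_pow, ← map_pow]
      exact hp _ (hmap I h _ hN')
    have h1 : p (f u') = p (g u') := by
      refine eq_of_isNilpotent_sub_of_aeval_eq_zero (P := P) (x := p (f u)) ?_ ?_ (hn f) ?_
        (hz f) (hz g)
      · rw [aeval_algHom_apply, aeval_algHom_apply]
        exact hp _ (hmap I f _ hP)
      · exact isUnit_aeval_of_isNilpotent hc (p.comp f) fun x hx => hp _ (hmap I f x hx)
      · have : p (f u) - p (g u') = p (f u - g u) + (p (g u) - p (g u')) := by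
          rw [map_sub]; ring
        rw [this]
        exact (Commute.all _ _).isNilpotent_add (hp _ hu) (hn g)
    rw [← sub_eq_zero, ← map_sub] at h1
    exact Ideal.Quotient.eq_zero_iff_mem.1 h1

end EtaleLift

section Separable

open Polynomial TensorProduct

/-- An integral element of an algebra which stays reduced over a perfect field has separable
minimal polynomial. If `q ^ 2 * s` is the minimal polynomial over the perfect field, then `q * s`
vanishes at `u` as well, so that `q` is constant. -/
theorem separable_minpoly_of_isReduced {k Ω B : Type*} [Field k] [Field Ω] [Algebra k Ω]
    [PerfectField Ω] [CommRing B] [Algebra k B] [IsReduced (Ω ⊗[k] B)] {u : B}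
    (hu : IsIntegral k u) : (minpoly k u).Separable := by
  set p := minpoly k u with hp
  have hmonic : p.Monic := minpoly.monic hu
  suffices h : (p.map (algebraMap k Ω)).Separable from (separable_map _).1 h
  rw [PerfectField.separable_iff_squarefree]
  intro q hq
  obtain ⟨s, hs⟩ := hq
  have hli : LinearIndependent Ω fun i : Fin p.natDegree =>
      ((1 : Ω) ⊗ₜ[k] u : Ω ⊗[k] B) ^ (i : ℕ) := by
    have := Module.Flat.linearIndependent_one_tmul (S := Ω) (linearIndependent_pow (K := k) u)
    simpa only [Algebra.TensorProduct.tmul_pow, one_pow] using this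
  set t : Ω ⊗[k] B := (1 : Ω) ⊗ₜ[k] u
  have hpt : aeval t (p.map (algebraMap k Ω)) = 0 := by
    have h1 : (Algebra.TensorProduct.includeRight : B →ₐ[k] Ω ⊗[k] B) u = t := rfl
    rw [aeval_map_algebraMap, ← h1, aeval_algHom_apply, minpoly.aeval, map_zero]
  have hmonic' : (p.map (algebraMap k Ω)).Monic := hmonic.map _
  have hqs : aeval t (q * s) = 0 := by
    refine IsReduced.eq_zero _ ⟨2, ?_⟩
    have : (q * s) ^ 2 = p.map (algebraMap k Ω) * s := by rw [hs]; ring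
    rw [← map_pow, this, map_mul, hpt, zero_mul]
  have hq0 : q ≠ 0 := by rintro rfl; apply hmonic'.ne_zero; rw [hs]; ring
  have hs0 : s ≠ 0 := by rintro rfl; apply hmonic'.ne_zero; rw [hs]; ring
  have hdeg : p.natDegree = q.natDegree + (q * s).natDegree := by
    rw [← natDegree_map (algebraMap k Ω) (p := p), hs, mul_assoc,
      natDegree_mul hq0 (mul_ne_zero hq0 hs0)]
  by_contra hqu
  have hqd : 0 < q.natDegree := by
    rw [Nat.pos_iff_ne_zero]
    intro h0
    exact hqu (isUnit_iff_degree_eq_zero.2 (by rw [degree_eq_natDegree hq0, h0]; rfl))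
  rw [aeval_eq_sum_range' (n := p.natDegree) (by omega), Finset.sum_range] at hqs
  have hco := Fintype.linearIndependent_iff.1 hli _ hqs
  apply mul_ne_zero hq0 hs0
  ext i
  by_cases hi : i < p.natDegree
  · exact hco ⟨i, hi⟩
  · rw [coeff_eq_zero_of_natDegree_lt (by omega), coeff_zero]

end Separable

/-! ### Reduction modulo an ideal -/

section Quotient

open TensorProduct

variable {R : Type*} [CommRing R] (I : Ideal R) {V : Type*} [AddCommGroup V] [Module R V]

theorem one_tmul_eq_zero_iff (v : V) :
    ((1 : R ⧸ I) ⊗ₜ[R] v) = 0 ↔ v ∈ (I • ⊤ : Submodule R V) := by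
  rw [← LinearMap.ker_tensorProductMk]; rfl

theorem exists_one_tmul_eq (y : (R ⧸ I) ⊗[R] V) : ∃ v : V, (1 : R ⧸ I) ⊗ₜ[R] v = y := by
  induction y using TensorProduct.induction_on with
  | zero => exact ⟨0, tmul_zero _ _⟩
  | add a b ha hb =>
    obtain ⟨v, rfl⟩ := ha
    obtain ⟨w, rfl⟩ := hb
    exact ⟨v + w, tmul_add _ _ _⟩
  | tmul q v =>
    obtain ⟨r, rfl⟩ := Ideal.Quotient.mk_surjective q
    refine ⟨r • v, ?_⟩
    rw [← smul_tmul, Algebra.smul_def, mul_one]; rfl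

theorem mem_smul_top_pi_iff {ι : Type*} [Finite ι] {W : ι → Type*} [∀ i, AddCommGroup (W i)]
    [∀ i, Module R (W i)] (v : ∀ i, W i) :
    v ∈ (I • ⊤ : Submodule R (∀ i, W i)) ↔ ∀ i, v i ∈ (I • ⊤ : Submodule R (W i)) := by
  classical
  cases nonempty_fintype ι
  simp only [← one_tmul_eq_zero_iff]
  rw [← (TensorProduct.piRight R R (R ⧸ I) W).map_eq_zero_iff, funext_iff]
  simp

end Quotient

/-! ### Kernels of linear maps over a local ring -/

section LocalRing

open TensorProduct IsLocalRing

variable {R : Type*} [CommRing R] {F G : Type*} [AddCommGroup F] [Module R F]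
  [AddCommGroup G] [Module R G]

/-- If every element killed by `φ` modulo `I` can be modified modulo `I` so as to be killed modulo
arbitrarily high powers of `I`, then it can be modified so as to be killed, by the Artin–Rees lemma. -/
theorem exists_sub_mem_and_map_eq_zero [IsNoetherianRing R] [Module.Finite R G] (I : Ideal R)
    (φ : F →ₗ[R] G)
    (h : ∀ u, φ u ∈ (I • ⊤ : Submodule R G) → ∀ n : ℕ, ∃ u', u' - u ∈ (I • ⊤ : Submodule R F) ∧
      φ u' ∈ (I ^ n • ⊤ : Submodule R G)) (u : F) (hu : φ u ∈ (I • ⊤ : Submodule R G)) :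
    ∃ u', u' - u ∈ (I • ⊤ : Submodule R F) ∧ φ u' = 0 := by
  obtain ⟨k, hk⟩ := Ideal.exists_pow_inf_eq_pow_smul I (LinearMap.range φ)
  obtain ⟨u', hu', hφ⟩ := h u hu (k + 1)
  have h1 : φ u' ∈ I ^ (k + 1 - k) • (I ^ k • ⊤ ⊓ LinearMap.range φ) := by
    rw [← hk (k + 1) (Nat.le_succ k)]
    exact ⟨hφ, ⟨u', rfl⟩⟩
  rw [Nat.add_sub_cancel_left, pow_one] at h1
  have h2 : φ u' ∈ (I • ⊤ : Submodule R F).map φ := by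
    rw [Submodule.map_smul'', Submodule.map_top]
    exact Submodule.smul_mono le_rfl inf_le_right h1
  obtain ⟨y, hy, hyu⟩ := h2
  refine ⟨u' - y, ?_, by rw [map_sub, hyu, sub_self]⟩
  have : u' - y - u = (u' - u) - y := by abel
  rw [this]
  exact Submodule.sub_mem _ hu' hy

/-- If the kernel of `φ` surjects onto the kernel of the reduction of `φ` modulo the maximal ideal,
then the kernel of `φ` has the same dimension after base change to any field, because the quotient
by the kernel is a direct summand of `G`. -/
theorem finrank_ker_baseChange_add [IsLocalRing R] [Module.Finite R F] [Module.Free R F]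
    [Module.Finite R G] [Module.Free R G] (φ : F →ₗ[R] G)
    (h : ∀ u, φ u ∈ (maximalIdeal R • ⊤ : Submodule R G) →
      ∃ u', u' - u ∈ (maximalIdeal R • ⊤ : Submodule R F) ∧ φ u' = 0)
    (Ω : Type*) [Field Ω] [Algebra R Ω] :
    Module.finrank R (F ⧸ LinearMap.ker φ) +
      Module.finrank Ω (LinearMap.ker (φ.baseChange Ω)) = Module.finrank R F := by
  let ψ : (F ⧸ LinearMap.ker φ) →ₗ[R] G := (LinearMap.ker φ).liftQ φ le_rfl
  have hψ : ψ ∘ₗ (LinearMap.ker φ).mkQ = φ := Submodule.liftQ_mkQ _ _ _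
  have hinj : Function.Injective (ψ.lTensor (ResidueField R)) := by
    rw [injective_iff_map_eq_zero]
    intro y hy
    obtain ⟨v, rfl⟩ := exists_one_tmul_eq (maximalIdeal R) y
    obtain ⟨u, rfl⟩ := Submodule.mkQ_surjective _ v
    change (1 : R ⧸ maximalIdeal R) ⊗ₜ[R] (ψ (Submodule.mkQ _ u)) = 0 at hy
    change (1 : R ⧸ maximalIdeal R) ⊗ₜ[R] _ = 0
    rw [← LinearMap.comp_apply, hψ, one_tmul_eq_zero_iff] at hy
    obtain ⟨u', hu', h0⟩ := h u hy
    rw [one_tmul_eq_zero_iff]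
    have h1 : (LinearMap.ker φ).mkQ u = (LinearMap.ker φ).mkQ (-(u' - u)) := by
      have h2 : (LinearMap.ker φ).mkQ u' = 0 := (Submodule.Quotient.mk_eq_zero _).2 h0
      rw [neg_sub, map_sub, h2, sub_zero]
    rw [h1]
    have h2 := Submodule.mem_map_of_mem (f := (LinearMap.ker φ).mkQ) (Submodule.neg_mem _ hu')
    rw [Submodule.map_smul''] at h2
    exact Submodule.smul_mono le_rfl le_top h2
  obtain ⟨ψ', hψ'⟩ := (split_injective_iff_lTensor_residueField_injective ψ).2 hinj
  have : Module.Projective R (F ⧸ LinearMap.ker φ) := Module.Projective.of_split ψ ψ' hψ'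
  have : Module.Free R (F ⧸ LinearMap.ker φ) := Module.free_of_flat_of_isLocalRing
  have h1 : Function.Injective (ψ.baseChange Ω) := by
    refine Function.LeftInverse.injective (g := ψ'.baseChange Ω) fun y => ?_
    rw [← LinearMap.comp_apply, ← LinearMap.baseChange_comp, hψ', LinearMap.baseChange_id]; rfl
  have h2 : Function.Surjective ((LinearMap.ker φ).mkQ.baseChange Ω) :=
    LinearMap.lTensor_surjective Ω (Submodule.mkQ_surjective _)
  have h3 : LinearMap.ker (φ.baseChange Ω) = LinearMap.ker ((LinearMap.ker φ).mkQ.baseChange Ω) := by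
    conv_lhs => rw [← hψ, LinearMap.baseChange_comp]
    exact LinearMap.ker_comp_of_ker_eq_bot _ (LinearMap.ker_eq_bot.2 h1)
  rw [h3]
  have h4 := LinearMap.finrank_range_add_finrank_ker ((LinearMap.ker φ).mkQ.baseChange Ω)
  rw [LinearMap.range_eq_top.2 h2, finrank_top, Module.finrank_baseChange,
    Module.finrank_baseChange] at h4
  exact h4

end LocalRing

end Branch

namespace Branch

/-! ### Compatible families of sections -/

open TensorProduct

section Compatible

variable {R ι : Type*} [CommRing R]
  {C : ι → Type*} [∀ i, AddCommGroup (C i)] [∀ i, Module R (C i)]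
  {C₂ : ι → ι → Type*} [∀ i j, AddCommGroup (C₂ i j)] [∀ i j, Module R (C₂ i j)]
  {M : ℕ → Type*} [∀ d, AddCommGroup (M d)] [∀ d, Module R (M d)]
  {z : ∀ i, ι → Module.End R (C i)} {w : ∀ i j, ι → Module.End R (C₂ i j)}
  {v : ∀ i j, Module.End R (C₂ i j)} {l : ∀ i j, C i →ₗ[R] C₂ i j} {r : ∀ i j, C j →ₗ[R] C₂ i j}
  {x : ι → ∀ d, M d →ₗ[R] M (d + 1)} {e : ∀ i d, M d →ₗ[R] C i}

/-- The families of sections on the charts which agree on overlaps. -/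
def compatible (l : ∀ i j, C i →ₗ[R] C₂ i j) (r : ∀ i j, C j →ₗ[R] C₂ i j) :
    Submodule R (∀ i, C i) where
  carrier := {a | ∀ i j, l i j (a i) = r i j (a j)}
  add_mem' ha hb i j := by
    rw [Pi.add_apply, Pi.add_apply, map_add, map_add, ha, hb]
  zero_mem' i j := by rw [Pi.zero_apply, Pi.zero_apply, map_zero, map_zero]
  smul_mem' c a ha i j := by
    rw [Pi.smul_apply, Pi.smul_apply, map_smul, map_smul, ha]

/-- Global sections are the kernel of a linear map between finitely generated modules. -/
theorem IsChartSystem.nonempty_ker_crossDiff_equiv (h : IsChartSystem z w v l r x e) {d : ℕ}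
    (hd : Saturated w l r e d) (hd2 : Saturated w l r e (d + d)) :
    Nonempty (LinearMap.ker (crossDiff x d) ≃ₗ[R] compatible l r) := by
  let f : (ι → M d) →ₗ[R] (∀ i, C i) := LinearMap.pi fun i => e i d ∘ₗ LinearMap.proj i
  let g : LinearMap.ker (crossDiff x d) →ₗ[R] compatible l r :=
    f.restrict fun b hb => h.compat_of_crossDiff_eq_zero hb
  refine ⟨LinearEquiv.ofBijective g ⟨?_, ?_⟩⟩
  · rw [injective_iff_map_eq_zero]
    intro b hb
    exact Subtype.ext (h.eq_zero_of_crossDiff_eq_zero hd b.2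
      fun i => congrFun (congrArg Subtype.val hb) i)
  · rintro ⟨a, ha⟩
    obtain ⟨b, hb, hba⟩ := h.exists_crossDiff_eq_zero hd hd2 ha
    exact ⟨⟨b, hb⟩, Subtype.ext (funext hba)⟩

variable (A : Type*) [CommRing A] [Algebra R A] (Q : Type*) [AddCommGroup Q] [Module R Q]
  [Module A Q] [IsScalarTower R A Q]

theorem crossDiff_lTensor_tmul (x : ι → ∀ d, M d →ₗ[R] M (d + 1)) (d : ℕ) (q : Q) (b : ι → M d)
    (p : ι × ι) :
    crossDiff (fun i d => AlgebraTensorModule.lTensor A Q (x i d)) d (fun i => q ⊗ₜ[R] b i) p =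
      q ⊗ₜ[R] crossDiff x d b p := by
  obtain ⟨i, j⟩ := p
  rw [crossDiff_apply, crossDiff_apply, lTensor_iterTrans, lTensor_iterTrans, tmul_sub]
  rfl

theorem crossDiff_piRight [Fintype ι] [DecidableEq ι] (x : ι → ∀ d, M d →ₗ[R] M (d + 1)) (d : ℕ)
    (y : Q ⊗[R] (ι → M d)) :
    crossDiff (fun i d => AlgebraTensorModule.lTensor A Q (x i d)) d
        (TensorProduct.piRight R A Q (fun _ : ι => M d) y) =
      TensorProduct.piRight R A Q (fun _ : ι × ι => M (d + d))
        (AlgebraTensorModule.lTensor A Q (crossDiff x d) y) := by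
  induction y using TensorProduct.induction_on with
  | zero => simp only [map_zero]
  | add a b ha hb => simp only [map_add, ha, hb]
  | tmul q b =>
    funext p
    exact crossDiff_lTensor_tmul A Q x d q b p

theorem finrank_ker_crossDiff_lTensor [Finite ι] (x : ι → ∀ d, M d →ₗ[R] M (d + 1)) (d : ℕ) :
    Module.finrank A (LinearMap.ker (crossDiff
      (fun i d => AlgebraTensorModule.lTensor A A (x i d)) d)) =
      Module.finrank A (LinearMap.ker ((crossDiff x d).baseChange A)) := by
  classical
  cases nonempty_fintype ι
  let E := TensorProduct.piRight R A A (fun _ : ι => M d)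
  have : LinearMap.ker ((crossDiff x d).baseChange A) =
      (LinearMap.ker (crossDiff (fun i d => AlgebraTensorModule.lTensor A A (x i d)) d)).comap
        E.toLinearMap := by
    ext y
    rw [Submodule.mem_comap, LinearMap.mem_ker, LinearMap.mem_ker]
    change _ ↔ crossDiff (fun i d => AlgebraTensorModule.lTensor A A (x i d)) d
      (TensorProduct.piRight R A A (fun _ : ι => M d) y) = 0
    rw [crossDiff_piRight, LinearEquiv.map_eq_zero_iff]; rfl
  rw [this]
  exact (E.ofSubmodule' _).finrank_eq.symm

variable {A Q}

theorem SaturatedTensor.restrictScalars {d : ℕ} (h : SaturatedTensor A Q w l r e d) :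
    SaturatedTensor R Q w l r e d where
  inj m hm := h.inj m hm
  surj a ha := by
    simp only [← lTensor_pow'] at ha
    refine h.surj a fun i j => ?_
    rw [← lTensor_pow']
    exact ha i j

end Compatible

end Branch

namespace Branch

/-! ### Lifting compatible families -/

open TensorProduct IsLocalRing Polynomial

section Lifting

variable {R ι : Type*} [CommRing R] {A : ι → Type*} [∀ i, CommRing (A i)] [∀ i, Algebra R (A i)]
  {A₂ : ι → ι → Type*} [∀ i j, CommRing (A₂ i j)] [∀ i j, Algebra R (A₂ i j)]
  {M : ℕ → Type*} [∀ d, AddCommGroup (M d)] [∀ d, Module R (M d)]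
  {z : ∀ i, ι → Module.End R (A i)} {w : ∀ i j, ι → Module.End R (A₂ i j)}
  {v : ∀ i j, Module.End R (A₂ i j)} {l : ∀ i j, A i →ₐ[R] A₂ i j} {r : ∀ i j, A j →ₐ[R] A₂ i j}
  {x : ι → ∀ d, M d →ₗ[R] M (d + 1)} {e : ∀ i d, M d →ₗ[R] A i}

/-- Let `k` be a field which is a quotient of `R`. If a separable polynomial over `k` vanishes at the
image of `u`, then `u` becomes over `k` a simple root of a polynomial with coefficients in `R`. -/
theorem exists_simple_root_mod {B k : Type*} [CommRing B] [Algebra R B] [Field k] [Algebra R k]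
    (hk : Function.Surjective (algebraMap R k)) {p : k[X]} (hp : p.Separable) {u : B}
    (hu : aeval ((1 : k) ⊗ₜ[R] u : k ⊗[R] B) p = 0) :
    ∃ (P : R[X]) (c : B), (1 : k) ⊗ₜ[R] (aeval u P) = 0 ∧
      (1 : k) ⊗ₜ[R] (aeval u (derivative P) * c - 1) = 0 := by
  obtain ⟨P, rfl⟩ := Polynomial.map_surjective _ hk p
  obtain ⟨b, c, hbc⟩ := hp
  obtain ⟨C', rfl⟩ := Polynomial.map_surjective _ hk c
  have key : ∀ Q : R[X], aeval ((1 : k) ⊗ₜ[R] u : k ⊗[R] B) (Q.map (algebraMap R k)) =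
      (1 : k) ⊗ₜ[R] (aeval u Q) := fun Q => by
    have h1 : (Algebra.TensorProduct.includeRight : B →ₐ[R] k ⊗[R] B) u = (1 : k) ⊗ₜ u := rfl
    rw [aeval_map_algebraMap, ← h1, aeval_algHom_apply]; rfl
  refine ⟨P, aeval u C', by rw [← key, hu], ?_⟩
  have h2 := congrArg (aeval ((1 : k) ⊗ₜ[R] u : k ⊗[R] B)) hbc
  rw [derivative_map, map_add, map_mul, map_mul, hu, mul_zero, zero_add, key, key, map_one] at h2
  rw [tmul_sub, sub_eq_zero, mul_comm]
  rw [Algebra.TensorProduct.tmul_mul_tmul, one_mul] at h2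
  exact h2

theorem isReduced_pi_tensor [Finite ι] (Ω : Type*) [Field Ω] [Algebra R Ω]
    [∀ i, IsReduced (Ω ⊗[R] A i)] (k : Type*) [Field k] [Algebra R k] [Algebra k Ω]
    [IsScalarTower R k Ω] : IsReduced (Ω ⊗[k] (k ⊗[R] (∀ i, A i))) := by
  classical
  cases nonempty_fintype ι
  have E1 := (Algebra.TensorProduct.cancelBaseChange R k Ω Ω (∀ i, A i))
  have E2 := (Algebra.TensorProduct.piRight R Ω Ω A)
  exact isReduced_of_injective (E1.trans E2) (E1.trans E2).injective

/-- Compatible families of sections on the charts are integral over the base field as soon as they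
form a finite-dimensional space. -/
theorem isIntegral_of_compatible [Finite ι] (k : Type*) [Field k] [Algebra R k]
    [Module.Finite k (compatible (R := k)
      (fun i j => AlgebraTensorModule.lTensor k k (l i j).toLinearMap)
      (fun i j => AlgebraTensorModule.lTensor k k (r i j).toLinearMap))]
    (a : ∀ i, A i)
    (ha : ∀ i j, (1 : k) ⊗ₜ[R] (l i j (a i)) = (1 : k) ⊗ₜ[R] (r i j (a j))) :
    IsIntegral k ((1 : k) ⊗ₜ[R] a : k ⊗[R] (∀ i, A i)) := by
  classical
  cases nonempty_fintype ι
  let S : Subalgebra k (∀ i, k ⊗[R] A i) :=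
    { compatible (R := k)
      (fun i j => AlgebraTensorModule.lTensor k k (l i j).toLinearMap)
      (fun i j => AlgebraTensorModule.lTensor k k (r i j).toLinearMap) with
      mul_mem' := fun {a b} ha hb i j => by
        have h1 := ha i j
        have h2 := hb i j
        change Algebra.TensorProduct.map (AlgHom.id k k) (l i j) _ =
          Algebra.TensorProduct.map (AlgHom.id k k) (r i j) _ at h1 h2 ⊢
        rw [Pi.mul_apply, Pi.mul_apply, map_mul, map_mul, h1, h2]
      algebraMap_mem' := fun c i j => by
        change (algebraMap k k c) ⊗ₜ[R] (l i j 1) = (algebraMap k k c) ⊗ₜ[R] (r i j 1)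
        rw [map_one, map_one] }
  have : Module.Finite k S := inferInstanceAs (Module.Finite k (compatible (R := k)
      (fun i j => AlgebraTensorModule.lTensor k k (l i j).toLinearMap)
      (fun i j => AlgebraTensorModule.lTensor k k (r i j).toLinearMap)))
  let E := Algebra.TensorProduct.piRight R k k A
  have h1 : IsIntegral k (⟨E ((1 : k) ⊗ₜ[R] a), fun i j => by
    exact ha i j⟩ : S) := Algebra.IsIntegral.isIntegral _
  have h2 : IsIntegral k (E ((1 : k) ⊗ₜ[R] a)) := h1.map S.val
  have h3 := h2.map E.symm.toAlgHom
  have h4 : E.symm.toAlgHom (E ((1 : k) ⊗ₜ[R] a)) = (1 : k) ⊗ₜ[R] a := E.symm_apply_apply _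
  rwa [h4] at h3

/-- If the reduction of the charts stays reduced over a perfect field, then sections which are
compatible modulo the maximal ideal can be modified so as to be compatible modulo any given
power of the maximal ideal. -/
theorem exists_compatible_mod_pow [IsLocalRing R] [Finite ι] (Ω : Type*) [Field Ω] [PerfectField Ω]
    [Algebra R Ω] (hΩ : ∀ a ∈ maximalIdeal R, algebraMap R Ω a = 0)
    [∀ i, IsReduced (Ω ⊗[R] A i)]
    (hfin : Module.Finite (R ⧸ maximalIdeal R) (compatible (R := R ⧸ maximalIdeal R)
      (fun i j => AlgebraTensorModule.lTensor (R ⧸ maximalIdeal R) (R ⧸ maximalIdeal R)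
        (l i j).toLinearMap)
      (fun i j => AlgebraTensorModule.lTensor (R ⧸ maximalIdeal R) (R ⧸ maximalIdeal R)
        (r i j).toLinearMap)))
    (a : ∀ i, A i) (ha : ∀ i j, l i j (a i) - r i j (a j) ∈
      (maximalIdeal R • ⊤ : Submodule R (A₂ i j))) (n : ℕ) :
    ∃ a' : ∀ i, A i, (∀ i, a' i - a i ∈ (maximalIdeal R • ⊤ : Submodule R (A i))) ∧
      ∀ i j, l i j (a' i) - r i j (a' j) ∈ (maximalIdeal R ^ n • ⊤ : Submodule R (A₂ i j)) := by
  let : Field (R ⧸ maximalIdeal R) := Ideal.Quotient.field _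
  let : Algebra (R ⧸ maximalIdeal R) Ω := (Ideal.Quotient.lift _ (algebraMap R Ω) hΩ).toAlgebra
  have : IsScalarTower R (R ⧸ maximalIdeal R) Ω := IsScalarTower.of_algebraMap_eq fun _ => rfl
  let f : (∀ i, A i) →ₐ[R] (∀ p : ι × ι, A₂ p.1 p.2) :=
    AlgHom.pi fun p => (l p.1 p.2).comp (Pi.evalAlgHom R A p.1)
  let g : (∀ i, A i) →ₐ[R] (∀ p : ι × ι, A₂ p.1 p.2) :=
    AlgHom.pi fun p => (r p.1 p.2).comp (Pi.evalAlgHom R A p.2)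
  have hint : IsIntegral (R ⧸ maximalIdeal R)
      ((1 : R ⧸ maximalIdeal R) ⊗ₜ[R] a : (R ⧸ maximalIdeal R) ⊗[R] (∀ i, A i)) := by
    refine isIntegral_of_compatible (l := l) (r := r) (R ⧸ maximalIdeal R) a fun i j => ?_
    rw [← sub_eq_zero, ← tmul_sub]
    exact (one_tmul_eq_zero_iff _ _).2 (ha i j)
  have : IsReduced (Ω ⊗[R ⧸ maximalIdeal R] ((R ⧸ maximalIdeal R) ⊗[R] (∀ i, A i))) :=
    isReduced_pi_tensor Ω (R ⧸ maximalIdeal R)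
  have hsep : (minpoly (R ⧸ maximalIdeal R) ((1 : R ⧸ maximalIdeal R) ⊗ₜ[R] a :
      (R ⧸ maximalIdeal R) ⊗[R] (∀ i, A i))).Separable := separable_minpoly_of_isReduced (Ω := Ω) hint
  obtain ⟨P, c, hP, hc⟩ := exists_simple_root_mod (R := R) (k := R ⧸ maximalIdeal R)
    Ideal.Quotient.mk_surjective hsep (minpoly.aeval _ _)
  have hP' := (one_tmul_eq_zero_iff _ _).1 hP
  have hc' := (one_tmul_eq_zero_iff _ _).1 hc
  rw [Ideal.smul_top_eq_map] at hP' hc'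
  obtain ⟨a', h1, h2⟩ := exists_sub_mem_and_map_sub_map_mem (maximalIdeal R) f g P a c hP' hc'
    (by
      have : f a - g a ∈ (maximalIdeal R • ⊤ : Submodule R (∀ p : ι × ι, A₂ p.1 p.2)) :=
        (mem_smul_top_pi_iff _ _).2 fun p => ha p.1 p.2
      rw [Ideal.smul_top_eq_map] at this
      exact this) n
  have h1' : a' - a ∈ (maximalIdeal R • ⊤ : Submodule R (∀ i, A i)) := by
    rw [Ideal.smul_top_eq_map]; exact h1
  have h2' : f a' - g a' ∈ (maximalIdeal R ^ (n + 1) • ⊤ :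
      Submodule R (∀ p : ι × ι, A₂ p.1 p.2)) := by
    rw [Ideal.smul_top_eq_map]; exact h2
  refine ⟨a', (mem_smul_top_pi_iff _ _).1 h1', fun i j => ?_⟩
  exact Submodule.smul_mono_left (Ideal.pow_le_pow_right n.le_succ)
    ((mem_smul_top_pi_iff _ _).1 h2' (i, j))

end Lifting

/-! ### Invariance of the dimension of the space of global functions -/

section Main

/-- Over a Noetherian ring, the global functions form a finite module. -/
theorem IsChartSystem.finite_compatible {R ι : Type*} [CommRing R] [Finite ι]
    {C : ι → Type*} [∀ i, AddCommGroup (C i)] [∀ i, Module R (C i)]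
    {C₂ : ι → ι → Type*} [∀ i j, AddCommGroup (C₂ i j)] [∀ i j, Module R (C₂ i j)]
    {M : ℕ → Type*} [∀ d, AddCommGroup (M d)] [∀ d, Module R (M d)] [∀ d, Module.Finite R (M d)]
    {z : ∀ i, ι → Module.End R (C i)} {w : ∀ i j, ι → Module.End R (C₂ i j)}
    {v : ∀ i j, Module.End R (C₂ i j)} {l : ∀ i j, C i →ₗ[R] C₂ i j}
    {r : ∀ i j, C j →ₗ[R] C₂ i j} {x : ι → ∀ d, M d →ₗ[R] M (d + 1)}
    {e : ∀ i d, M d →ₗ[R] C i} (h : IsChartSystem z w v l r x e)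
    (hgen : ∃ d₁, ∀ d ≥ d₁, (⨆ i, LinearMap.range (x i d)) = ⊤) (K : Type*) [CommRing K]
    [IsNoetherianRing K] [Algebra R K] :
    Module.Finite K (compatible (R := K) (fun i j => AlgebraTensorModule.lTensor K K (l i j))
      (fun i j => AlgebraTensorModule.lTensor K K (r i j))) := by
  obtain ⟨d, h₁⟩ := h.eventually_saturatedTensor hgen K
  obtain ⟨E⟩ := (h.lTensor K K).nonempty_ker_crossDiff_equiv (h₁ d le_rfl)
    (h₁ (d + d) (Nat.le_add_left _ _))
  exact Module.Finite.equiv E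

theorem isFiniteLength_quotient_pow (R : Type*) [CommRing R] [IsNoetherianRing R] [IsLocalRing R]
    (n : ℕ) : IsFiniteLength R (R ⧸ maximalIdeal R ^ n) := by
  have : Ring.KrullDimLE 0 (R ⧸ maximalIdeal R ^ n) := by
    refine Ring.KrullDimLE.mk₀ fun I hI => ?_
    have h1 : maximalIdeal R ≤ I.comap (Ideal.Quotient.mk _) := by
      intro a ha
      refine hI.mem_of_pow_mem n ?_
      rw [← map_pow, Ideal.Quotient.eq_zero_iff_mem.2 (Ideal.pow_mem_pow ha n)]
      exact I.zero_mem
    have h2 : I.comap (Ideal.Quotient.mk (maximalIdeal R ^ n)) = maximalIdeal R :=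
      ((maximalIdeal.isMaximal R).eq_of_le (Ideal.comap_ne_top _ hI.ne_top) h1).symm
    have := maximalIdeal.isMaximal R
    rw [← h2] at this
    have h3 := Ideal.map_eq_top_or_isMaximal_of_surjective
      (Ideal.Quotient.mk (maximalIdeal R ^ n)) Ideal.Quotient.mk_surjective this
    rw [Ideal.map_comap_of_surjective _ Ideal.Quotient.mk_surjective] at h3
    exact h3.resolve_left hI.ne_top
  have : IsArtinianRing (R ⧸ maximalIdeal R ^ n) :=
    IsNoetherianRing.isArtinianRing_of_krullDimLE_zero
  rw [isFiniteLength_iff_isNoetherian_isArtinian]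
  exact ⟨inferInstance, isArtinian_of_surjective_algebraMap
    (R := R ⧸ maximalIdeal R ^ n) Ideal.Quotient.mk_surjective⟩

variable {R ι : Type*} [CommRing R] [IsNoetherianRing R] [IsLocalRing R] [Finite ι]
  {A : ι → Type*} [∀ i, CommRing (A i)] [∀ i, Algebra R (A i)]
  {A₂ : ι → ι → Type*} [∀ i j, CommRing (A₂ i j)] [∀ i j, Algebra R (A₂ i j)]
  {M : ℕ → Type*} [∀ d, AddCommGroup (M d)] [∀ d, Module R (M d)] [∀ d, Module.Finite R (M d)]
  [∀ i, Module.Flat R (A i)] [∀ i j, Module.Flat R (A₂ i j)]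
  {z : ∀ i, ι → Module.End R (A i)} {w : ∀ i j, ι → Module.End R (A₂ i j)}
  {v : ∀ i j, Module.End R (A₂ i j)} {l : ∀ i j, A i →ₐ[R] A₂ i j} {r : ∀ i j, A j →ₐ[R] A₂ i j}
  {x : ι → ∀ d, M d →ₗ[R] M (d + 1)} {e : ∀ i d, M d →ₗ[R] A i}

/-- Families of elements of `M d` killed by `crossDiff` modulo the maximal ideal lift to elements killed modulo
any power of the maximal ideal. -/
theorem IsChartSystem.exists_crossDiff_mem_pow
    (h : IsChartSystem z w v (fun i j => (l i j).toLinearMap) (fun i j => (r i j).toLinearMap) x e)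
    (Ω : Type*) [Field Ω] [PerfectField Ω]
    [Algebra R Ω] (hΩ : ∀ a ∈ maximalIdeal R, algebraMap R Ω a = 0)
    [∀ i, IsReduced (Ω ⊗[R] A i)] {d : ℕ}
    (hd : SaturatedTensor (R ⧸ maximalIdeal R) (R ⧸ maximalIdeal R) w
      (fun i j => (l i j).toLinearMap) (fun i j => (r i j).toLinearMap) e d)
    (hd2 : SaturatedTensor (R ⧸ maximalIdeal R) (R ⧸ maximalIdeal R) w
      (fun i j => (l i j).toLinearMap) (fun i j => (r i j).toLinearMap) e (d + d))
    (u : ι → M d) (hu : crossDiff x d u ∈ (maximalIdeal R • ⊤ : Submodule R (ι × ι → M (d + d))))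
    (n : ℕ) :
    ∃ u', u' - u ∈ (maximalIdeal R • ⊤ : Submodule R (ι → M d)) ∧
      crossDiff x d u' ∈ (maximalIdeal R ^ n • ⊤ : Submodule R (ι × ι → M (d + d))) := by
  wlog hn : n ≠ 0 generalizing n
  · rw [not_not] at hn
    subst hn
    exact ⟨u, by rw [sub_self]; exact Submodule.zero_mem _, by simp⟩
  have hK := h.lTensor (R ⧸ maximalIdeal R) (R ⧸ maximalIdeal R)
  have hkR := h.lTensor R (R ⧸ maximalIdeal R)
  have hQ := h.lTensor R (R ⧸ maximalIdeal R ^ n)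
  have hdQ := SaturatedTensor.of_isFiniteLength h hd.restrictScalars
    (isFiniteLength_quotient_pow R n)
  have hdQ2 := SaturatedTensor.of_isFiniteLength h hd2.restrictScalars
    (isFiniteLength_quotient_pow R n)
  have hfin : Module.Finite (R ⧸ maximalIdeal R) (compatible (R := R ⧸ maximalIdeal R)
      (fun i j => AlgebraTensorModule.lTensor (R ⧸ maximalIdeal R) (R ⧸ maximalIdeal R)
        (l i j).toLinearMap)
      (fun i j => AlgebraTensorModule.lTensor (R ⧸ maximalIdeal R) (R ⧸ maximalIdeal R)
        (r i j).toLinearMap)) := by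
    obtain ⟨E⟩ := hK.nonempty_ker_crossDiff_equiv hd hd2
    exact Module.Finite.equiv E
  have hu' : crossDiff (fun i d => AlgebraTensorModule.lTensor R (R ⧸ maximalIdeal R) (x i d)) d
      (fun i => (1 : R ⧸ maximalIdeal R) ⊗ₜ[R] u i) = 0 := by
    funext p
    rw [crossDiff_lTensor_tmul]
    exact (one_tmul_eq_zero_iff _ _).2 ((mem_smul_top_pi_iff _ _).1 hu p)
  obtain ⟨a', h1, h2⟩ := exists_compatible_mod_pow Ω hΩ hfin (fun i => e i d (u i))
    (fun i j => by
      rw [← one_tmul_eq_zero_iff, tmul_sub, sub_eq_zero]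
      exact hkR.compat_of_crossDiff_eq_zero hu' i j) n
  obtain ⟨b, hb, hba⟩ := hQ.exists_crossDiff_eq_zero hdQ hdQ2
    (a := fun i => (1 : R ⧸ maximalIdeal R ^ n) ⊗ₜ[R] a' i) (fun i j => by
      have := (one_tmul_eq_zero_iff _ _).2 (h2 i j)
      rw [tmul_sub, sub_eq_zero] at this
      exact this)
  choose u' hu'' using fun i => exists_one_tmul_eq _ (b i)
  obtain rfl : (fun i => (1 : R ⧸ maximalIdeal R ^ n) ⊗ₜ[R] u' i) = b := funext hu''
  have hφ : crossDiff x d u' ∈ (maximalIdeal R ^ n • ⊤ : Submodule R (ι × ι → M (d + d))) := by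
    refine (mem_smul_top_pi_iff _ _).2 fun p => (one_tmul_eq_zero_iff _ _).1 ?_
    rw [← crossDiff_lTensor_tmul R, hb]; rfl
  have hle : maximalIdeal R ^ n ≤ maximalIdeal R := Ideal.pow_le_self hn
  refine ⟨u', (mem_smul_top_pi_iff _ _).2 fun i => (one_tmul_eq_zero_iff _ _).1 ?_, hφ⟩
  refine congrFun (hkR.eq_zero_of_crossDiff_eq_zero hd.restrictScalars
    (b := fun i => (1 : R ⧸ maximalIdeal R) ⊗ₜ[R] (u' - u) i) ?_ fun i => ?_) i
  · funext p
    rw [crossDiff_lTensor_tmul, map_sub]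
    exact (one_tmul_eq_zero_iff _ _).2 (Submodule.sub_mem _
      (Submodule.smul_mono_left hle ((mem_smul_top_pi_iff _ _).1 hφ p))
      ((mem_smul_top_pi_iff _ _).1 hu p))
  · refine (one_tmul_eq_zero_iff _ _).2 ?_
    rw [Pi.sub_apply, map_sub, ← sub_add_sub_cancel _ (a' i)]
    refine Submodule.add_mem _ (Submodule.smul_mono_left hle ?_) (h1 i)
    rw [← one_tmul_eq_zero_iff, tmul_sub, sub_eq_zero]
    exact hba i

/-- The dimension of the space of compatible families of sections is the same over any two fields
over the local ring `R`, provided that the reduction of the charts stays reduced over a perfect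
field. -/
theorem IsChartSystem.finrank_compatible_eq
    (h : IsChartSystem z w v (fun i j => (l i j).toLinearMap) (fun i j => (r i j).toLinearMap) x e)
    (hgen : ∃ d₁, ∀ d ≥ d₁, (⨆ i, LinearMap.range (x i d)) = ⊤)
    (Ω : Type*) [Field Ω] [PerfectField Ω]
    [Algebra R Ω] (hΩ : ∀ a ∈ maximalIdeal R, algebraMap R Ω a = 0)
    [∀ i, IsReduced (Ω ⊗[R] A i)] (K : Type*) [Field K] [Algebra R K] :
    Module.finrank K (compatible (R := K)
      (fun i j => AlgebraTensorModule.lTensor K K (l i j).toLinearMap)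
      (fun i j => AlgebraTensorModule.lTensor K K (r i j).toLinearMap)) =
    Module.finrank Ω (compatible (R := Ω)
      (fun i j => AlgebraTensorModule.lTensor Ω Ω (l i j).toLinearMap)
      (fun i j => AlgebraTensorModule.lTensor Ω Ω (r i j).toLinearMap)) := by
  obtain ⟨d₁, h₁⟩ := h.eventually_saturatedTensor hgen (R ⧸ maximalIdeal R)
  obtain ⟨d₂, h₂⟩ := h.eventually_saturatedTensor hgen Ω
  obtain ⟨d₃, h₃⟩ := h.eventually_saturatedTensor hgen K
  obtain ⟨d₄, h₄⟩ := h.eventually_free hgen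
  obtain ⟨d, hd₁, hd₂, hd₃, hd₄⟩ : ∃ d, d₁ ≤ d ∧ d₂ ≤ d ∧ d₃ ≤ d ∧ d₄ ≤ d :=
    ⟨d₁ + d₂ + d₃ + d₄, by omega, by omega, by omega, by omega⟩
  have := h₄ d hd₄
  have := h₄ (d + d) (by omega)
  have key := (exists_sub_mem_and_map_eq_zero
    (maximalIdeal R) _ (h.exists_crossDiff_mem_pow Ω hΩ (h₁ d hd₁) (h₁ (d + d) (by omega))))
  have h1 := finrank_ker_baseChange_add (crossDiff x d) key K
  have h2 := finrank_ker_baseChange_add (crossDiff x d) key Ω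
  obtain ⟨E⟩ := (h.lTensor K K).nonempty_ker_crossDiff_equiv (h₃ d hd₃) (h₃ (d + d) (by omega))
  obtain ⟨E'⟩ := (h.lTensor Ω Ω).nonempty_ker_crossDiff_equiv (h₂ d hd₂) (h₂ (d + d) (by omega))
  rw [← E.finrank_eq, ← E'.finrank_eq, finrank_ker_crossDiff_lTensor,
    finrank_ker_crossDiff_lTensor]
  omega

end Main

end Branch

namespace Branch

/-! ### The graded module of a scheme finite over projective space -/

section GradedPart

variable {R : Type*} [CommRing R] {ι : Type*} {B : Type*} [CommRing B] [Algebra R B]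

/-- The graded pieces of the module over the polynomial ring generated by the elements of `G d` in
degree `d`, where the variable `j` acts as multiplication by `ζ j`. -/
def gradedPart (R : Type*) [CommRing R] [Algebra R B] (ζ : ι → B) (G : ℕ → Set B) :
    ℕ → Submodule R B
  | 0 => Submodule.span R (G 0)
  | d + 1 => Submodule.span R (G (d + 1)) ⊔
      ⨆ j, (gradedPart R ζ G d).map (LinearMap.mulLeft R (ζ j))

variable {ζ : ι → B} {G : ℕ → Set B}

theorem mul_mem_gradedPart {d : ℕ} {b : B} (hb : b ∈ gradedPart R ζ G d) (j : ι) :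
    ζ j * b ∈ gradedPart R ζ G (d + 1) :=
  Submodule.mem_sup_right (Submodule.mem_iSup_of_mem j ⟨b, hb, rfl⟩)

theorem subset_gradedPart (d : ℕ) : G d ⊆ gradedPart R ζ G d := by
  cases d with
  | zero => exact Submodule.subset_span
  | succ d => exact fun b hb => Submodule.mem_sup_left (Submodule.subset_span hb)

theorem gradedPart_fg [Finite ι] (hG : ∀ d, (G d).Finite) (d : ℕ) : (gradedPart R ζ G d).FG := by
  induction d with
  | zero => exact Submodule.fg_span (hG 0)
  | succ d ih => exact (Submodule.fg_span (hG _)).sup (Submodule.fg_iSup _ fun j => ih.map _)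

theorem gradedPart_le {P : ℕ → Submodule R B} (hG : ∀ d, G d ⊆ P d)
    (hP : ∀ d b j, b ∈ P d → ζ j * b ∈ P (d + 1)) (d : ℕ) : gradedPart R ζ G d ≤ P d := by
  induction d with
  | zero => exact Submodule.span_le.2 (hG 0)
  | succ d ih =>
    refine sup_le (Submodule.span_le.2 (hG _)) (iSup_le fun j => ?_)
    rintro _ ⟨b, hb, rfl⟩
    exact hP d b j (ih hb)

/-- Multiplication by `ζ j`, from degree `d` to degree `d + 1`. -/
def gradedMul (R : Type*) [CommRing R] [Algebra R B] (ζ : ι → B) (G : ℕ → Set B) (j : ι) (d : ℕ) :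
    gradedPart R ζ G d →ₗ[R] gradedPart R ζ G (d + 1) :=
  (LinearMap.mulLeft R (ζ j)).restrict fun _ hb => mul_mem_gradedPart hb j

theorem coe_iterTrans_gradedMul (j : ι) (d n : ℕ) (m : gradedPart R ζ G d) :
    (iterTrans (N := fun d => gradedPart R ζ G d) (gradedMul R ζ G j) d n m : B) =
      ζ j ^ n * m := by
  induction n with
  | zero => rw [pow_zero, one_mul]; rfl
  | succ n ih =>
    change ζ j * (iterTrans (N := fun d => gradedPart R ζ G d) (gradedMul R ζ G j) d n m : B) = _
    rw [ih]; ring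

theorem iSup_range_gradedMul {d : ℕ} (hd : G (d + 1) = ∅) :
    (⨆ j, LinearMap.range (gradedMul R ζ G j d)) = ⊤ := by
  rw [eq_top_iff]
  rintro ⟨b, hb⟩ -
  have hb' : b ∈ ⨆ j, (gradedPart R ζ G d).map (LinearMap.mulLeft R (ζ j)) := by
    rw [gradedPart, hd, Submodule.span_empty, bot_sup_eq] at hb
    exact hb
  have : (⨆ j, (gradedPart R ζ G d).map (LinearMap.mulLeft R (ζ j))) ≤
      (⨆ j, LinearMap.range (gradedMul R ζ G j d)).map (gradedPart R ζ G (d + 1)).subtype := by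
    refine iSup_le fun j => ?_
    rintro _ ⟨b, hb, rfl⟩
    exact ⟨gradedMul R ζ G j d ⟨b, hb⟩, Submodule.mem_iSup_of_mem j ⟨_, rfl⟩, rfl⟩
  obtain ⟨m, hm, hmb⟩ := this hb'
  have : m = ⟨b, hb⟩ := Subtype.ext hmb
  exact this ▸ hm

end GradedPart

section ChartRings

variable {R ι : Type*} [CommRing R] {A : ι → Type*} [∀ i, CommRing (A i)] [∀ i, Algebra R (A i)]
  {A₂ : ι → ι → Type*} [∀ i j, CommRing (A₂ i j)] [∀ i j, Algebra R (A₂ i j)]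

/-- Families of sections `a i` of a twist `𝒪(d)` on the charts, i.e. `a i = (x j / x i) ^ d * a j`
on overlaps, where `z i j` stands for `x j / x i`. -/
def twistedSections (z : ∀ i, ι → A i) (l : ∀ i j, A i →ₐ[R] A₂ i j) (r : ∀ i j, A j →ₐ[R] A₂ i j)
    (d : ℕ) : Submodule R (∀ i, A i) where
  carrier := {a | ∀ i j, l i j (a i) = l i j (z i j) ^ d * r i j (a j)}
  add_mem' ha hb i j := by
    rw [Pi.add_apply, Pi.add_apply, map_add, map_add, ha, hb, mul_add]
  zero_mem' i j := by rw [Pi.zero_apply, Pi.zero_apply, map_zero, map_zero, mul_zero]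
  smul_mem' c a ha i j := by
    rw [Pi.smul_apply, Pi.smul_apply, map_smul, map_smul, ha, mul_smul_comm]

/-- The rings of sections on the standard charts of a scheme finite over projective space, and on
their overlaps. Here `z i j` is the function `x j / x i`. The fields `surj` and `ker` say that the
ring of an overlap arises from that of a chart by inverting `z i j`, and `extend` says that a section
on a chart extends to a section of a twist after multiplication by a power of `x i`. -/
structure IsChartRings (z : ∀ i, ι → A i) (l : ∀ i j, A i →ₐ[R] A₂ i j)
    (r : ∀ i j, A j →ₐ[R] A₂ i j) : Prop where
  z_self : ∀ i, z i i = 1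
  cocycle : ∀ i j k, l i j (z i k) = l i j (z i j) * r i j (z j k)
  surj : ∀ i j (a : A₂ i j), ∃ n c, l i j c = l i j (z i j) ^ n * a
  ker : ∀ i j (c : A i), l i j c = 0 → ∃ n, z i j ^ n * c = 0
  extend : ∀ i (a : A i), ∃ d, ∃ b ∈ twistedSections z l r d, b i = a
  finite : ∀ i, Module.Finite (Algebra.adjoin R (Set.range (z i))) (A i)

variable {z : ∀ i, ι → A i} {l : ∀ i j, A i →ₐ[R] A₂ i j} {r : ∀ i j, A j →ₐ[R] A₂ i j}

theorem mul_mem_twistedSections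
    (h : ∀ i j k, l i j (z i k) = l i j (z i j) * r i j (z j k)) {d : ℕ} {b : ∀ i, A i}
    (hb : b ∈ twistedSections z l r d) (k : ι) :
    (fun i => z i k) * b ∈ twistedSections z l r (d + 1) := fun i j => by
  rw [Pi.mul_apply, Pi.mul_apply, map_mul, map_mul, hb i j, h i j k]
  ring

/-- There are finitely many twisted sections such that the graded module they generate gives all
sections on each chart. -/
theorem IsChartRings.exists_generators [Finite ι] (h : IsChartRings z l r) :
    ∃ G : ℕ → Set (∀ i, A i), (∀ d, (G d).Finite) ∧ (∃ d₁, ∀ d ≥ d₁, G d = ∅) ∧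
      (∀ d, G d ⊆ twistedSections z l r d) ∧
      ∀ i (a : A i), ∃ d, ∃ m ∈ gradedPart R (fun k i => z i k) G d, m i = a := by
  have := h.finite
  choose g hg using fun i => (this i).fg_top
  choose D b hb hba using h.extend
  have hfin : (⋃ i, (fun a => (D i a, b i a)) '' (g i : Set (A i))).Finite :=
    Set.finite_iUnion fun i => (g i).finite_toSet.image _
  refine ⟨fun d => {c | (d, c) ∈ ⋃ i, (fun a => (D i a, b i a)) '' (g i : Set (A i))},
    fun d => hfin.preimage (fun _ _ _ _ h => (Prod.mk.inj h).2), ?_, ?_, fun i a => ?_⟩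
  · obtain ⟨N, hN⟩ := (hfin.image Prod.fst).bddAbove
    refine ⟨N + 1, fun d hd => Set.eq_empty_of_forall_notMem fun c hc => ?_⟩
    have : d ≤ N := hN ⟨(d, c), hc, rfl⟩
    omega
  · intro d c hc
    obtain ⟨i, a, -, hac⟩ := Set.mem_iUnion.1 hc
    obtain ⟨rfl, rfl⟩ := Prod.mk.inj hac
    exact hb i a
  · set G : ℕ → Set (∀ i, A i) :=
      fun d => {c | (d, c) ∈ ⋃ i, (fun a => (D i a, b i a)) '' (g i : Set (A i))}
    let P : A i → Prop := fun a => ∃ d, ∃ m ∈ gradedPart R (fun k i => z i k) G d, m i = a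
    have hraise : ∀ {d m} (n : ℕ), m ∈ gradedPart R (fun k i => z i k) G d →
        ∃ m' ∈ gradedPart R (fun k i => z i k) G (d + n), m' i = m i := by
      intro d m n hm
      induction n with
      | zero => exact ⟨m, hm, rfl⟩
      | succ n ih =>
        obtain ⟨m', hm', h'⟩ := ih
        refine ⟨_, mul_mem_gradedPart hm' i, ?_⟩
        rw [Pi.mul_apply, h.z_self, one_mul, h']
    have hadd : ∀ a a', P a → P a' → P (a + a') := by
      rintro _ _ ⟨d, m, hm, rfl⟩ ⟨d', m', hm', rfl⟩
      obtain ⟨m₁, hm₁, h₁⟩ := hraise d' hm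
      obtain ⟨m₂, hm₂, h₂⟩ := hraise d hm'
      rw [add_comm] at hm₂
      exact ⟨_, _, Submodule.add_mem _ hm₁ hm₂, by rw [Pi.add_apply, h₁, h₂]⟩
    have hsmul : ∀ (s : Algebra.adjoin R (Set.range (z i))) a, P a → P (s • a) := by
      rintro ⟨s, hs⟩ a ha
      change P (s * a)
      induction hs using Algebra.adjoin_induction generalizing a with
      | mem s hs =>
        obtain ⟨k, rfl⟩ := hs
        obtain ⟨d, m, hm, rfl⟩ := ha
        exact ⟨_, _, mul_mem_gradedPart hm k, rfl⟩
      | algebraMap c =>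
        obtain ⟨d, m, hm, rfl⟩ := ha
        exact ⟨_, _, Submodule.smul_mem _ c hm, by rw [Pi.smul_apply, Algebra.smul_def]⟩
      | add s s' _ _ hs hs' => rw [add_mul]; exact hadd _ _ (hs a ha) (hs' a ha)
      | mul s s' _ _ hs hs' => rw [mul_assoc]; exact hs _ (hs' a ha)
    have ha : a ∈ Submodule.span (Algebra.adjoin R (Set.range (z i))) (g i : Set (A i)) :=
      hg i ▸ Submodule.mem_top
    induction ha using Submodule.span_induction with
    | mem a ha =>
      exact ⟨D i a, b i a, subset_gradedPart _ (Set.mem_iUnion.2 ⟨i, a, ha, rfl⟩), hba i a⟩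
    | zero => exact ⟨0, 0, Submodule.zero_mem _, rfl⟩
    | add a a' _ _ h1 h2 => exact hadd _ _ h1 h2
    | smul s a _ h1 => exact hsmul s a h1

theorem mulLeft_pow_apply {B : Type*} [CommRing B] [Algebra R B] (b c : B) (n : ℕ) :
    (LinearMap.mulLeft R b ^ n) c = b ^ n * c := by
  rw [LinearMap.pow_mulLeft]; rfl

/-- The charts of a scheme finite over projective space form a chart system, for a suitable finitely
generated graded module. -/
theorem IsChartRings.exists_isChartSystem [Finite ι] (h : IsChartRings z l r) :
    ∃ (M : ℕ → Submodule R (∀ i, A i)) (x : ι → ∀ d, M d →ₗ[R] M (d + 1))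
      (e : ∀ i d, M d →ₗ[R] A i), (∀ d, Module.Finite R (M d)) ∧
      (∃ d₁, ∀ d ≥ d₁, (⨆ i, LinearMap.range (x i d)) = ⊤) ∧
      IsChartSystem (M := fun d => M d) (fun i k => LinearMap.mulLeft R (z i k))
        (fun i j k => LinearMap.mulLeft R (l i j (z i k)))
        (fun i j => LinearMap.mulLeft R (r i j (z j i)))
        (fun i j => (l i j).toLinearMap) (fun i j => (r i j).toLinearMap) x e := by
  obtain ⟨G, hfin, ⟨d₁, hd₁⟩, hG, hsurj⟩ := h.exists_generators
  set ζ : ι → ∀ i, A i := fun k i => z i k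
  have hle := gradedPart_le (ζ := ζ) hG fun d b j hb => mul_mem_twistedSections h.cocycle hb j
  have hinv : ∀ i j, r i j (z j i) * l i j (z i j) = 1 := fun i j => by
    rw [mul_comm, ← h.cocycle, h.z_self, map_one]
  refine ⟨gradedPart R ζ G, gradedMul R ζ G,
    fun i d => LinearMap.proj i ∘ₗ (gradedPart R ζ G d).subtype,
    fun d => Module.Finite.iff_fg.2 (gradedPart_fg hfin d),
    ⟨d₁, fun d hd => iSup_range_gradedMul (hd₁ _ (by omega))⟩, ?_⟩
  exact
    { x_comm := fun i j d => LinearMap.ext fun m => Subtype.ext (mul_left_comm (ζ i) (ζ j) m)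
      z_self := fun i => by rw [h.z_self]; exact LinearMap.mulLeft_one _ _
      z_comm := fun i j k => LinearMap.ext fun a => mul_left_comm _ _ a
      w_comm := fun i j k k' => LinearMap.ext fun a => mul_left_comm _ _ a
      v_w := fun i j => LinearMap.ext fun a => by
        change r i j (z j i) * (l i j (z i j) * a) = a
        rw [← mul_assoc, hinv, one_mul]
      l_z := fun i j k => LinearMap.ext fun a => map_mul (l i j) _ _
      r_z := fun i j k => LinearMap.ext fun a => by
        change l i j (z i j) * r i j (z j k * a) = l i j (z i k) * r i j a
        rw [map_mul, ← mul_assoc, h.cocycle i j k]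
      e_x := fun i j d => rfl
      l_e := fun i j d => LinearMap.ext fun m => by
        change l i j (m.1 i) = (LinearMap.mulLeft R (l i j (z i j)) ^ d) (r i j (m.1 j))
        rw [mulLeft_pow_apply]
        exact hle d m.2 i j
      colim_e := fun i =>
        { comp_trans := fun d => LinearMap.ext fun m => by
            change z i i * m.1 i = m.1 i
            rw [h.z_self, one_mul]
          surj := fun a => by
            obtain ⟨d, m, hm, rfl⟩ := hsurj i a
            exact ⟨d, ⟨m, hm⟩, rfl⟩
          ker := fun d m hm => by
            have hm0 : m.1 i = 0 := hm
            have h1 : ∀ k, ∃ n, z k i ^ n * m.1 k = 0 := fun k => h.ker k i _ (by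
              rw [hle d m.2 k i, hm0, map_zero, mul_zero])
            choose n hn using h1
            obtain ⟨N, hN⟩ := (Set.finite_range n).bddAbove
            refine ⟨N, Subtype.ext ?_⟩
            rw [coe_iterTrans_gradedMul]
            funext k
            obtain ⟨s, hs⟩ := Nat.exists_eq_add_of_le (hN ⟨k, rfl⟩)
            change z k i ^ N * m.1 k = 0
            rw [hs, pow_add, mul_right_comm, hn, zero_mul] }
      colim_l := fun i j =>
        { comp_trans := fun d => LinearMap.ext fun a => by
            change (LinearMap.mulLeft R (r i j (z j i)) ^ (d + 1)) (l i j (z i j * a)) =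
              (LinearMap.mulLeft R (r i j (z j i)) ^ d) (l i j a)
            rw [mulLeft_pow_apply, mulLeft_pow_apply, map_mul, pow_succ, mul_assoc,
              ← mul_assoc (r i j (z j i)) (l i j (z i j)), hinv, one_mul]
          surj := fun a => by
            obtain ⟨n, c, hc⟩ := h.surj i j a
            refine ⟨n, c, ?_⟩
            change (LinearMap.mulLeft R (r i j (z j i)) ^ n) (l i j c) = a
            rw [mulLeft_pow_apply, hc, ← mul_assoc, ← mul_pow, hinv, one_pow, one_mul]
          ker := fun d a ha => by
            change (LinearMap.mulLeft R (r i j (z j i)) ^ d) (l i j a) = 0 at ha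
            rw [mulLeft_pow_apply] at ha
            have : l i j a = 0 := by
              have h2 : l i j (z i j) ^ d * (r i j (z j i) ^ d * l i j a) = l i j a := by
                rw [← mul_assoc, ← mul_pow, mul_comm (l i j (z i j)), hinv, one_pow, one_mul]
              rw [← h2, ha, mul_zero]
            obtain ⟨n, hn⟩ := h.ker i j a this
            refine ⟨n, ?_⟩
            rw [iterTrans_const, mulLeft_pow_apply, hn] } }

end ChartRings

end Branch

namespace Branch

/-! ### Sections of schemes over an affine base -/

section Sections

variable {R : Type u} [CommRing R] {T : Scheme.{u}}

/-- The sections of the structure sheaf of a scheme over `Spec R`. The structure morphism is a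
parameter in order to carry the `R`-algebra structure. -/
def Sec (_π : T ⟶ Spec (.of R)) (U : T.Opens) : Type u := Γ(T, U)

variable (π : T ⟶ Spec (.of R))

instance (U : T.Opens) : CommRing (Sec π U) := inferInstanceAs (CommRing Γ(T, U))

theorem le_preimage_top {X Y : Scheme.{u}} (f : X ⟶ Y) (U : X.Opens) : U ≤ f ⁻¹ᵁ ⊤ := le_top

/-- The structure map of the `R`-algebra of sections over `U`. -/
noncomputable def Sec.structureMap (U : T.Opens) : CommRingCat.of R ⟶ Γ(T, U) :=
  (Scheme.ΓSpecIso (.of R)).inv ≫ π.appLE ⊤ U (le_preimage_top π U)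

theorem Sec.structureMap_map {U V : T.Opens} (h : V ≤ U) :
    Sec.structureMap π U ≫ T.presheaf.map (homOfLE h).op = Sec.structureMap π V := by
  rw [Sec.structureMap, Category.assoc, Scheme.Hom.appLE_map, Sec.structureMap]

noncomputable instance (U : T.Opens) : Algebra R (Sec π U) :=
  (Sec.structureMap π U).hom.toAlgebra

/-- Restriction of sections. -/
noncomputable def Sec.res {U V : T.Opens} (h : V ≤ U) : Sec π U →ₐ[R] Sec π V where
  toRingHom := (T.presheaf.map (homOfLE h).op).hom
  commutes' r := ConcreteCategory.congr_hom (Sec.structureMap_map π h) r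

theorem Sec.res_res {U V W : T.Opens} (h : V ≤ U) (h' : W ≤ V) (a : Sec π U) :
    Sec.res π h' (Sec.res π h a) = Sec.res π (h'.trans h) a := by
  change (T.presheaf.map (homOfLE h).op ≫ T.presheaf.map (homOfLE h').op) a = _
  rw [← Functor.map_comp]
  rfl

theorem Sec.res_self {U : T.Opens} (h : U ≤ U) (a : Sec π U) : Sec.res π h a = a := by
  change T.presheaf.map (𝟙 _) a = a
  rw [T.presheaf.map_id]; rfl

theorem Sec.exists_res_eq_pow_mul {U V : T.Opens} (hU : IsAffineOpen U) (f : Sec π U)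
    (hV : T.basicOpen (U := U) f = V) (h : V ≤ U) (a : Sec π V) :
    ∃ n c, Sec.res π h c = Sec.res π h f ^ n * a := by
  subst hV
  exact exists_eq_pow_mul_of_isAffineOpen T U hU f a

theorem Sec.exists_pow_mul_eq_zero {U V : T.Opens} (hU : IsAffineOpen U) (f : Sec π U)
    (hV : T.basicOpen (U := U) f = V) (h : V ≤ U) (a : Sec π U) (ha : Sec.res π h a = 0) :
    ∃ n, f ^ n * a = 0 := by
  subst hV
  exact exists_pow_mul_eq_zero_of_res_basicOpen_eq_zero_of_isAffineOpen T hU a f ha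

theorem Sec.basicOpen_res {U V : T.Opens} (h : V ≤ U) (f : Sec π U) :
    T.basicOpen (U := V) (Sec.res π h f) = V ⊓ T.basicOpen (U := U) f :=
  T.basicOpen_res f (homOfLE h).op

theorem Sec.flat {U : T.Opens} (hU : IsAffineOpen U) [Flat π] : Module.Flat R (Sec π U) := by
  have h1 : (π.appLE ⊤ U (le_preimage_top π U)).hom.Flat :=
    HasRingHomProperty.appLE @Flat π inferInstance ⟨⊤, isAffineOpen_top _⟩ ⟨U, hU⟩ (le_preimage_top π U)
  have h2 : (Sec.structureMap π U).hom.Flat := by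
    rw [Sec.structureMap, CommRingCat.hom_comp]
    exact RingHom.Flat.comp (RingHom.Flat.of_bijective
      (ConcreteCategory.bijective_of_isIso (Scheme.ΓSpecIso (.of R)).inv)) h1
  exact h2

end Sections

/-! ### Charts of schemes over projective space -/

section Charts

variable {R : Type u} [CommRing R] {T : Scheme.{u}} (π : T ⟶ Spec (.of R)) {ι : Type*}

/-- Affine opens `U i` with functions `z i j = x j / x i`, as for the standard charts of a scheme
affine over projective space. -/
structure IsChartCover (U : ι → T.Opens) (z : ∀ i, ι → Sec π (U i)) : Prop where
  isAffineOpen : ∀ i, IsAffineOpen (U i)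
  iSup_eq_top : ⨆ i, U i = ⊤
  basicOpen_eq : ∀ i j, T.basicOpen (U := U i) (z i j) = U i ⊓ U j
  z_self : ∀ i, z i i = 1
  cocycle : ∀ i j k, Sec.res π inf_le_left (z i k) =
    Sec.res π (inf_le_left : U i ⊓ U j ≤ _) (z i j) * Sec.res π inf_le_right (z j k)

variable {π} {U : ι → T.Opens} {z : ∀ i, ι → Sec π (U i)}

theorem IsChartCover.isAffineOpen_inf (h : IsChartCover π U z) (i j : ι) :
    IsAffineOpen (U i ⊓ U j) := by
  rw [← h.basicOpen_eq]
  exact (h.isAffineOpen i).basicOpen _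

/-- The cocycle relation on an arbitrary open contained in two charts. -/
theorem IsChartCover.res_z (h : IsChartCover π U z) {V : T.Opens} (i j k : ι) (hi : V ≤ U i)
    (hj : V ≤ U j) :
    Sec.res π hi (z i k) = Sec.res π hi (z i j) * Sec.res π hj (z j k) := by
  have := congrArg (Sec.res π (le_inf hi hj)) (h.cocycle i j k)
  rwa [map_mul, Sec.res_res, Sec.res_res, Sec.res_res] at this

/-- Every section on the chart `i` extends to a section of a twist, after multiplication by a power
of `x i`. -/
theorem IsChartCover.extend [Finite ι] (h : IsChartCover π U z) (i : ι) (a : Sec π (U i)) :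
    ∃ d, ∃ b ∈ twistedSections z (fun j k => Sec.res π (inf_le_left : U j ⊓ U k ≤ _))
      (fun _ _ => Sec.res π inf_le_right) d, b i = a := by
  -- sections on the other charts with the correct restriction to the chart `i`
  have h1 : ∀ k, ∃ n c, Sec.res π (inf_le_left : U k ⊓ U i ≤ _) c =
      Sec.res π inf_le_left (z k i) ^ n * Sec.res π inf_le_right a := fun k =>
    Sec.exists_res_eq_pow_mul π (h.isAffineOpen k) (z k i) (h.basicOpen_eq k i) _ _
  choose n c hc using h1
  obtain ⟨N, hN⟩ := (Set.finite_range n).bddAbove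
  have h2 : ∀ k, ∃ c', Sec.res π (inf_le_left : U k ⊓ U i ≤ _) c' =
      Sec.res π inf_le_left (z k i) ^ N * Sec.res π inf_le_right a := fun k => by
    obtain ⟨s, hs⟩ := Nat.exists_eq_add_of_le (hN ⟨k, rfl⟩)
    refine ⟨z k i ^ s * c k, ?_⟩
    rw [map_mul, hc, map_pow, hs, pow_add]; ring
  choose c' hc' using h2
  have hc'i : c' i = a := by
    have := hc' i
    rw [h.z_self, map_one, one_pow, one_mul] at this
    have h3 := congrArg (Sec.res π (le_inf le_rfl le_rfl : U i ≤ U i ⊓ U i)) this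
    rwa [Sec.res_res, Sec.res_res, Sec.res_self, Sec.res_self] at h3
  -- their differences vanish where `x i` is invertible, so they are killed by a power of `x i`
  have h4 : ∀ k k', ∃ L, Sec.res π (inf_le_left : U k ⊓ U k' ≤ _) (z k i) ^ L *
      (Sec.res π inf_le_left (c' k) - Sec.res π inf_le_left (z k k') ^ N *
        Sec.res π inf_le_right (c' k')) = 0 := fun k k' => by
    refine Sec.exists_pow_mul_eq_zero π (h.isAffineOpen_inf k k')
      (V := U k ⊓ U k' ⊓ U i) (Sec.res π inf_le_left (z k i)) ?_ inf_le_left _ ?_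
    · rw [Sec.basicOpen_res, h.basicOpen_eq, ← inf_assoc, inf_right_comm _ _ (U k), inf_idem]
    · rw [map_sub, map_mul, map_pow, Sec.res_res, Sec.res_res, Sec.res_res]
      have e1 := congrArg (Sec.res π (le_inf (inf_le_left.trans inf_le_left) inf_le_right :
        U k ⊓ U k' ⊓ U i ≤ U k ⊓ U i)) (hc' k)
      have e2 := congrArg (Sec.res π (le_inf (inf_le_left.trans inf_le_right) inf_le_right :
        U k ⊓ U k' ⊓ U i ≤ U k' ⊓ U i)) (hc' k')
      rw [map_mul, map_pow, Sec.res_res, Sec.res_res, Sec.res_res] at e1 e2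
      rw [e1, e2, h.res_z k k' i _ (inf_le_left.trans inf_le_right)]
      ring
  choose L hL using h4
  obtain ⟨L₀, hL₀⟩ := (Set.finite_range fun p : ι × ι => L p.1 p.2).bddAbove
  refine ⟨N + L₀, fun k => z k i ^ L₀ * c' k, fun k k' => ?_, ?_⟩
  · obtain ⟨s, hs⟩ := Nat.exists_eq_add_of_le (hL₀ ⟨(k, k'), rfl⟩)
    have e1 : Sec.res π (inf_le_left : U k ⊓ U k' ≤ _) (z k i) ^ L₀ *
      (Sec.res π inf_le_left (c' k) - Sec.res π inf_le_left (z k k') ^ N *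
        Sec.res π inf_le_right (c' k')) = 0 := by
      rw [hs, pow_add, mul_right_comm, hL, zero_mul]
    rw [mul_sub, sub_eq_zero] at e1
    rw [map_mul, map_mul, map_pow, map_pow, e1, h.res_z k k' i _ inf_le_right]
    ring
  · change z i i ^ L₀ * c' i = a
    rw [h.z_self, one_pow, one_mul, hc'i]

theorem IsChartCover.isChartRings [Finite ι] (h : IsChartCover π U z)
    (hfin : ∀ i, Module.Finite (Algebra.adjoin R (Set.range (z i))) (Sec π (U i))) :
    IsChartRings z (fun i j => Sec.res π (inf_le_left : U i ⊓ U j ≤ _))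
      (fun _ _ => Sec.res π inf_le_right) where
  z_self := h.z_self
  cocycle := h.cocycle
  surj i j a := Sec.exists_res_eq_pow_mul π (h.isAffineOpen i) _ (h.basicOpen_eq i j) _ a
  ker i j a ha := Sec.exists_pow_mul_eq_zero π (h.isAffineOpen i) _ (h.basicOpen_eq i j) _ a ha
  extend := h.extend
  finite := hfin

end Charts

end Branch

namespace Branch

/-! ### Base change of global sections -/

open TensorProduct

section BaseChange

variable {R K : Type u} [CommRing R] [CommRing K] [Algebra R K] {T T' : Scheme.{u}}
  {π : T ⟶ Spec (.of R)} {π' : T' ⟶ Spec (.of K)} {g : T' ⟶ T}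

theorem isPushout_structureMap
    (H : IsPullback g π' π (Spec.map (CommRingCat.ofHom (algebraMap R K)))) {U : T.Opens}
    (hU : IsAffineOpen U) :
    IsPushout (Sec.structureMap π U) (CommRingCat.ofHom (algebraMap R K)) (g.app U)
      (Sec.structureMap π' (g ⁻¹ᵁ U)) := by
  have h1 := (isIso_pushoutSection_iff H (US := ⊤) (UT := ⊤) (UX := U) (UY := g ⁻¹ᵁ U)
    (le_preimage_top _ _) (le_preimage_top _ _) (by simp)).1
    (isIso_pushoutSection_of_isAffineOpen H _ _ _ (isAffineOpen_top _) (isAffineOpen_top _) hU)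
  refine IsPushout.of_iso h1 (Scheme.ΓSpecIso (.of R)) (Iso.refl _) (Scheme.ΓSpecIso (.of K))
    (Iso.refl _) ?_ ?_ ?_ ?_
  · simp [Sec.structureMap]
  · have := Scheme.ΓSpecIso_naturality (CommRingCat.ofHom (algebraMap R K))
    rw [← this]
    congr 1
  · rw [Iso.refl_hom, Iso.refl_hom, Category.id_comp, Category.comp_id]
    exact Scheme.Hom.appLE_eq_app _
  · simp [Sec.structureMap]

/-- Formation of sections over affine opens commutes with affine base change. -/
theorem exists_baseChange_equiv
    (H : IsPullback g π' π (Spec.map (CommRingCat.ofHom (algebraMap R K)))) {U : T.Opens}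
    (hU : IsAffineOpen U) :
    ∃ e : K ⊗[R] Sec π U ≃ₐ[K] Sec π' (g ⁻¹ᵁ U),
      ∀ a : Sec π U, e (1 ⊗ₜ a) = (g.app U a : Γ(T', g ⁻¹ᵁ U)) := by
  have h1 := isPushout_structureMap H hU
  have h2 := CommRingCat.isPushout_tensorProduct R K (Sec π U)
  let E := h2.flip.isoIsPushout _ _ h1
  have hl : ∀ c : K, E.hom (c ⊗ₜ[R] (1 : Sec π U)) = algebraMap K (Sec π' (g ⁻¹ᵁ U)) c :=
    fun c => ConcreteCategory.congr_hom (IsPushout.inr_isoIsPushout_hom _ _ h2.flip h1) c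
  have hr : ∀ a : Sec π U, E.hom ((1 : K) ⊗ₜ[R] a) = (g.app U a : Γ(T', g ⁻¹ᵁ U)) :=
    fun a => ConcreteCategory.congr_hom (IsPushout.inl_isoIsPushout_hom _ _ h2.flip h1) a
  exact ⟨AlgEquiv.ofRingEquiv (f := E.commRingCatIsoToRingEquiv) hl, hr⟩

theorem res_baseChange_equiv {U V : T.Opens} (h : V ≤ U)
    (e : K ⊗[R] Sec π U ≃ₐ[K] Sec π' (g ⁻¹ᵁ U))
    (he : ∀ a : Sec π U, e (1 ⊗ₜ a) = (g.app U a : Γ(T', g ⁻¹ᵁ U)))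
    (e' : K ⊗[R] Sec π V ≃ₐ[K] Sec π' (g ⁻¹ᵁ V))
    (he' : ∀ a : Sec π V, e' (1 ⊗ₜ a) = (g.app V a : Γ(T', g ⁻¹ᵁ V))) (y : K ⊗[R] Sec π U)
    (h' : g ⁻¹ᵁ V ≤ g ⁻¹ᵁ U) :
    Sec.res π' h' (e y) =
      e' (AlgebraTensorModule.lTensor K K (Sec.res π h).toLinearMap y) := by
  induction y using TensorProduct.induction_on with
  | zero => simp only [map_zero]
  | add a b ha hb => simp only [map_add, ha, hb]
  | tmul c a =>
    have h1 : c ⊗ₜ[R] a = c • ((1 : K) ⊗ₜ[R] a) := by rw [smul_tmul', smul_eq_mul, mul_one]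
    rw [h1, map_smul, map_smul, map_smul, map_smul, he]
    congr 1
    exact (ConcreteCategory.congr_hom (g.naturality (homOfLE h).op) a).symm.trans
      (he' (Sec.res π h a)).symm

theorem Sec.eq_of_res_eq {ι : Type*} {U : ι → T.Opens} (hU : ⨆ i, U i = ⊤) (a b : Sec π ⊤)
    (h : ∀ i, Sec.res π (le_top : U i ≤ ⊤) a = Sec.res π le_top b) : a = b :=
  TopCat.Sheaf.eq_of_locally_eq' T.sheaf U ⊤ (fun _ => homOfLE le_top) hU.ge a b h

theorem Sec.exists_res_eq {ι : Type*} {U : ι → T.Opens} (hU : ⨆ i, U i = ⊤)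
    (a : ∀ i, Sec π (U i))
    (h : ∀ i j, Sec.res π (inf_le_left : U i ⊓ U j ≤ _) (a i) = Sec.res π inf_le_right (a j)) :
    ∃ b : Sec π ⊤, ∀ i, Sec.res π (le_top : U i ≤ ⊤) b = a i :=
  (TopCat.Sheaf.existsUnique_gluing' T.sheaf U ⊤ (fun _ => homOfLE le_top) hU.ge a
    (by exact fun i j => h i j)).exists

/-- Global sections after base change are the compatible families of sections on the charts. -/
theorem IsChartCover.nonempty_sec_top_equiv {ι : Type*} {U : ι → T.Opens}
    {z : ∀ i, ι → Sec π (U i)} (h : IsChartCover π U z)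
    (H : IsPullback g π' π (Spec.map (CommRingCat.ofHom (algebraMap R K)))) :
    Nonempty (Sec π' ⊤ ≃ₗ[K] compatible (R := K)
      (fun i j => AlgebraTensorModule.lTensor K K
        (Sec.res π (inf_le_left : U i ⊓ U j ≤ _)).toLinearMap)
      (fun i j => AlgebraTensorModule.lTensor K K
        (Sec.res π (inf_le_right : U i ⊓ U j ≤ _)).toLinearMap)) := by
  choose e he using fun i => exists_baseChange_equiv H (h.isAffineOpen i)
  choose e₂ he₂ using fun i j => exists_baseChange_equiv H (h.isAffineOpen_inf i j)
  have hcov : ⨆ i, g ⁻¹ᵁ (U i) = ⊤ := by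
    rw [← Scheme.Hom.preimage_iSup, h.iSup_eq_top]; rfl
  have hl : ∀ i j y, Sec.res π' (inf_le_left : g ⁻¹ᵁ (U i) ⊓ g ⁻¹ᵁ (U j) ≤ _) (e i y) = _ :=
    fun i j y => res_baseChange_equiv (inf_le_left : U i ⊓ U j ≤ _) (e i) (he i) (e₂ i j)
      (he₂ i j) y _
  have hr : ∀ i j y, Sec.res π' (inf_le_right : g ⁻¹ᵁ (U i) ⊓ g ⁻¹ᵁ (U j) ≤ _) (e j y) = _ :=
    fun i j y => res_baseChange_equiv (inf_le_right : U i ⊓ U j ≤ _) (e j) (he j) (e₂ i j)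
      (he₂ i j) y _
  let F : Sec π' ⊤ →ₗ[K] ∀ i, K ⊗[R] Sec π (U i) := LinearMap.pi fun i =>
    (e i).symm.toLinearMap ∘ₗ (Sec.res π' (le_top : g ⁻¹ᵁ (U i) ≤ ⊤)).toLinearMap
  have heF : ∀ a i, e i (F a i) = Sec.res π' (le_top : g ⁻¹ᵁ (U i) ≤ ⊤) a :=
    fun a i => (e i).apply_symm_apply _
  let F' : Sec π' ⊤ →ₗ[K] compatible (R := K)
      (fun i j => AlgebraTensorModule.lTensor K K
        (Sec.res π (inf_le_left : U i ⊓ U j ≤ _)).toLinearMap)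
      (fun i j => AlgebraTensorModule.lTensor K K
        (Sec.res π (inf_le_right : U i ⊓ U j ≤ _)).toLinearMap) :=
    F.codRestrict _ fun a i j => (e₂ i j).injective <| by
      rw [← hl, ← hr, heF, heF, Sec.res_res, Sec.res_res]
  refine ⟨LinearEquiv.ofBijective F' ⟨fun a b hab => ?_, fun ⟨a, ha⟩ => ?_⟩⟩
  · refine Sec.eq_of_res_eq hcov a b fun i => ?_
    rw [← heF, ← heF]
    exact congrArg (fun c => e i (c.1 i)) hab
  · obtain ⟨b, hb⟩ := Sec.exists_res_eq hcov (fun i => e i (a i)) fun i j => by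
      rw [hl, hr]
      exact congrArg _ (ha i j)
    refine ⟨b, Subtype.ext (funext fun i => (e i).injective ?_)⟩
    exact (heF b i).trans (hb i)

theorem isReduced_tensor_sec [IsReduced T']
    (H : IsPullback g π' π (Spec.map (CommRingCat.ofHom (algebraMap R K)))) {U : T.Opens}
    (hU : IsAffineOpen U) : _root_.IsReduced (K ⊗[R] Sec π U) := by
  obtain ⟨e, -⟩ := exists_baseChange_equiv H hU
  have : _root_.IsReduced (Sec π' (g ⁻¹ᵁ U)) := inferInstanceAs (_root_.IsReduced Γ(T', g ⁻¹ᵁ U))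
  exact isReduced_of_injective e e.injective

end BaseChange

section LocalRing

variable {R : Type u} [CommRing R] [IsNoetherianRing R] [IsLocalRing R] {T : Scheme.{u}}
  {π : T ⟶ Spec (.of R)} [Flat π] {ι : Type*} [Finite ι] {U : ι → T.Opens}
  {z : ∀ i, ι → Sec π (U i)}

/-- The base changes of a flat scheme with a finite chart cover to two fields over a Noetherian local
ring have spaces of global functions of the same dimension, if one of them is reduced and lies over
the closed point, with perfect field. -/
theorem IsChartCover.finrank_sec_eq (h : IsChartCover π U z)
    (hfin : ∀ i, Module.Finite (Algebra.adjoin R (Set.range (z i))) (Sec π (U i)))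
    {Ω K : Type u} [Field Ω] [PerfectField Ω] [Algebra R Ω] [Field K] [Algebra R K]
    (hΩ : ∀ a ∈ IsLocalRing.maximalIdeal R, algebraMap R Ω a = 0) {T₁ T₂ : Scheme.{u}}
    {π₁ : T₁ ⟶ Spec (.of Ω)} {π₂ : T₂ ⟶ Spec (.of K)} {g₁ : T₁ ⟶ T} {g₂ : T₂ ⟶ T}
    (H₁ : IsPullback g₁ π₁ π (Spec.map (CommRingCat.ofHom (algebraMap R Ω))))
    (H₂ : IsPullback g₂ π₂ π (Spec.map (CommRingCat.ofHom (algebraMap R K)))) [IsReduced T₁] :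
    Module.Finite Ω (Sec π₁ ⊤) ∧ Module.Finite K (Sec π₂ ⊤) ∧
      Module.finrank K (Sec π₂ ⊤) = Module.finrank Ω (Sec π₁ ⊤) := by
  obtain ⟨M, x, e, hM, hgen, hc⟩ := (h.isChartRings hfin).exists_isChartSystem
  have := fun i => Sec.flat π (h.isAffineOpen i)
  have := fun i j => Sec.flat π (h.isAffineOpen_inf i j)
  have := fun i => isReduced_tensor_sec H₁ (h.isAffineOpen i)
  obtain ⟨E₁⟩ := h.nonempty_sec_top_equiv H₁
  obtain ⟨E₂⟩ := h.nonempty_sec_top_equiv H₂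
  have := hc.finite_compatible hgen Ω
  have := hc.finite_compatible hgen K
  exact ⟨Module.Finite.equiv E₁.symm, Module.Finite.equiv E₂.symm, by
    rw [E₁.finrank_eq, E₂.finrank_eq]
    exact hc.finrank_compatible_eq hgen Ω hΩ K⟩

end LocalRing

end Branch

namespace Branch

/-! ### Counting connected components -/

section Count

/-- A finite reduced algebra over an algebraically closed field is a product of copies of the field,
so its spectrum has as many points as its dimension. -/
theorem card_primeSpectrum_eq_finrank {Ω E : Type*} [Field Ω] [IsAlgClosed Ω] [CommRing E]
    [Algebra Ω E] [Module.Finite Ω E] [_root_.IsReduced E] :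
    Nat.card (PrimeSpectrum E) = Module.finrank Ω E := by
  have : IsArtinianRing E := IsArtinianRing.of_finite Ω E
  cases nonempty_fintype (MaximalSpectrum E)
  have h1 : ∀ I : MaximalSpectrum E, Module.finrank Ω (E ⧸ I.asIdeal) = 1 := fun I => by
    let : Field (E ⧸ I.asIdeal) := Ideal.Quotient.field _
    have : Algebra.IsIntegral Ω (E ⧸ I.asIdeal) := Algebra.IsIntegral.of_finite Ω _
    have h2 := IsAlgClosed.algebraMap_bijective_of_isIntegral (k := Ω) (K := E ⧸ I.asIdeal)
    exact (LinearEquiv.ofBijective (Algebra.linearMap Ω (E ⧸ I.asIdeal)) h2).finrank_eq.symm.trans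
      (Module.finrank_self Ω)
  rw [((IsArtinianRing.equivPi E).toLinearEquiv.restrictScalars Ω).finrank_eq,
    Module.finrank_pi_fintype, Finset.sum_congr rfl fun I _ => h1 I, Finset.sum_const,
    smul_eq_mul, mul_one, Finset.card_univ, ← Nat.card_eq_fintype_card]
  exact Nat.card_congr IsArtinianRing.primeSpectrumEquivMaximalSpectrum

/-- On a scheme which is the disjoint union of `Z` and `W`, there is a function which is `1` on `Z` and
`0` on `W`. -/
theorem exists_section_eq_one_eq_zero {Y : Scheme.{u}} {Z W : Y.Opens} (hd : Z ⊓ W = ⊥)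
    (hc : Z ⊔ W = ⊤) : ∃ ε : Γ(Y, ⊤), Z ≤ Y.basicOpen ε ∧ W ⊓ Y.basicOpen ε = ⊥ := by
  let V : Bool → Y.Opens := fun b => cond b Z W
  let s : ∀ b, Γ(Y, V b) := fun b => Bool.rec 0 1 b
  have hV : ⨆ b, V b = ⊤ := by rw [iSup_bool_eq]; exact hc
  obtain ⟨ε, hε, -⟩ := TopCat.Sheaf.existsUnique_gluing' Y.sheaf V ⊤ (fun _ => homOfLE le_top)
    hV.ge s (by
      intro i j
      by_cases h : i = j
      · subst h; rfl
      · refine TopCat.Sheaf.eq_of_locally_eq' Y.sheaf (fun x : PEmpty.{1} => x.elim) _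
          (fun x => x.elim) ?_ _ _ (fun x => x.elim)
        cases i <;> cases j <;> simp_all [V, inf_comm])
  refine ⟨ε, ?_, ?_⟩
  · have h1 := Y.basicOpen_res ε (homOfLE (le_top : V true ≤ ⊤)).op
    have h2 : Y.presheaf.map (homOfLE (le_top : V true ≤ ⊤)).op ε = (1 : Γ(Y, V true)) := hε true
    rw [h2, Y.basicOpen_of_isUnit isUnit_one] at h1
    exact inf_eq_left.1 h1.symm
  · have h1 := Y.basicOpen_res ε (homOfLE (le_top : V false ≤ ⊤)).op
    have h2 : Y.presheaf.map (homOfLE (le_top : V false ≤ ⊤)).op ε = (0 : Γ(Y, V false)) := hε false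
    rw [h2, Y.basicOpen_zero] at h1
    exact h1.symm

/-- If `Spec Γ(Y, ⊤)` is discrete, then the fibers of `Y → Spec Γ(Y, ⊤)` are connected, as a
decomposition of a fiber would be visible in an idempotent function on `Y`. -/
theorem isConnected_toSpecΓ_fiber (Y : Scheme.{u}) [IsReduced Y] [DiscreteTopology (Spec Γ(Y, ⊤))]
    (p : Spec Γ(Y, ⊤)) : _root_.IsConnected (Y.toSpecΓ ⁻¹' {p}) := by
  have hmem : ∀ (ε : Γ(Y, ⊤)) (y : Y), y ∈ Y.basicOpen ε ↔ ε ∉ (Y.toSpecΓ y).asIdeal := by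
    intro ε y
    rw [← Scheme.toSpecΓ_preimage_basicOpen]; rfl
  constructor
  · obtain ⟨e, -, he⟩ := PrimeSpectrum.exists_idempotent_basicOpen_eq_of_isClopen
      (isClopen_discrete ({p} : Set (Spec Γ(Y, ⊤))))
    rw [Set.nonempty_iff_ne_empty]
    intro h0
    have h1 : Y.basicOpen e = ⊥ := by
      rw [eq_bot_iff]
      intro y hy
      have h2 : Y.toSpecΓ y ∈ ({p} : Set (Spec Γ(Y, ⊤))) := by
        rw [he]; exact (hmem e y).1 hy
      have h3 : y ∈ Y.toSpecΓ ⁻¹' {p} := h2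
      rw [h0] at h3
      exact h3.elim
    rw [basicOpen_eq_bot_iff] at h1
    subst h1
    rw [PrimeSpectrum.basicOpen_zero] at he
    exact Set.singleton_ne_empty p he
  · rw [isPreconnected_iff_subset_of_disjoint]
    intro u v hu hv huv hd
    have hF : IsClopen (Y.toSpecΓ ⁻¹' {p}) :=
      (isClopen_discrete _).preimage Y.toSpecΓ.continuous
    let Z : Y.Opens := ⟨Y.toSpecΓ ⁻¹' {p} ∩ u, hF.isOpen.inter hu⟩
    let W : Y.Opens := ⟨(Y.toSpecΓ ⁻¹' {p} ∩ v) ∪ (Y.toSpecΓ ⁻¹' {p})ᶜ,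
      (hF.isOpen.inter hv).union hF.compl.isOpen⟩
    obtain ⟨ε, h1, h2⟩ := exists_section_eq_one_eq_zero (Z := Z) (W := W)
      (by
        rw [eq_bot_iff]
        rintro y ⟨⟨hy, hyu⟩, ⟨-, hyv⟩ | hy'⟩
        · have : y ∈ Y.toSpecΓ ⁻¹' {p} ∩ (u ∩ v) := ⟨hy, hyu, hyv⟩
          rw [hd] at this
          exact this.elim
        · exact (hy' hy).elim)
      (by
        rw [eq_top_iff]
        rintro y -
        by_cases hy : y ∈ Y.toSpecΓ ⁻¹' {p}
        · rcases huv hy with h | h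
          · exact Or.inl ⟨hy, h⟩
          · exact Or.inr (Or.inl ⟨hy, h⟩)
        · exact Or.inr (Or.inr hy))
    by_cases hε : ε ∈ p.asIdeal
    · right
      intro y hy
      refine (huv hy).resolve_left fun hyu => ?_
      have := (hmem ε y).1 (h1 ⟨hy, hyu⟩)
      rw [show Y.toSpecΓ y = p from hy] at this
      exact this hε
    · left
      intro y hy
      refine (huv hy).resolve_right fun hyv => ?_
      have h3 : y ∈ Y.basicOpen ε := (hmem ε y).2 (by
        rw [show Y.toSpecΓ y = p from hy]; exact hε)
      have h4 : y ∈ W ⊓ Y.basicOpen ε := ⟨Or.inl ⟨hy, hyv⟩, h3⟩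
      rw [h2] at h4
      exact h4.elim

/-- The connected components of a reduced scheme over an algebraically closed field are counted by the
dimension of its ring of functions, if this is finite. -/
theorem card_connectedComponents_eq_finrank {Ω : Type u} [Field Ω] [IsAlgClosed Ω] {Y : Scheme.{u}}
    (π : Y ⟶ Spec (.of Ω)) [IsReduced Y] [Module.Finite Ω (Sec π ⊤)] :
    ENat.card (_root_.ConnectedComponents Y) = Module.finrank Ω (Sec π ⊤) := by
  have hred : _root_.IsReduced (Sec π ⊤) := inferInstanceAs (_root_.IsReduced Γ(Y, ⊤))
  have : IsArtinianRing (Sec π ⊤) := IsArtinianRing.of_finite Ω (Sec π ⊤)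
  have hdisc : DiscreteTopology (PrimeSpectrum (Sec π ⊤)) := inferInstance
  have hdisc' : DiscreteTopology (Spec Γ(Y, ⊤)) := hdisc
  let e := _root_.ConnectedComponents.equivOfIsClopenOfIsConnected
    (U := fun p : Spec Γ(Y, ⊤) => Y.toSpecΓ ⁻¹' {p})
    (fun p => (isClopen_discrete _).preimage Y.toSpecΓ.continuous)
    (fun p q hpq => Disjoint.preimage _ (by simpa using hpq))
    (Set.iUnion_eq_univ_iff.2 fun y => ⟨Y.toSpecΓ y, rfl⟩)
    (isConnected_toSpecΓ_fiber Y)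
  rw [ENat.card_congr e, ← card_primeSpectrum_eq_finrank (Ω := Ω) (E := Sec π ⊤)]
  have : Finite (PrimeSpectrum (Sec π ⊤)) := inferInstance
  exact ENat.card_eq_coe_natCard (PrimeSpectrum (Sec π ⊤))

end Count

end Branch

namespace Branch

/-! ### The standard charts of projective space -/

section ProjCharts

open HomogeneousLocalization MvPolynomial

attribute [local instance] MvPolynomial.gradedAlgebra

variable (σ : Type*) (k : Type*) [CommRing k]

theorem X_mem_homogeneousSubmodule (i : σ) : (X i : MvPolynomial σ k) ∈ homogeneousSubmodule σ k 1 :=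
  isHomogeneous_X k i

/-- The element `x j / x i` of the homogeneous localization. -/
noncomputable def ratio (i j : σ) : Away (homogeneousSubmodule σ k) (X i) :=
  Away.mk _ (X_mem_homogeneousSubmodule σ k i) 1 (X j)
    (by rw [smul_eq_mul, mul_one]; exact X_mem_homogeneousSubmodule σ k j)

theorem val_ratio (i j : σ) : (ratio σ k i j).val =
    Localization.mk (X j) ⟨X i, Submonoid.mem_powers _⟩ := by
  rw [ratio, Away.val_mk]
  simp only [pow_one]

theorem adjoin_X_eq_top :
    Algebra.adjoin (homogeneousSubmodule σ k 0) (Set.range (X : σ → MvPolynomial σ k)) = ⊤ := by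
  rw [eq_top_iff]
  rintro p -
  induction p using MvPolynomial.induction_on with
  | C a =>
    exact Subalgebra.algebraMap_mem _ (⟨C a, isHomogeneous_C σ a⟩ : homogeneousSubmodule σ k 0)
  | add p q hp hq => exact add_mem hp hq
  | mul_X p i hp => exact mul_mem hp (Algebra.subset_adjoin ⟨i, rfl⟩)

theorem ratio_self (i : σ) : ratio σ k i i = 1 := by
  rw [HomogeneousLocalization.ext_iff_val, val_ratio, val_one]
  exact Localization.mk_self (S := Submonoid.powers (X i : MvPolynomial σ k))
    ⟨X i, Submonoid.mem_powers _⟩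

/-- The fractions `x j / x i` generate the ring of functions on a standard chart of projective space
over the integers. -/
theorem closure_range_ratio [Fintype σ] (i : σ) :
    Subring.closure (Set.range (ratio σ (ULift.{u} ℤ) i)) = ⊤ := by
  rw [eq_top_iff]
  rintro y -
  have hy : y ∈ Submodule.span (homogeneousSubmodule σ (ULift.{u} ℤ) 0) _ :=
    (Away.span_mk_prod_pow_eq_top (X_mem_homogeneousSubmodule σ (ULift.{u} ℤ) i)
      (X : σ → MvPolynomial σ (ULift.{u} ℤ)) (adjoin_X_eq_top σ _) (fun _ => 1)
      (X_mem_homogeneousSubmodule σ _)) ▸ Submodule.mem_top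
  induction hy using Submodule.span_induction with
  | mem y hy =>
    obtain ⟨a, b, hab, rfl⟩ := hy
    have : Away.mk (homogeneousSubmodule σ (ULift.{u} ℤ)) (X_mem_homogeneousSubmodule σ _ i) a
        (∏ j, X j ^ b j) (hab ▸ SetLike.prod_pow_mem_graded _ _ _ _
          fun j _ => X_mem_homogeneousSubmodule σ _ j) = ∏ j, ratio σ _ i j ^ b j := by
      rw [HomogeneousLocalization.ext_iff_val, Away.val_mk]
      have h1 : (∏ j, ratio σ (ULift.{u} ℤ) i j ^ b j).val =
          ∏ j, (ratio σ (ULift.{u} ℤ) i j).val ^ b j := by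
        rw [← HomogeneousLocalization.algebraMap_apply, map_prod]
        simp only [map_pow, HomogeneousLocalization.algebraMap_apply]
      rw [h1]
      simp only [val_ratio, Localization.mk_pow, Localization.mk_prod]
      congr 1
      refine Subtype.ext ?_
      simp only [smul_eq_mul, mul_one] at hab
      rw [Submonoid.coe_finsetProd]
      simp only [SubmonoidClass.coe_pow]
      rw [Finset.prod_pow_eq_pow_sum, hab]
    rw [this]
    exact Subring.prod_mem _ fun j _ => Subring.pow_mem _ (Subring.subset_closure (Set.mem_range_self j)) _
  | zero => exact Subring.zero_mem _
  | add a b _ _ ha hb => exact Subring.add_mem _ ha hb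
  | smul c y _ hy =>
    rw [Algebra.smul_def]
    refine Subring.mul_mem _ ?_ hy
    obtain ⟨c, hc⟩ := c
    obtain ⟨m, rfl⟩ : ∃ m : ULift.{u} ℤ, C m = c :=
      ⟨_, (totalDegree_eq_zero_iff_eq_C.1 ((totalDegree_zero_iff_isHomogeneous _).2 hc)).symm⟩
    have h2 : fromZeroRingHom (homogeneousSubmodule σ (ULift.{u} ℤ))
        (Submonoid.powers (X i)) ⟨C m, hc⟩ =
          ((m.down : ℤ) : Away (homogeneousSubmodule σ (ULift.{u} ℤ)) (X i)) := by
      let F : ULift.{u} ℤ →+* homogeneousSubmodule σ (ULift.{u} ℤ) 0 :=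
        { toFun := fun m => ⟨C m, isHomogeneous_C σ m⟩
          map_one' := Subtype.ext (map_one C)
          map_mul' := fun a b => Subtype.ext (map_mul C a b)
          map_zero' := Subtype.ext (map_zero C)
          map_add' := fun a b => Subtype.ext (map_add C a b) }
      obtain ⟨m⟩ := m
      exact map_intCast ((fromZeroRingHom (homogeneousSubmodule σ (ULift.{u} ℤ))
        (Submonoid.powers (X i))).comp F) m
    refine (congrArg (· ∈ _) h2).mpr ?_
    exact intCast_mem _ _

/-- The function `x j / x i` on the standard chart `x i ≠ 0` of projective space. -/
noncomputable def ratioSection (i j : σ) :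
    Γ(Proj (homogeneousSubmodule σ k), Proj.basicOpen (homogeneousSubmodule σ k) (X i)) :=
  Proj.awayToSection (homogeneousSubmodule σ k) (X i) (ratio σ k i j)

theorem ratioSection_self (i : σ) : ratioSection σ k i i = 1 := by
  rw [ratioSection, ratio_self, map_one]

theorem val_mapId_ratio (x : ProjectiveSpectrum (homogeneousSubmodule σ k)) (i j : σ)
    (hx : X i ∈ x.asHomogeneousIdeal.toIdeal.primeCompl) :
    (mapId (homogeneousSubmodule σ k) (Submonoid.powers_le.mpr hx) (ratio σ k i j)).val =
      Localization.mk (X j) ⟨X i, hx⟩ := by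
  change Localization.mk (X j) (⟨X i ^ 1, _⟩ : x.asHomogeneousIdeal.toIdeal.primeCompl) = _
  simp only [pow_one]

theorem ratioSection_cocycle (i j m : σ) :
    (Proj (homogeneousSubmodule σ k)).presheaf.map (homOfLE inf_le_left).op
        (ratioSection σ k i m) =
      (Proj (homogeneousSubmodule σ k)).presheaf.map
        (homOfLE (inf_le_left : Proj.basicOpen (homogeneousSubmodule σ k) (X i) ⊓
          Proj.basicOpen (homogeneousSubmodule σ k) (X j) ≤ _)).op (ratioSection σ k i j) *
      (Proj (homogeneousSubmodule σ k)).presheaf.map (homOfLE inf_le_right).op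
        (ratioSection σ k j m) := by
  apply Subtype.ext
  funext x
  apply HomogeneousLocalization.val_injective
  let p : ProjectiveSpectrum (homogeneousSubmodule σ k) := x.1
  have hi : X i ∈ p.asHomogeneousIdeal.toIdeal.primeCompl := x.2.1
  have hj : X j ∈ p.asHomogeneousIdeal.toIdeal.primeCompl := x.2.2
  change (mapId (homogeneousSubmodule σ k) (Submonoid.powers_le.mpr hi) (ratio σ k i m)).val =
    (mapId (homogeneousSubmodule σ k) (Submonoid.powers_le.mpr hi) (ratio σ k i j) *
      mapId (homogeneousSubmodule σ k) (Submonoid.powers_le.mpr hj) (ratio σ k j m)).val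
  rw [val_mul, val_mapId_ratio σ k p i m hi, val_mapId_ratio σ k p i j hi,
    val_mapId_ratio σ k p j m hj, Localization.mk_mul,
    Localization.mk_eq_mk_iff, Localization.r_iff_exists]
  refine ⟨1, ?_⟩
  simp only [Submonoid.coe_mul, OneMemClass.coe_one, one_mul]
  ring

theorem basicOpen_ratioSection (i j : σ) :
    (Proj (homogeneousSubmodule σ k)).basicOpen (ratioSection σ k i j) =
      Proj.basicOpen (homogeneousSubmodule σ k) (X i) ⊓
        Proj.basicOpen (homogeneousSubmodule σ k) (X j) := by
  ext x
  by_cases hx : x ∈ Proj.basicOpen (homogeneousSubmodule σ k) (X i)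
  · let p : ProjectiveSpectrum (homogeneousSubmodule σ k) := x
    have h2 : IsUnit ((Proj (homogeneousSubmodule σ k)).presheaf.germ _ x hx
        (ratioSection σ k i j)) ↔ X j ∈ p.asHomogeneousIdeal.toIdeal.primeCompl := by
      have h3 := AlgebraicGeometry.Proj.stalkIso'_germ (homogeneousSubmodule σ k)
        (Proj.basicOpen (homogeneousSubmodule σ k) (X i)) x hx (ratioSection σ k i j)
      refine (MulEquiv.isUnit_map
        (AlgebraicGeometry.Proj.stalkIso' (homogeneousSubmodule σ k) x)).symm.trans ?_
      refine (Iff.of_eq (congrArg IsUnit h3)).trans ?_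
      rw [← isUnit_iff_isUnit_val]
      change IsUnit (mapId (homogeneousSubmodule σ k) (Submonoid.powers_le.mpr hx)
        (ratio σ k i j)).val ↔ _
      rw [val_mapId_ratio σ k p i j hx, Localization.mk_eq_mk',
        IsLocalization.AtPrime.isUnit_mk'_iff]
    refine (Scheme.mem_basicOpen _ _ x hx).trans (h2.trans ?_)
    exact ⟨fun h => ⟨hx, h⟩, fun h => h.2⟩
  · exact ⟨fun h => (hx (Scheme.basicOpen_le _ _ h)).elim, fun h => (hx h.1).elim⟩

end ProjCharts

end Branch

namespace Branch

/-! ### Projective space over an affine base -/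

section ProjectiveCharts

open MvPolynomial TensorProduct

attribute [local instance] MvPolynomial.gradedAlgebra

theorem closure_eq_top_of_isPushout {A B C D : CommRingCat.{u}} {f : A ⟶ B} {g : A ⟶ C}
    {inl : B ⟶ D} {inr : C ⟶ D} (h : IsPushout f g inl inr) :
    Subring.closure (Set.range inl ∪ Set.range inr) = ⊤ := by
  algebraize [f.hom, g.hom]
  let E := (CommRingCat.isPushout_tensorProduct A B C).isoIsPushout _ _ h
  have hl : ∀ b : B, E.hom (b ⊗ₜ[A] (1 : C)) = inl b := fun b =>
    ConcreteCategory.congr_hom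
      (IsPushout.inl_isoIsPushout_hom _ _ (CommRingCat.isPushout_tensorProduct A B C) h) b
  have hr : ∀ c : C, E.hom ((1 : B) ⊗ₜ[A] c) = inr c := fun c =>
    ConcreteCategory.congr_hom
      (IsPushout.inr_isoIsPushout_hom _ _ (CommRingCat.isPushout_tensorProduct A B C) h) c
  rw [eq_top_iff]
  rintro y -
  obtain ⟨y, rfl⟩ := E.commRingCatIsoToRingEquiv.surjective y
  change E.hom y ∈ _
  induction y using TensorProduct.induction_on with
  | zero => rw [map_zero]; exact Subring.zero_mem _
  | add a b ha hb => rw [map_add]; exact Subring.add_mem _ ha hb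
  | tmul b c =>
    have : b ⊗ₜ[A] c = (b ⊗ₜ[A] (1 : C)) * ((1 : B) ⊗ₜ[A] c) := by
      rw [Algebra.TensorProduct.tmul_mul_tmul, mul_one, one_mul]
    rw [this]
    refine (congrArg (· ∈ Subring.closure _) (map_mul E.hom.hom _ _)).mpr ?_
    refine Subring.mul_mem _ (Subring.subset_closure (Or.inl ⟨b, (hl b).symm⟩))
      (Subring.subset_closure (Or.inr ⟨c, (hr c).symm⟩))

/-- The standard chart `x i ≠ 0` of projective space over the integers. -/
noncomputable def chartInt (n : ℕ) (i : Fin (n + 1)) : (projectiveSpaceInt.{u} n).Opens :=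
  Proj.basicOpen (homogeneousSubmodule (Fin (n + 1)) (ULift.{u} ℤ)) (X i)

/-- The function `x j / x i` on the chart `x i ≠ 0`. -/
noncomputable def ratioInt (n : ℕ) (i j : Fin (n + 1)) :
    Γ(projectiveSpaceInt.{u} n, chartInt n i) :=
  ratioSection (Fin (n + 1)) (ULift.{u} ℤ) i j

theorem isAffineOpen_chartInt (n : ℕ) (i : Fin (n + 1)) : IsAffineOpen (chartInt.{u} n i) :=
  Proj.isAffineOpen_basicOpen _ _ (X_mem_homogeneousSubmodule _ _ i) one_pos

theorem iSup_chartInt (n : ℕ) : ⨆ i, chartInt.{u} n i = ⊤ :=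
  Proj.iSup_basicOpen_eq_top' _ _ (fun i => ⟨1, X_mem_homogeneousSubmodule _ _ i⟩)
    (adjoin_X_eq_top _ _)

theorem ratioInt_self (n : ℕ) (i : Fin (n + 1)) : ratioInt.{u} n i i = 1 :=
  ratioSection_self _ _ i

theorem basicOpen_ratioInt (n : ℕ) (i j : Fin (n + 1)) :
    (projectiveSpaceInt.{u} n).basicOpen (ratioInt n i j) = chartInt n i ⊓ chartInt n j :=
  basicOpen_ratioSection _ _ i j

theorem ratioInt_cocycle (n : ℕ) (i j m : Fin (n + 1)) :
    (projectiveSpaceInt.{u} n).presheaf.map (homOfLE inf_le_left).op (ratioInt n i m) =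
      (projectiveSpaceInt.{u} n).presheaf.map
        (homOfLE (inf_le_left : chartInt n i ⊓ chartInt n j ≤ _)).op (ratioInt n i j) *
      (projectiveSpaceInt.{u} n).presheaf.map (homOfLE inf_le_right).op (ratioInt n j m) :=
  ratioSection_cocycle _ _ i j m

theorem closure_range_ratioInt (n : ℕ) (i : Fin (n + 1)) :
    Subring.closure (Set.range (ratioInt.{u} n i)) = ⊤ := by
  let E := Proj.basicOpenIsoAway (homogeneousSubmodule (Fin (n + 1)) (ULift.{u} ℤ)) (X i)
    (X_mem_homogeneousSubmodule _ _ i) one_pos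
  have h1 := congrArg (Subring.map E.hom.hom) (closure_range_ratio.{u} (Fin (n + 1)) i)
  rw [RingHom.map_closure, ← Set.range_comp] at h1
  refine h1.trans ?_
  refine (RingHom.range_eq_map _).symm.trans (RingHom.range_eq_top.2 ?_)
  exact (ConcreteCategory.bijective_of_isIso E.hom).surjective

variable {n : ℕ} {S : Scheme.{u}}

/-- The projection from projective space over `S` to projective space over the integers. -/
noncomputable def projectiveSpaceToInt (n : ℕ) (S : Scheme.{u}) :
    projectiveSpace n S ⟶ projectiveSpaceInt n :=
  pullback.snd _ _

theorem isPullback_projectiveSpace (n : ℕ) (S : Scheme.{u}) :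
    IsPullback (projectiveSpaceToInt n S) (projectiveSpaceToBase n S)
      (terminal.from (projectiveSpaceInt.{u} n)) (terminal.from S) :=
  (IsPullback.of_hasPullback _ _).flip

theorem isAffineHom_projectiveSpaceToInt [IsAffine S] :
    IsAffineHom (projectiveSpaceToInt n S) := by
  have : IsAffineHom (terminal.from S) := inferInstance
  exact MorphismProperty.of_isPullback (isPullback_projectiveSpace n S).flip this

/-- The ring of functions on a chart of projective space over an affine base `S` is generated by the
functions `x j / x i` and by those coming from `S`. -/
theorem closure_chart [IsAffine S] (i : Fin (n + 1)) :
    Subring.closure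
      (Set.range ((projectiveSpaceToInt n S).app (chartInt n i)) ∪
        Set.range ((projectiveSpaceToBase n S).appLE ⊤ (projectiveSpaceToInt n S ⁻¹ᵁ chartInt n i)
          (le_preimage_top _ _))) = ⊤ := by
  have h1 := (isIso_pushoutSection_iff (isPullback_projectiveSpace n S) (US := ⊤) (UT := ⊤)
    (UX := chartInt n i) (UY := projectiveSpaceToInt n S ⁻¹ᵁ chartInt n i)
    (le_preimage_top _ _) (le_preimage_top _ _) (by simp)).1
    (isIso_pushoutSection_of_isAffineOpen _ _ _ _ (isAffineOpen_top _) (isAffineOpen_top _)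
      (isAffineOpen_chartInt n i))
  have h2 := closure_eq_top_of_isPushout h1
  rwa [Scheme.Hom.appLE_eq_app] at h2

/-- A scheme which is finite over projective space is covered by the preimages of the standard charts,
and the functions on each of these form a finite module over the algebra generated by the `x j / x i`. -/
theorem exists_isChartCover {R : Type u} [CommRing R] {T : Scheme.{u}}
    (h : T ⟶ projectiveSpace n (Spec (.of R))) [IsFinite h] (π : T ⟶ Spec (.of R))
    (hπ : h ≫ projectiveSpaceToBase n _ = π) :
    ∃ (U : Fin (n + 1) → T.Opens) (z : ∀ i, Fin (n + 1) → Sec π (U i)), IsChartCover π U z ∧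
      ∀ i, Module.Finite (Algebra.adjoin R (Set.range (z i))) (Sec π (U i)) := by
  let q := projectiveSpaceToInt n (Spec (.of R))
  have : IsAffineHom q := isAffineHom_projectiveSpaceToInt
  let V : Fin (n + 1) → (projectiveSpace n (Spec (.of R))).Opens := fun i => q ⁻¹ᵁ chartInt n i
  have hV : ∀ i, IsAffineOpen (V i) := fun i => (isAffineOpen_chartInt n i).preimage q
  let z : ∀ i, Fin (n + 1) → Sec π (h ⁻¹ᵁ V i) := fun i j => (h ≫ q).app _ (ratioInt n i j)
  refine ⟨fun i => h ⁻¹ᵁ V i, z, ?_, fun i => ?_⟩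
  · exact
    { isAffineOpen := fun i => (hV i).preimage h
      iSup_eq_top := by
        change ⨆ i, (h ≫ q) ⁻¹ᵁ (chartInt n i) = ⊤
        rw [← Scheme.Hom.preimage_iSup, iSup_chartInt]; rfl
      basicOpen_eq := fun i j => by
        have := Scheme.preimage_basicOpen (h ≫ q) (ratioInt n i j)
        rw [basicOpen_ratioInt] at this
        exact this.symm
      z_self := fun i => by
        change (h ≫ q).app _ (ratioInt n i i) = 1
        rw [ratioInt_self, map_one]
      cocycle := fun i j k => by
        have h1 := congrArg ((h ≫ q).app _) (ratioInt_cocycle n i j k)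
        rw [map_mul] at h1
        have nat : ∀ {W W' : (projectiveSpaceInt.{u} n).Opens} (hW : W' ≤ W)
            (a : Γ(projectiveSpaceInt.{u} n, W)),
            (h ≫ q).app W' ((projectiveSpaceInt.{u} n).presheaf.map (homOfLE hW).op a) =
            Sec.res π (show (h ≫ q) ⁻¹ᵁ W' ≤ (h ≫ q) ⁻¹ᵁ W from fun x hx => hW hx)
              ((h ≫ q).app W a) := fun hW a =>
          ConcreteCategory.congr_hom ((h ≫ q).naturality (homOfLE hW).op) a
        rw [nat, nat, nat] at h1
        exact h1 }
  · let S' := Algebra.adjoin R (Set.range (z i))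
    have hfin : (h.app (V i)).hom.Finite := IsFinite.finite_app h (V i) (hV i)
    have hrange : ∀ b, (h.app (V i) b : Sec π (h ⁻¹ᵁ V i)) ∈ S' := by
      intro b
      have hb : b ∈ Subring.closure _ := (closure_chart (S := Spec (.of R)) i) ▸ Subring.mem_top b
      have hle : Subring.closure (Set.range ((projectiveSpaceToInt n (Spec (.of R))).app
          (chartInt n i)) ∪ Set.range ((projectiveSpaceToBase n (Spec (.of R))).appLE ⊤
          (projectiveSpaceToInt n (Spec (.of R)) ⁻¹ᵁ chartInt n i) (le_preimage_top _ _))) ≤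
          S'.toSubring.comap (h.app (V i)).hom := by
        rw [Subring.closure_le]
        rintro _ (⟨a, rfl⟩ | ⟨a, rfl⟩)
        · have ha : a ∈ Subring.closure (Set.range (ratioInt.{u} n i)) :=
            (closure_range_ratioInt n i) ▸ Subring.mem_top a
          have hle' : Subring.closure (Set.range (ratioInt.{u} n i)) ≤
              S'.toSubring.comap ((h ≫ q).app (chartInt n i)).hom := by
            rw [Subring.closure_le]
            rintro _ ⟨j, rfl⟩
            exact Algebra.subset_adjoin ⟨j, rfl⟩
          have h2 := hle' ha
          change (h ≫ q).app (chartInt n i) a ∈ S' at h2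
          rw [Scheme.Hom.comp_app] at h2
          exact h2
        · have h3 : (projectiveSpaceToBase n (Spec (.of R))).appLE ⊤
              (V i) (le_preimage_top _ _) ≫ h.app (V i) =
              π.appLE ⊤ (h ⁻¹ᵁ V i) (le_preimage_top _ _) := by
            subst hπ
            rw [← Scheme.Hom.appLE_eq_app, Scheme.Hom.appLE_comp_appLE]
          have h4 : h.app (V i) ((projectiveSpaceToBase n (Spec (.of R))).appLE ⊤
              (V i) (le_preimage_top _ _) a) = algebraMap R (Sec π (h ⁻¹ᵁ V i))
                ((Scheme.ΓSpecIso (.of R)).hom a) := by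
            refine (ConcreteCategory.congr_hom h3 a).trans ?_
            change _ = (Sec.structureMap π _) _
            rw [Sec.structureMap, ← CommRingCat.comp_apply, Iso.hom_inv_id_assoc]
          change h.app (V i) _ ∈ S'
          exact h4 ▸ S'.algebraMap_mem _
      exact hle hb
    let φ : Γ(projectiveSpace n (Spec (.of R)), V i) →+* S' :=
      (h.app (V i)).hom.codRestrict S'.toSubring hrange
    let : Algebra Γ(projectiveSpace n (Spec (.of R)), V i) S' := φ.toAlgebra
    let : Algebra Γ(projectiveSpace n (Spec (.of R)), V i) (Sec π (h ⁻¹ᵁ V i)) :=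
      (h.app (V i)).hom.toAlgebra
    have : IsScalarTower Γ(projectiveSpace n (Spec (.of R)), V i) S' (Sec π (h ⁻¹ᵁ V i)) :=
      IsScalarTower.of_algebraMap_eq fun _ => rfl
    have : Module.Finite Γ(projectiveSpace n (Spec (.of R)), V i) (Sec π (h ⁻¹ᵁ V i)) := hfin
    exact Module.Finite.of_restrictScalars_finite Γ(projectiveSpace n (Spec (.of R)), V i) S' _

end ProjectiveCharts

end Branch

namespace Branch

/-! ### Families of branchvarieties under specialization -/

lemma fiberMap_fiberι {S X Y : Scheme.{u}} (f : X ⟶ Y) (p : Y ⟶ S) (s : S) :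
    fiberMap f p s ≫ p.fiberι s = (f ≫ p).fiberι s ≫ f :=
  pullback.lift_fst _ _ _

lemma fiberMap_fiberToSpecResidueField {S X Y : Scheme.{u}} (f : X ⟶ Y) (p : Y ⟶ S) (s : S) :
    fiberMap f p s ≫ p.fiberToSpecResidueField s = (f ≫ p).fiberToSpecResidueField s :=
  (pullback.lift_snd _ _ _).trans (Category.comp_id _)

lemma isSeparated_projectiveSpaceToBase (n : ℕ) (S : Scheme.{u}) :
    IsSeparated (projectiveSpaceToBase n S) := by
  let _ := MvPolynomial.gradedAlgebra (σ := Fin (n + 1)) (R := ULift.{u} ℤ)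
  have h : (projectiveSpaceInt.{u} n).IsSeparated :=
    inferInstanceAs (Proj (MvPolynomial.homogeneousSubmodule (Fin (n + 1))
      (ULift.{u} ℤ))).IsSeparated
  have : IsSeparated (terminal.from (projectiveSpaceInt.{u} n)) := h.isSeparated_terminal_from
  exact MorphismProperty.of_isPullback (isPullback_projectiveSpace n S) this

/-- The morphism of a family of branchvarieties is proper and has finite fibers, so it is finite by
Zariski's main theorem. -/
lemma IsBranchFamily.isFinite {S X Y : Scheme.{u}} {f : X ⟶ Y} {p : Y ⟶ S} [IsSeparated p]
    (hf : IsBranchFamily f p) : IsFinite f := by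
  have := hf.isProper
  have : IsProper f := .of_comp f p
  have : LocallyQuasiFinite f := by
    refine LocallyQuasiFinite.of_finite_preimage_singleton f fun y => ?_
    have := (hf.fiber (p y)).isFinite
    refine (((fiberMap f p (p y)).finite_preimage_singleton (p.asFiber y)).image
      ((f ≫ p).fiberι (p y))).subset fun x hx => ?_
    obtain ⟨x', rfl⟩ : x ∈ Set.range ((f ≫ p).fiberι (p y)) := by
      rw [Scheme.Hom.range_fiberι]
      simpa using congr(p $hx)
    refine ⟨x', (p.fiberι (p y)).isEmbedding.injective ?_, rfl⟩
    rw [Scheme.Hom.fiberι_asFiber, ← Scheme.Hom.comp_apply, fiberMap_fiberι,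
      Scheme.Hom.comp_apply]
    exact hx
  exact IsFinite.of_isProper_of_locallyQuasiFinite f

lemma IsBranchFamily.isReduced_geometricFiber {S X Y : Scheme.{u}} {f : X ⟶ Y} {p : Y ⟶ S}
    (hf : IsBranchFamily f p) (s : S) : IsReduced (geometricFiber (f ≫ p) s) := by
  have h := (hf.fiber s).isReduced
  rw [fiberMap_fiberToSpecResidueField] at h
  exact h

lemma SpecMap_comp_fromSpecStalk {S : Scheme.{u}} {s t : S} (h : t ⤳ s) {A : CommRingCat.{u}}
    (j : S.residueField t ⟶ A) :
    Spec.map (S.presheaf.stalkSpecializes h ≫ S.residue t ≫ j) ≫ S.fromSpecStalk s =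
      Spec.map j ≫ S.fromSpecResidueField t := by
  rw [Spec.map_comp, Spec.map_comp, Category.assoc, Category.assoc,
    Scheme.SpecMap_stalkSpecializes_fromSpecStalk]
  rfl

/-- A scheme obtained from the fiber over a generization `t` of `s` by extension of the residue
field is also a base change of the restriction of the family to the local scheme at `s`. -/
lemma exists_isPullback_fromSpecStalk {S X F : Scheme.{u}} (π : X ⟶ S) {s t : S} (h : t ⤳ s)
    {A : CommRingCat.{u}} {j : S.residueField t ⟶ A} {a : F ⟶ π.fiber t} {b : F ⟶ Spec A}
    (H : IsPullback a b (π.fiberToSpecResidueField t) (Spec.map j)) :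
    ∃ g : F ⟶ pullback π (S.fromSpecStalk s),
      IsPullback g b (pullback.snd π (S.fromSpecStalk s))
        (Spec.map (S.presheaf.stalkSpecializes h ≫ S.residue t ≫ j)) := by
  have H := H.paste_horiz (IsPullback.of_hasPullback π (S.fromSpecResidueField t))
  rw [← SpecMap_comp_fromSpecStalk h] at H
  have H' := IsPullback.of_hasPullback π (S.fromSpecStalk s)
  refine ⟨H'.lift _ _ (H.w.trans (Category.assoc _ _ _).symm), ?_⟩
  refine IsPullback.of_right (h₁₂ := pullback.fst _ _) ?_ (H'.lift_snd _ _ _) H'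
  rwa [H'.lift_fst]

/-- The base change of a morphism to projective space along `S' ⟶ S`, as a morphism to projective
space over `S'`. -/
lemma exists_isPullback_projectiveSpace (n : ℕ) {S S' : Scheme.{u}} (b : S' ⟶ S) :
    ∃ g : projectiveSpace n S' ⟶ projectiveSpace n S,
      IsPullback g (projectiveSpaceToBase n S') (projectiveSpaceToBase n S) b := by
  have H := isPullback_projectiveSpace n S
  have H' := isPullback_projectiveSpace n S'
  refine ⟨H.lift (projectiveSpaceToInt n S') (projectiveSpaceToBase n S' ≫ b)
    (Subsingleton.elim _ _), ?_⟩
  refine IsPullback.of_right (h₁₂ := projectiveSpaceToInt n S) ?_ (H.lift_snd _ _ _) H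
  rw [H.lift_fst]
  convert H' using 1
  exact Subsingleton.elim _ _

/-- Over a Noetherian local ring, a reduced fiber over an algebraically closed extension of the
residue field has as many connected components as any other reduced geometric fiber. -/
theorem card_connectedComponents_eq_of_isLocalRing {n : ℕ} {R Ω K : Type u} [CommRing R]
    [IsLocalRing R] [IsNoetherianRing R] [Field Ω] [IsAlgClosed Ω] [Field K] [IsAlgClosed K]
    {T T₁ T₂ : Scheme.{u}} (h : T ⟶ projectiveSpace n (Spec (.of R))) [IsFinite h]
    {π : T ⟶ Spec (.of R)} [Flat π] (hπ : h ≫ projectiveSpaceToBase n _ = π)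
    {φ₁ : R →+* Ω} {φ₂ : R →+* K} (hφ : ∀ a ∈ IsLocalRing.maximalIdeal R, φ₁ a = 0)
    {g₁ : T₁ ⟶ T} {g₂ : T₂ ⟶ T} {π₁ : T₁ ⟶ Spec (.of Ω)} {π₂ : T₂ ⟶ Spec (.of K)}
    (H₁ : IsPullback g₁ π₁ π (Spec.map (CommRingCat.ofHom φ₁)))
    (H₂ : IsPullback g₂ π₂ π (Spec.map (CommRingCat.ofHom φ₂)))
    (hT₁ : IsReduced T₁) (hT₂ : IsReduced T₂) :
    ENat.card (_root_.ConnectedComponents T₁) ≠ ⊤ ∧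
      ENat.card (_root_.ConnectedComponents T₂) = ENat.card (_root_.ConnectedComponents T₁) := by
  obtain ⟨U, z, hU, hfin⟩ := exists_isChartCover h π hπ
  let _ := φ₁.toAlgebra
  let _ := φ₂.toAlgebra
  obtain ⟨h₁, h₂, h₃⟩ := hU.finrank_sec_eq hfin hφ H₁ H₂
  rw [card_connectedComponents_eq_finrank π₁, card_connectedComponents_eq_finrank π₂, h₃]
  exact ⟨ENat.natCast_ne_top _, rfl⟩

/-- The number of connected components of the geometric fibers of a family of branchvarieties is
finite and does not change under specialization. -/
lemma IsBranchFamily.numGeometricComponents_eq {n : ℕ} {S X : Scheme.{u}} [IsLocallyNoetherian S]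
    {f : X ⟶ projectiveSpace n S} (hf : IsBranchFamily f (projectiveSpaceToBase n S)) {s t : S}
    (hst : t ⤳ s) :
    numGeometricComponents (f ≫ projectiveSpaceToBase n S) s ≠ ⊤ ∧
    numGeometricComponents (f ≫ projectiveSpaceToBase n S) t =
      numGeometricComponents (f ≫ projectiveSpaceToBase n S) s := by
  have := isSeparated_projectiveSpaceToBase n S
  have := hf.isFinite
  have := hf.flat
  obtain ⟨b, hb⟩ := exists_isPullback_projectiveSpace n (S.fromSpecStalk s)
  have h₁ := hf.isReduced_geometricFiber s
  have h₂ := hf.isReduced_geometricFiber t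
  set π := f ≫ projectiveSpaceToBase n S with hπ
  have H := IsPullback.of_hasPullback π (S.fromSpecStalk s)
  let h : pullback π (S.fromSpecStalk s) ⟶ projectiveSpace n (Spec (S.presheaf.stalk s)) :=
    hb.lift (pullback.fst _ _ ≫ f) (pullback.snd _ _) (by simpa using H.w)
  have hh : h ≫ projectiveSpaceToBase n _ = pullback.snd π (S.fromSpecStalk s) := hb.lift_snd _ _ _
  have H' : IsPullback (pullback.fst π (S.fromSpecStalk s)) h f b :=
    IsPullback.of_bot (by rwa [hh]) (hb.lift_fst _ _ _).symm hb
  have : IsFinite h := MorphismProperty.of_isPullback H' inferInstance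
  have hflat : Flat (pullback.snd π (S.fromSpecStalk s)) := inferInstance
  obtain ⟨g₁, H₁⟩ := exists_isPullback_fromSpecStalk π (specializes_refl s)
    (IsPullback.of_hasPullback _ (Spec.map (CommRingCat.ofHom (algebraMap (S.residueField s)
        (AlgebraicClosure (S.residueField s))))))
  obtain ⟨g₂, H₂⟩ := exists_isPullback_fromSpecStalk π hst
    (IsPullback.of_hasPullback _ (Spec.map (CommRingCat.ofHom (algebraMap (S.residueField t)
        (AlgebraicClosure (S.residueField t))))))
  refine card_connectedComponents_eq_of_isLocalRing (R := S.presheaf.stalk s)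
    (Ω := AlgebraicClosure (S.residueField s)) (K := AlgebraicClosure (S.residueField t))
    h hh ?_ H₁ H₂ h₁ h₂
  intro a ha
  have ha' : (S.residue s).hom a = 0 := (IsLocalRing.residue_eq_zero_iff a).2 ha
  have e : S.presheaf.stalkSpecializes (specializes_refl s) = 𝟙 _ :=
    TopCat.Presheaf.stalkSpecializes_refl _ _
  rw [e]
  change algebraMap (S.residueField s) (AlgebraicClosure (S.residueField s))
    ((S.residue s).hom a) = 0
  rw [ha', map_zero]

/-- On a locally Noetherian sober space, a function which is invariant under specialization is
locally constant: `s` has a neighborhood each of whose irreducible components contains `s`, and the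
generic point of a component specializes to all of its points. -/
theorem isLocallyConstant_of_specializes {α β : Type*} [TopologicalSpace α] [QuasiSober α]
    (hα : ∀ s : α, ∃ V : Set α, IsOpen V ∧ s ∈ V ∧ TopologicalSpace.NoetherianSpace V)
    {N : α → β} (hN : ∀ s t : α, t ⤳ s → N t = N s) : IsLocallyConstant N := by
  refine (IsLocallyConstant.iff_exists_open N).2 fun s => ?_
  obtain ⟨V, hV, hs, hV'⟩ := hα s
  have : QuasiSober V := hV.isOpenEmbedding_subtypeVal.quasiSober
  have hfin := TopologicalSpace.NoetherianSpace.finite_irreducibleComponents (α := V)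
  let W : Set V := (⋃ C ∈ {C ∈ irreducibleComponents V | (⟨s, hs⟩ : V) ∉ C}, C)ᶜ
  have hW : IsOpen W := by
    rw [isOpen_compl_iff]
    exact (hfin.subset (Set.sep_subset _ _)).isClosed_biUnion fun C hC =>
      isClosed_of_mem_irreducibleComponents C hC.1
  refine ⟨Subtype.val '' W, hV.isOpenMap_subtype_val _ hW, ⟨⟨s, hs⟩, ?_, rfl⟩, ?_⟩
  · rintro hsW
    obtain ⟨C, hC, hsC⟩ := Set.mem_iUnion₂.1 hsW
    exact hC.2 hsC
  · rintro _ ⟨t, ht, rfl⟩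
    have hst : (⟨s, hs⟩ : V) ∈ irreducibleComponent t := by
      by_contra hst
      exact ht (Set.mem_biUnion ⟨irreducibleComponent_mem_irreducibleComponents t, hst⟩
        mem_irreducibleComponent)
    have hη := (isIrreducible_irreducibleComponent (x := t)).isGenericPoint_genericPoint
      isClosed_irreducibleComponent
    exact (hN _ _ ((hη.specializes mem_irreducibleComponent).map continuous_subtype_val)).symm.trans
      (hN _ _ ((hη.specializes hst).map continuous_subtype_val))

/-- The number of connected components of the geometric fibers of a family of branchvarieties is
locally constant. -/
theorem IsBranchFamily.isLocallyConstant_numGeometricComponents {n : ℕ} {S X : Scheme.{u}}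
    [IsLocallyNoetherian S] {f : X ⟶ projectiveSpace n S}
    (hf : IsBranchFamily f (projectiveSpaceToBase n S)) :
    IsLocallyConstant (numGeometricComponents (f ≫ projectiveSpaceToBase n S)) :=
  isLocallyConstant_of_specializes (fun s => by
    obtain ⟨V, hV, hs, -⟩ := exists_isAffineOpen_mem_and_subset (x := s) (U := ⊤) trivial
    have := IsLocallyNoetherian.component_noetherian ⟨V, hV⟩
    exact ⟨V, V.isOpen, hs, noetherianSpace_of_isAffineOpen V hV⟩)
    fun _ _ h => (hf.numGeometricComponents_eq h).2

end Branch

namespace Branch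

/-! ### A flat family of subschemes with jumping number of components -/

section Quadratic

open TensorProduct QuadraticAlgebra

variable {R Ω : Type u} [CommRing R] (c : R) [Field Ω] [Algebra R Ω]

lemma exists_eq_smul_one_add_smul_omega (a : Ω ⊗[R] QuadraticAlgebra R 0 c) :
    ∃ r s : Ω, a = r • (1 : Ω ⊗[R] QuadraticAlgebra R 0 c) + s • (1 ⊗ₜ[R] ω) := by
  induction a using TensorProduct.induction_on with
  | zero => exact ⟨0, 0, by simp⟩
  | add a b ha hb =>
    obtain ⟨r, s, rfl⟩ := ha
    obtain ⟨r', s', rfl⟩ := hb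
    exact ⟨r + r', s + s', by rw [add_smul, add_smul]; abel⟩
  | tmul r b =>
    refine ⟨b.re • r, b.im • r, ?_⟩
    rw [Algebra.TensorProduct.one_def, TensorProduct.smul_tmul', TensorProduct.smul_tmul',
      smul_eq_mul, smul_eq_mul, mul_one, mul_one, TensorProduct.smul_tmul, TensorProduct.smul_tmul,
      ← TensorProduct.tmul_add]
    congr 1
    ext <;> simp

/-- If `c` vanishes in `Ω`, then `x` is nilpotent in `Ω[x]/(x² - c x)`. -/
lemma subsingleton_primeSpectrum_of_eq_zero (hc : algebraMap R Ω c = 0) :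
    Subsingleton (PrimeSpectrum (Ω ⊗[R] QuadraticAlgebra R 0 c)) := by
  let x : Ω ⊗[R] QuadraticAlgebra R 0 c := 1 ⊗ₜ[R] ω
  have hx : x * x = 0 := by
    rw [Algebra.TensorProduct.tmul_mul_tmul, omega_mul_omega_eq_add, zero_smul, zero_add,
      TensorProduct.tmul_smul, ← algebraMap_smul Ω c, hc, zero_smul]
  have key : ∀ (p : PrimeSpectrum (Ω ⊗[R] QuadraticAlgebra R 0 c)) a,
      a ∈ p.asIdeal ↔ ∃ s : Ω, a = s • x := by
    intro p a
    have hxp : x ∈ p.asIdeal := by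
      have : x * x ∈ p.asIdeal := hx ▸ p.asIdeal.zero_mem
      exact (p.isPrime.mem_or_mem this).elim id id
    constructor
    · intro ha
      obtain ⟨r, s, rfl⟩ := exists_eq_smul_one_add_smul_omega c a
      have h1 := (p.asIdeal.add_mem_iff_left (Submodule.smul_of_tower_mem _ s hxp)).1 ha
      have hr : r = 0 := by
        by_contra hr
        refine p.isPrime.ne_top ((Ideal.eq_top_iff_one _).2 ?_)
        have := Submodule.smul_of_tower_mem p.asIdeal r⁻¹ h1
        rwa [smul_smul, inv_mul_cancel₀ hr, one_smul] at this
      exact ⟨s, by rw [hr, zero_smul, zero_add]⟩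
    · rintro ⟨s, rfl⟩
      exact Submodule.smul_of_tower_mem _ s hxp
  exact ⟨fun p q => PrimeSpectrum.ext (Ideal.ext fun a => (key p a).trans (key q a).symm)⟩

/-- If `c` is invertible in `Ω`, then `Ω[x]/(x² - c x)` has the nontrivial idempotent `x / c`. -/
lemma not_preconnectedSpace_of_ne_zero (hc : algebraMap R Ω c ≠ 0) :
    ¬ PreconnectedSpace (PrimeSpectrum (Ω ⊗[R] QuadraticAlgebra R 0 c)) := by
  intro H
  let e : Ω ⊗[R] QuadraticAlgebra R 0 c := (algebraMap R Ω c)⁻¹ ⊗ₜ[R] ω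
  have he : IsIdempotentElem e := by
    rw [IsIdempotentElem, Algebra.TensorProduct.tmul_mul_tmul, omega_mul_omega_eq_add, zero_smul,
      zero_add, ← TensorProduct.smul_tmul, Algebra.smul_def, mul_inv_cancel_left₀ hc]
  have hom : ∀ v : Ω, v * v = algebraMap R Ω c * v →
      ∃ φ : (Ω ⊗[R] QuadraticAlgebra R 0 c) →+* Ω, φ e = (algebraMap R Ω c)⁻¹ * v := by
    intro v hv
    refine ⟨(Algebra.TensorProduct.lift (AlgHom.id Ω Ω) (QuadraticAlgebra.lift ⟨v, ?_⟩ :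
      QuadraticAlgebra R 0 c →ₐ[R] Ω) fun _ _ => Commute.all _ _).toRingHom, ?_⟩
    · rw [hv, zero_smul, zero_add, Algebra.smul_def]
    · simp [e]
  obtain ⟨φ, hφ⟩ := hom 0 (by simp)
  obtain ⟨ψ, hψ⟩ := hom (algebraMap R Ω c) rfl
  rw [mul_zero] at hφ
  rw [inv_mul_cancel₀ hc] at hψ
  have hclopen : IsClopen (PrimeSpectrum.basicOpen e : Set _) :=
    PrimeSpectrum.isClopen_iff.2 ⟨e, he, rfl⟩
  let o : PrimeSpectrum Ω := ⊥
  have h0 : PrimeSpectrum.comap φ o ∉ PrimeSpectrum.basicOpen e := by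
    rw [PrimeSpectrum.mem_basicOpen, PrimeSpectrum.comap_asIdeal, Ideal.mem_comap, hφ]
    simp
  have h1 : PrimeSpectrum.comap ψ o ∈ PrimeSpectrum.basicOpen e := by
    rw [PrimeSpectrum.mem_basicOpen, PrimeSpectrum.comap_asIdeal, Ideal.mem_comap, hψ]
    exact fun h => o.isPrime.ne_top ((Ideal.eq_top_iff_one _).2 h)
  rcases isClopen_iff.1 hclopen with h | h
  · exact (h ▸ h1 : PrimeSpectrum.comap ψ o ∈ (∅ : Set _))
  · exact h0 (h ▸ Set.mem_univ (PrimeSpectrum.comap φ o) :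
      PrimeSpectrum.comap φ o ∈ (PrimeSpectrum.basicOpen e : Set _))

end Quadratic

lemma card_connectedComponents_le_one_iff (α : Type*) [TopologicalSpace α] :
    ENat.card (_root_.ConnectedComponents α) ≤ 1 ↔ PreconnectedSpace α := by
  rw [ENat.card_le_one_iff_subsingleton]
  refine ⟨fun h => preconnectedSpace_iff_connectedComponent.2 fun x => ?_, fun _ => inferInstance⟩
  exact Set.eq_univ_of_forall fun y =>
    ConnectedComponents.coe_eq_coe'.1 (Subsingleton.elim (y : _root_.ConnectedComponents α) x)

open TensorProduct in
/-- The geometric fiber of `Spec R[x]/(x² - c x)` at `s` is connected precisely when `c` vanishes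
at `s`. -/
lemma numGeometricComponents_quadratic_le_one_iff {R : Type u} [CommRing R] (c : R)
    (s : Spec (.of R)) :
    numGeometricComponents (Spec.map (CommRingCat.ofHom
      (algebraMap R (QuadraticAlgebra R 0 c)))) s ≤ 1 ↔ c ∈ s.asIdeal := by
  let k := (Spec (.of R)).residueField s
  let Ω := AlgebraicClosure k
  let j : Spec (.of Ω) ⟶ Spec (.of k) := Spec.map (CommRingCat.ofHom (algebraMap k Ω))
  obtain ⟨φ, hφ⟩ : ∃ φ : CommRingCat.of R ⟶ .of Ω,
      Spec.map φ = j ≫ (Spec (.of R)).fromSpecResidueField s :=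
    ⟨_, Spec.map_preimage _⟩
  let _ := φ.hom.toAlgebra
  have hs : c ∈ s.asIdeal ↔ algebraMap R Ω c = 0 := by
    have h1 : Spec.map φ (⊥ : PrimeSpectrum Ω) = s := by
      rw [hφ]
      exact Scheme.fromSpecResidueField_apply s (j (⊥ : PrimeSpectrum Ω))
    conv_lhs => rw [← h1]
    exact Ideal.mem_bot
  let π := Spec.map (CommRingCat.ofHom (algebraMap R (QuadraticAlgebra R 0 c)))
  have H : IsPullback (pullback.fst (π.fiberToSpecResidueField s) j ≫ π.fiberι s)
      (pullback.snd (π.fiberToSpecResidueField s) j) π (Spec.map φ) := by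
    rw [hφ]
    exact (IsPullback.of_hasPullback _ _).paste_horiz
      (IsPullback.of_hasPullback π ((Spec (.of R)).fromSpecResidueField s))
  let E : pullback (π.fiberToSpecResidueField s) j ≅
      Spec (.of (Ω ⊗[R] QuadraticAlgebra R 0 c)) :=
    H.flip.isoPullback ≪≫ pullbackSpecIso R Ω (QuadraticAlgebra R 0 c)
  let e : geometricFiber π s ≃ₜ PrimeSpectrum (Ω ⊗[R] QuadraticAlgebra R 0 c) :=
    Scheme.homeoOfIso E
  rw [numGeometricComponents, card_connectedComponents_le_one_iff, hs]
  constructor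
  · intro h
    by_contra hc
    refine not_preconnectedSpace_of_ne_zero c hc ?_
    exact e.surjective.denseRange.preconnectedSpace e.continuous
  · intro hc
    have := subsingleton_primeSpectrum_of_eq_zero c hc
    have : PreconnectedSpace (PrimeSpectrum (Ω ⊗[R] QuadraticAlgebra R 0 c)) := inferInstance
    exact e.symm.surjective.denseRange.preconnectedSpace e.symm.continuous

section Embedding

open MvPolynomial QuadraticAlgebra

attribute [local instance] MvPolynomial.gradedAlgebra

/-- A ring generated by a single element is a quotient of the coordinate ring of a standard chart
of the projective line over the integers. -/
lemma exists_away_surjective {B : Type u} [CommRing B] {w : B} (hw : Subring.closure {w} = ⊤) :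
    ∃ χ : HomogeneousLocalization.Away (homogeneousSubmodule (Fin 2) (ULift.{u} ℤ)) (X 0) →+* B,
      Function.Surjective χ := by
  let ev : MvPolynomial (Fin 2) (ULift.{u} ℤ) →+* B :=
    eval₂Hom ((Int.castRingHom B).comp ULift.ringEquiv.toRingHom) ![1, w]
  have h0 : ev (X 0) = 1 := by simp [ev]
  have h1 : ev (X 1) = w := by simp [ev]
  let L : Localization.Away (X 0 : MvPolynomial (Fin 2) (ULift.{u} ℤ)) →+* B :=
    IsLocalization.Away.lift (X 0) (g := ev) (h0 ▸ isUnit_one)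
  let χ : HomogeneousLocalization.Away (homogeneousSubmodule (Fin 2) (ULift.{u} ℤ)) (X 0) →+* B :=
    L.comp (algebraMap _ (Localization.Away (X 0 : MvPolynomial (Fin 2) (ULift.{u} ℤ))))
  have hχ : χ (ratio (Fin 2) (ULift.{u} ℤ) 0 1) = w := by
    have h2 := congrArg L (IsLocalization.mk'_spec (Localization.Away _)
      (X 1 : MvPolynomial (Fin 2) (ULift.{u} ℤ)) ⟨X 0, Submonoid.mem_powers _⟩)
    rw [map_mul, IsLocalization.Away.lift_eq, IsLocalization.Away.lift_eq, h0, h1, mul_one] at h2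
    refine Eq.trans (congrArg L ?_) h2
    rw [← Localization.mk_eq_mk']
    exact val_ratio _ _ _ _
  refine ⟨χ, fun b => ?_⟩
  have hb : b ∈ Subring.closure {w} := hw ▸ Subring.mem_top b
  induction hb using Subring.closure_induction with
  | mem b hb => exact ⟨_, hχ.trans (Set.mem_singleton_iff.1 hb).symm⟩
  | zero => exact ⟨0, map_zero χ⟩
  | one => exact ⟨1, map_one χ⟩
  | add a b _ _ ha hb =>
    obtain ⟨⟨a, rfl⟩, ⟨b, rfl⟩⟩ := And.intro ha hb
    exact ⟨a + b, map_add χ a b⟩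
  | neg a _ ha =>
    obtain ⟨a, rfl⟩ := ha
    exact ⟨-a, map_neg χ a⟩
  | mul a b _ _ ha hb =>
    obtain ⟨⟨a, rfl⟩, ⟨b, rfl⟩⟩ := And.intro ha hb
    exact ⟨a * b, map_mul χ a b⟩

lemma closure_omega_eq_top (c : ULift.{u} ℤ) :
    Subring.closure {(ω : QuadraticAlgebra (ULift.{u} ℤ) 0 c)} = ⊤ := by
  refine eq_top_iff.2 ?_
  rintro ⟨⟨a⟩, ⟨b⟩⟩ -
  have hab : (⟨⟨a⟩, ⟨b⟩⟩ : QuadraticAlgebra (ULift.{u} ℤ) 0 c) =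
      (a : QuadraticAlgebra (ULift.{u} ℤ) 0 c) + (b : QuadraticAlgebra (ULift.{u} ℤ) 0 c) * ω := by
    ext <;> simp
  rw [hab]
  exact add_mem (intCast_mem _ a)
    (mul_mem (intCast_mem _ b) (Subring.subset_closure (Set.mem_singleton _)))

/-- The subscheme `x² = c x` of the affine line over the integers is closed in the projective
line. -/
lemma exists_isSubschemeFamily_quadratic (c : ULift.{u} ℤ) :
    ∃ i : Spec (.of (QuadraticAlgebra (ULift.{u} ℤ) 0 c)) ⟶
        projectiveSpace 1 (Spec (.of (ULift.{u} ℤ))),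
      i ≫ projectiveSpaceToBase 1 _ = Spec.map (CommRingCat.ofHom (algebraMap _ _)) ∧
      IsSubschemeFamily i (projectiveSpaceToBase 1 _) := by
  obtain ⟨χ, hχ⟩ := exists_away_surjective (closure_omega_eq_top c)
  let a : Spec (.of (HomogeneousLocalization.Away (homogeneousSubmodule (Fin 2) (ULift.{u} ℤ))
      (X 0))) ⟶ Proj (homogeneousSubmodule (Fin 2) (ULift.{u} ℤ)) :=
    Proj.awayι _ _ (X_mem_homogeneousSubmodule _ _ 0) one_pos
  have ha : IsOpenImmersion a := inferInstance
  let q : Spec (.of (QuadraticAlgebra (ULift.{u} ℤ) 0 c)) ⟶ projectiveSpaceInt.{u} 1 :=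
    Spec.map (CommRingCat.ofHom χ) ≫ a
  have : IsClosedImmersion (Spec.map (CommRingCat.ofHom χ)) :=
    IsClosedImmersion.spec_of_surjective _ hχ
  have hq : Mono q := mono_comp (Spec.map (CommRingCat.ofHom χ)) a
  let π : Spec (.of (QuadraticAlgebra (ULift.{u} ℤ) 0 c)) ⟶ Spec (.of (ULift.{u} ℤ)) :=
    Spec.map (CommRingCat.ofHom (algebraMap _ _))
  have H := isPullback_projectiveSpace 1 (Spec (.of (ULift.{u} ℤ)))
  let i := H.lift q π (Subsingleton.elim _ _)
  have hi : i ≫ projectiveSpaceToBase 1 _ = π := H.lift_snd _ _ _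
  have hfin : IsFinite π := (IsFinite.SpecMap_iff _).2
    (RingHom.finite_algebraMap.2 inferInstance)
  have hflat : Flat π := Flat.SpecMap_iff.2
    (RingHom.flat_algebraMap_iff.2 inferInstance)
  have hproper : IsProper (i ≫ projectiveSpaceToBase 1 _) := hi ▸ inferInstance
  refine ⟨i, hi, ?_, hproper, hi ▸ hflat⟩
  have := isSeparated_projectiveSpaceToBase 1 (Spec (.of (ULift.{u} ℤ)))
  have hmono : Mono i := by
    have : Mono (i ≫ projectiveSpaceToInt 1 _) := by rwa [H.lift_fst]
    exact mono_of_mono i (projectiveSpaceToInt 1 _)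
  exact (IsClosedImmersion.iff_isProper_and_mono i).2
    ⟨.of_comp i (projectiveSpaceToBase 1 _), hmono⟩

end Embedding

/-- The two sections `x = 0` and `x = 2` of the projective line over the integers meet exactly over
the prime `2`. -/
theorem exists_isSubschemeFamily_not_isLocallyConstant :
    ∃ (n : ℕ) (S X : Scheme.{u}) (i : X ⟶ projectiveSpace n S),
      IsLocallyNoetherian S ∧ ConnectedSpace S ∧
        IsSubschemeFamily i (projectiveSpaceToBase n S) ∧
        ¬ IsLocallyConstant (numGeometricComponents (i ≫ projectiveSpaceToBase n S)) := by
  obtain ⟨i, hi, h⟩ := exists_isSubschemeFamily_quadratic.{u} 2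
  have hnoeth : IsNoetherianRing (ULift.{u} ℤ) :=
    isNoetherianRing_of_ringEquiv ℤ ULift.ringEquiv.symm
  have hdom : IsDomain (ULift.{u} ℤ) := ULift.ringEquiv.toMulEquiv.isDomain ℤ
  have hconn : ConnectedSpace (Spec (.of (ULift.{u} ℤ))) :=
    inferInstanceAs (ConnectedSpace (PrimeSpectrum (ULift.{u} ℤ)))
  refine ⟨1, _, _, i, inferInstance, hconn, h, fun hlc => ?_⟩
  have h2 : ¬ IsUnit (2 : ULift.{u} ℤ) := fun hu => by
    have := hu.map (ULift.ringEquiv : ULift.{u} ℤ ≃+* ℤ)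
    rw [map_ofNat] at this
    exact absurd (Int.isUnit_iff.1 this) (by decide)
  obtain ⟨m, hm, hm2⟩ := exists_max_ideal_of_mem_nonunits h2
  let s : Spec (.of (ULift.{u} ℤ)) := (⟨m, hm.isPrime⟩ : PrimeSpectrum (ULift.{u} ℤ))
  let η : Spec (.of (ULift.{u} ℤ)) := (⊥ : PrimeSpectrum (ULift.{u} ℤ))
  have hle := (numGeometricComponents_quadratic_le_one_iff (2 : ULift.{u} ℤ) s).2 hm2
  rw [← hi, hlc.apply_eq_of_preconnectedSpace s η, hi,
    numGeometricComponents_quadratic_le_one_iff] at hle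
  have h20 : (2 : ULift.{u} ℤ) = 0 := hle
  have := congrArg ULift.down h20
  exact absurd this (by decide)

end Branch

theorem mainTheorem7 :
    (∀ (n : ℕ) (S X : Scheme.{u}) [IsLocallyNoetherian S] (f : X ⟶ Branch.projectiveSpace n S),
      Branch.IsBranchFamily f (Branch.projectiveSpaceToBase n S) →
        (∀ s : S,
          Branch.numGeometricComponents (f ≫ Branch.projectiveSpaceToBase n S) s ≠ ⊤) ∧
        IsLocallyConstant
          (Branch.numGeometricComponents (f ≫ Branch.projectiveSpaceToBase n S))) ∧
    (∃ (n : ℕ) (S X : Scheme.{u}) (i : X ⟶ Branch.projectiveSpace n S),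
      IsLocallyNoetherian S ∧ ConnectedSpace S ∧
        Branch.IsSubschemeFamily i (Branch.projectiveSpaceToBase n S) ∧
        ¬ IsLocallyConstant
          (Branch.numGeometricComponents (i ≫ Branch.projectiveSpaceToBase n S))) := by
  refine ⟨fun n S X _ f hf => ⟨fun s => ?_, ?_⟩, ?_⟩
  · exact (hf.numGeometricComponents_eq (specializes_refl s)).1
  · exact hf.isLocallyConstant_numGeometricComponents
  · exact Branch.exists_isSubschemeFamily_not_isLocallyConstant
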